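/- **Setting.** Let $s\in\mathbb N_0$ and let $\mathcal F=\bigoplus_{n\ge 0}\mathcal F_n$ be the symmetric Fock space over $L^2(\mathbb R^s)$, where $\mathcal F_n$ is the space of symmetric functions in $L^2((\mathbb R^s)^n)$. For $f\in L^2(\mathbb R^s)$ let $a^*(f)$ be the creation operator, $a^*(f)\Psi=\sqrt{n+1}\,S(f\otimes\Psi)$ for $\Psi\in\mathcal F_n$ ($S$ the orthogonal projection onto symmetric functions), let $a(f)$ be its adjoint and $N_f=a^*(f)a(f)$. Put $$W_f=a^*(f)(1+N_f)^{-1/2},\qquad W_f^*=(1+N_f)^{-1/2}a(f).$$ Let $N$ be the particle number operator and $P_n$ the projection onto $\bigoplus_{k=0}^n\mathcal F_k$. Let $\mathcal D(\mathbb R^s)\subset L^2(\mathbb R^s)$ be the complex-valued smooth functions with compact support. The resolvent algebra $\mathfrak R$ is the C*-algebra on $\mathcal F$ generated by the resolvents $(i\mu+\phi(f))^{-1}$, $\mu\in\mathbb R\setminus\{0\}$, $f\in\mathcal D(\mathbb R^s)$, where $\phi(f)$ is the selfadjoint closure of $a^*(f)+a(f)$ on the vectors with finitely many nonzero components. A bounded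 operator $T$ on $\mathcal F$ is a tensor of degree $m\in\mathbb Z$ if $e^{iuN}Te^{-iuN}=e^{ium}T$ for all $u\in\mathbb R$. For $M\in\mathbb N_0$ let $\mathfrak R_M$ be the norm closed linear span of the tensors in $\mathfrak R$ of degrees $-M\le m\le M$. The (extended) field algebra $\overline{\mathfrak F}$ is the norm closure of the set of bounded operators $F$ on $\mathcal F$ for which there is $M\in\mathbb N_0$ such that for every $n\in\mathbb N_0$ there is $R\in\mathfrak R_M$ with $FP_n=RP_n$. **Lemma 5.1.** (i) For every $n\in\mathbb N_0$ there is a constant $c_n$ such that for all $f_1,f_2\in\mathcal D(\mathbb R^s)$ with $\|f_1\|_2=\|f_2\|_2=1$ $$\|(W_{f_1}^*-W_{f_2}^*)P_n\|\le c_n\,\|f_1-f_2\|_2 .$$ (ii) Let $(f_k)_{k\in\mathbb N}$ be a sequence of normalized functions in $\mathcal D(\mathbb R^s)$ which converges in $L^2(\mathbb R^s)$ to $f_\infty$. Then for every $n\in\mathbb N_0$ the sequence $k\mapsto W_{f_k}^*P_n$ is a Cauchy sequence in the norm topology; the sequence $k\mapsto W_{f_k}^*$ converges in the strong operator topology on $\mathcal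 F$ to $W_{f_\infty}^*$; and $W_{f_\infty}^*$ is an isometric tensor in the field algebra, that is, $W_{f_\infty}^*W_{f_\infty}=1$, $e^{iuN}W_{f_\infty}^*e^{-iuN}=e^{-iu}W_{f_\infty}^*$ for all $u\in\mathbb R$, and $W_{f_\infty}^*\in\overline{\mathfrak F}$. -/

import Mathlib

open MeasureTheory Filter Topology
open scoped ENNReal

noncomputable section

namespace BoseFock

/-- Position space `ℝˢ`. -/
abbrev Pos (s : ℕ) : Type := EuclideanSpace ℝ (Fin s)

/-- The single particle space `L²(ℝˢ)`. -/
abbrev OneParticle (s : ℕ) : Type := Lp ℂ 2 (volume : Measure (Pos s))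

/-- The space `L²((ℝˢ)ⁿ)` of all (not necessarily symmetric) `n`-particle wave functions. -/
abbrev WaveFn (s n : ℕ) : Type := Lp ℂ 2 (volume : Measure (Fin n → Pos s))

/-- Test functions with compact support, `𝓓(ℝˢ) ⊆ L²(ℝˢ)`. -/
def testVectors (s : ℕ) : Set (OneParticle s) :=
  {f | ∃ g : TestFunction (⊤ : TopologicalSpace.Opens (Pos s)) ℂ ⊤,
    (f : Pos s → ℂ) =ᵐ[volume] g}

/-! ### Operators on Hilbert space direct sums -/

section DirectSum

variable {G : ℕ → Type*} [∀ n, NormedAddCommGroup (G n)] [∀ n, NormedSpace ℂ (G n)]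

/-- The operator on `⨁ₙ Gₙ` multiplying the `n`-th component by the number `c n`, `|c n| ≤ 1`. -/
def diagonal (G : ℕ → Type*) [∀ n, NormedAddCommGroup (G n)] [∀ n, NormedSpace ℂ (G n)]
    (c : ℕ → ℂ) (hc : ∀ n, ‖c n‖ ≤ 1) : lp G 2 →L[ℂ] lp G 2 :=
  have hle : ∀ (Ψ : lp G 2) (n : ℕ), ‖c n • Ψ n‖ ≤ ‖Ψ n‖ := fun Ψ n => by
    rw [norm_smul]; exact mul_le_of_le_one_left (norm_nonneg _) (hc n)
  LinearMap.mkContinuous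
    { toFun := fun Ψ => ⟨fun n => c n • Ψ n, (lp.memℓp Ψ).mono' (hle Ψ)⟩
      map_add' := fun Ψ Φ => by
        ext n
        exact smul_add (c n) (Ψ n) (Φ n)
      map_smul' := fun a Ψ => by
        ext n
        exact smul_comm (c n) a (Ψ n) }
    1 (fun Ψ => by
      rw [one_mul]
      exact lp.norm_mono two_ne_zero (hle Ψ))

/-- The vector with components `(0, B₀ Ψ₀, B₁ Ψ₁, …)`. -/
def shiftVec (B : (n : ℕ) → (G n →L[ℂ] G (n + 1))) (Ψ : (n : ℕ) → G n) : (n : ℕ) → G n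
  | 0 => 0
  | n + 1 => B n (Ψ n)

lemma shiftVec_hasSum (B : (n : ℕ) → (G n →L[ℂ] G (n + 1))) (C : ℝ) (hC : ∀ n, ‖B n‖ ≤ C)
    (Ψ : lp G 2) :
    Summable (fun n => ‖shiftVec B Ψ n‖ ^ (2 : ℝ)) ∧
      ∑' n, ‖shiftVec B Ψ n‖ ^ (2 : ℝ) ≤ (C * ‖Ψ‖) ^ (2 : ℝ) := by
  have hC0 : 0 ≤ C := (norm_nonneg _).trans (hC 0)
  have h2 : (0 : ℝ) < (2 : ℝ≥0∞).toReal := by norm_num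
  have hs : HasSum (fun n => C ^ (2 : ℝ) * ‖Ψ n‖ ^ (2 : ℝ)) (C ^ (2 : ℝ) * ‖Ψ‖ ^ (2 : ℝ)) := by
    have := (lp.hasSum_norm h2 Ψ).mul_left (C ^ (2 : ℝ))
    simpa using this
  have hle : ∀ n, ‖shiftVec B Ψ (n + 1)‖ ^ (2 : ℝ) ≤ C ^ (2 : ℝ) * ‖Ψ n‖ ^ (2 : ℝ) := fun n => by
    rw [← Real.mul_rpow hC0 (norm_nonneg _)]
    refine Real.rpow_le_rpow (norm_nonneg _) ?_ (by norm_num)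
    exact (B n).le_of_opNorm_le (hC n) (Ψ n)
  have hsum : Summable (fun n => ‖shiftVec B Ψ (n + 1)‖ ^ (2 : ℝ)) :=
    Summable.of_nonneg_of_le (fun n => by positivity) hle hs.summable
  have hsum' : Summable (fun n => ‖shiftVec B Ψ n‖ ^ (2 : ℝ)) := (summable_nat_add_iff 1).1 hsum
  refine ⟨hsum', ?_⟩
  rw [hsum'.tsum_eq_zero_add, Real.mul_rpow hC0 (norm_nonneg _), ← hs.tsum_eq]
  simpa [shiftVec] using hsum.tsum_le_tsum hle hs.summable

/-- The operator `(Ψ₀, Ψ₁, …) ↦ (0, B₀ Ψ₀, B₁ Ψ₁, …)` on `⨁ₙ Gₙ`, for uniformly bounded `Bₙ`. -/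
def raising (B : (n : ℕ) → (G n →L[ℂ] G (n + 1))) (C : ℝ) (hC : ∀ n, ‖B n‖ ≤ C) :
    lp G 2 →L[ℂ] lp G 2 :=
  LinearMap.mkContinuous
    { toFun := fun Ψ => ⟨shiftVec B Ψ, by
        refine memℓp_gen ?_
        simpa using (shiftVec_hasSum B C hC Ψ).1⟩
      map_add' := fun Ψ Φ => by
        ext n
        cases n with
        | zero => exact (add_zero (0 : G 0)).symm
        | succ n => exact map_add (B n) (Ψ n) (Φ n)
      map_smul' := fun a Ψ => by
        ext n
        cases n with
        | zero => exact (smul_zero a).symm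
        | succ n => exact map_smul (B n) a (Ψ n) }
    C (fun Ψ => by
      refine lp.norm_le_of_tsum_le (by norm_num)
        (mul_nonneg ((norm_nonneg _).trans (hC 0)) (norm_nonneg _)) ?_
      simpa using (shiftVec_hasSum B C hC Ψ).2)

end DirectSum

/-! ### The symmetric `n`-particle spaces -/

lemma measurePreserving_perm (s : ℕ) {n : ℕ} (σ : Equiv.Perm (Fin n)) :
    MeasurePreserving (fun x : Fin n → Pos s => x ∘ σ) volume volume := by
  have h := volume_measurePreserving_piCongrLeft (fun _ : Fin n => Pos s) σ.symm
  convert h using 1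
  ext x i j
  have := Equiv.piCongrLeft_apply_apply (fun _ : Fin n => Pos s) σ.symm x (σ i)
  simp only [Equiv.symm_apply_apply] at this
  simp [MeasurableEquiv.coe_piCongrLeft, this]

/-- The action `(U_σ Ψ)(x₁, …, xₙ) = Ψ(x_{σ 1}, …, x_{σ n})` of permutations on wave functions. -/
def permute (s : ℕ) {n : ℕ} (σ : Equiv.Perm (Fin n)) : WaveFn s n →ₗᵢ[ℂ] WaveFn s n :=
  Lp.compMeasurePreservingₗᵢ ℂ (fun x : Fin n → Pos s => x ∘ σ) (measurePreserving_perm s σ)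

/-- The closed subspace of symmetric wave functions. -/
def symmetricFns (s n : ℕ) : Submodule ℂ (WaveFn s n) where
  carrier := {Ψ | ∀ σ : Equiv.Perm (Fin n), permute s σ Ψ = Ψ}
  zero_mem' := fun σ => map_zero _
  add_mem' := fun {a b} ha hb σ => by rw [map_add, ha σ, hb σ]
  smul_mem' := fun c a ha σ => by rw [map_smul, ha σ]

lemma isClosed_symmetricFns (s n : ℕ) : IsClosed (symmetricFns s n : Set (WaveFn s n)) := by
  have : (symmetricFns s n : Set (WaveFn s n))
      = ⋂ σ : Equiv.Perm (Fin n), {Ψ | permute s σ Ψ = Ψ} := by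
    ext Ψ; simp [symmetricFns]
  rw [this]
  exact isClosed_iInter fun σ => isClosed_eq (permute s σ).continuous continuous_id

instance (s n : ℕ) : CompleteSpace (symmetricFns s n) :=
  (isClosed_symmetricFns s n).completeSpace_coe

/-- The `n`-particle space `𝓕ₙ`. -/
def Particles (s n : ℕ) : Type := symmetricFns s n

instance (s n : ℕ) : NormedAddCommGroup (Particles s n) :=
  inferInstanceAs (NormedAddCommGroup (symmetricFns s n))

instance (s n : ℕ) : InnerProductSpace ℂ (Particles s n) :=
  inferInstanceAs (InnerProductSpace ℂ (symmetricFns s n))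

instance (s n : ℕ) : CompleteSpace (Particles s n) :=
  inferInstanceAs (CompleteSpace (symmetricFns s n))

/-- The inclusion of `𝓕ₙ` into the space of all wave functions. -/
def inclusion (s n : ℕ) : Particles s n →L[ℂ] WaveFn s n := (symmetricFns s n).subtypeL

/-- The orthogonal projection (symmetrization) of wave functions onto `𝓕ₙ`. -/
def symmetrize (s n : ℕ) : WaveFn s n →L[ℂ] Particles s n :=
  (symmetricFns s n).orthogonalProjectionOnto

/-- The symmetric Fock space `𝓕 = ⨁ₙ 𝓕ₙ` (Hilbert space direct sum); the component of
`Ψ : Fock s` in `𝓕ₙ` is `Ψ n`. -/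
abbrev Fock (s : ℕ) : Type := lp (fun n : ℕ => Particles s n) 2

/-! ### Creation and annihilation operators -/

lemma measurePreserving_split (s n : ℕ) :
    MeasurePreserving (fun x : Fin (n + 1) → Pos s => (x 0, Fin.tail x)) volume
      ((volume : Measure (Pos s)).prod volume) :=
  volume_preserving_piFinSuccAbove (fun _ : Fin (n + 1) => Pos s) 0

lemma eLpNorm_mul_prod {α β : Type*} [MeasurableSpace α] [MeasurableSpace β] {μ : Measure α}
    {ν : Measure β} [SFinite ν] {f : α → ℂ} {g : β → ℂ} (hf : AEStronglyMeasurable f μ)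
    (hg : AEStronglyMeasurable g ν) :
    eLpNorm (fun z : α × β => f z.1 * g z.2) 2 (μ.prod ν) = eLpNorm f 2 μ * eLpNorm g 2 ν := by
  simp only [eLpNorm_eq_lintegral_rpow_enorm_toReal two_ne_zero ENNReal.ofNat_ne_top, enorm_mul]
  rw [← ENNReal.mul_rpow_of_nonneg _ _ (by norm_num), ← lintegral_prod_mul
    (hf.enorm.pow_const _) (hg.enorm.pow_const _)]
  congr 1
  exact lintegral_congr fun z => ENNReal.mul_rpow_of_nonneg _ _ (by norm_num)

lemma tensor_eLpNorm {s n : ℕ} (f : OneParticle s) (Ψ : WaveFn s n) :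
    eLpNorm (fun x : Fin (n + 1) → Pos s => f (x 0) * Ψ (Fin.tail x)) 2 volume
      = eLpNorm f 2 volume * eLpNorm Ψ 2 volume := by
  have hm : AEStronglyMeasurable (fun z : Pos s × (Fin n → Pos s) => f z.1 * Ψ z.2)
      ((volume : Measure (Pos s)).prod volume) :=
    (Lp.aestronglyMeasurable f).comp_fst.mul (Lp.aestronglyMeasurable Ψ).comp_snd
  rw [← eLpNorm_mul_prod (Lp.aestronglyMeasurable f) (Lp.aestronglyMeasurable Ψ),
    ← eLpNorm_comp_measurePreserving hm (measurePreserving_split s n)]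
  rfl

lemma tensor_memLp {s n : ℕ} (f : OneParticle s) (Ψ : WaveFn s n) :
    MemLp (fun x : Fin (n + 1) → Pos s => f (x 0) * Ψ (Fin.tail x)) 2 volume := by
  refine ⟨?_, ?_⟩
  · exact ((Lp.aestronglyMeasurable f).comp_fst.mul
      (Lp.aestronglyMeasurable Ψ).comp_snd).comp_measurePreserving (measurePreserving_split s n)
  · rw [tensor_eLpNorm]
    exact ENNReal.mul_lt_top (Lp.eLpNorm_lt_top f) (Lp.eLpNorm_lt_top Ψ)

lemma tensor_norm {s n : ℕ} (f : OneParticle s) (Ψ : WaveFn s n) :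
    ‖(tensor_memLp f Ψ).toLp _‖ = ‖f‖ * ‖Ψ‖ := by
  rw [Lp.norm_toLp, tensor_eLpNorm, ENNReal.toReal_mul, Lp.norm_def, Lp.norm_def]

lemma tail_quasiMeasurePreserving (s n : ℕ) :
    Measure.QuasiMeasurePreserving (fun x : Fin (n + 1) → Pos s => Fin.tail x) volume volume :=
  Measure.quasiMeasurePreserving_snd.comp (measurePreserving_split s n).quasiMeasurePreserving

/-- The wave function `(f ⊗ Ψ)(x₀, …, xₙ) = f(x₀) Ψ(x₁, …, xₙ)`. -/
def tensorVec {s n : ℕ} (f : OneParticle s) (Ψ : WaveFn s n) : WaveFn s (n + 1) :=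
  (tensor_memLp f Ψ).toLp _

lemma tensorVec_add {s n : ℕ} (f : OneParticle s) (Ψ Φ : WaveFn s n) :
    tensorVec f (Ψ + Φ) = tensorVec f Ψ + tensorVec f Φ := by
  unfold tensorVec
  rw [← MemLp.toLp_add]
  refine MemLp.toLp_congr _ _ ?_
  filter_upwards [(tail_quasiMeasurePreserving s n).ae (Lp.coeFn_add Ψ Φ)] with x hx
  have hx' : (Ψ + Φ : WaveFn s n) (Fin.tail x) = Ψ (Fin.tail x) + Φ (Fin.tail x) := hx
  exact (congrArg (fun z => f (x 0) * z) hx').trans (mul_add _ _ _)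

lemma tensorVec_smul {s n : ℕ} (f : OneParticle s) (c : ℂ) (Ψ : WaveFn s n) :
    tensorVec f (c • Ψ) = c • tensorVec f Ψ := by
  unfold tensorVec
  rw [← MemLp.toLp_const_smul]
  refine MemLp.toLp_congr _ _ ?_
  filter_upwards [(tail_quasiMeasurePreserving s n).ae (Lp.coeFn_smul c Ψ)] with x hx
  have hx' : (c • Ψ : WaveFn s n) (Fin.tail x) = c * Ψ (Fin.tail x) := hx
  exact (congrArg (fun z => f (x 0) * z) hx').trans (mul_left_comm _ _ _)

/-- The operator `Ψ ↦ f ⊗ Ψ`. -/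
def tensorLeft {s : ℕ} (f : OneParticle s) (n : ℕ) : WaveFn s n →L[ℂ] WaveFn s (n + 1) :=
  LinearMap.mkContinuous
    (E := WaveFn s n) (F := WaveFn s (n + 1)) (σ := RingHom.id ℂ)
    { toFun := tensorVec f, map_add' := tensorVec_add f, map_smul' := tensorVec_smul f }
    ‖f‖ (fun Ψ => (tensor_norm f Ψ).le)

/-- The creation operator `a*(f)`, restricted to `𝓕ₙ`: it maps `Ψ` to `√(n+1) S(f ⊗ Ψ)`, where
`S` is the orthogonal projection onto the symmetric wave functions. -/
def creation {s : ℕ} (f : OneParticle s) (n : ℕ) : Particles s n →L[ℂ] Particles s (n + 1) :=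
  ((Real.sqrt (n + 1) : ℝ) : ℂ) •
    (symmetrize s (n + 1) ∘L tensorLeft f n ∘L inclusion s n)

/-- The annihilation operator `a(f)`, restricted to `𝓕ₙ₊₁`: the adjoint of `a*(f)`. It vanishes
on `𝓕₀`. -/
def annihilation {s : ℕ} (f : OneParticle s) (n : ℕ) : Particles s (n + 1) →L[ℂ] Particles s n :=
  ContinuousLinearMap.adjoint (creation f n)

/-- The operator `N_f = a*(f) a(f)`, restricted to `𝓕ₙ`. -/
def modeNumber {s : ℕ} (f : OneParticle s) : (n : ℕ) → (Particles s n →L[ℂ] Particles s n)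
  | 0 => 0
  | n + 1 => creation f n ∘L annihilation f n

/-! ### Operators on Fock space -/

/-- The projection `P_n` onto the states with at most `n` particles. -/
def atMost (s n : ℕ) : Fock s →L[ℂ] Fock s :=
  diagonal _ (fun k => if k ≤ n then 1 else 0) (fun k => by split_ifs <;> simp)

/-- The unitary `e^{iuN}`, where `N` is the particle number operator. -/
def gauge (s : ℕ) (u : ℝ) : Fock s →L[ℂ] Fock s :=
  diagonal _ (fun n => Complex.exp (((u * n : ℝ) : ℂ) * Complex.I))
    (fun _ => (Complex.norm_exp_ofReal_mul_I _).le)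

/-- The operator `a(f)* (1 + N_f)^{-1/2}`, restricted to `𝓕ₙ`. -/
def isometryPart {s : ℕ} (f : OneParticle s) (n : ℕ) : Particles s n →L[ℂ] Particles s (n + 1) :=
  creation f n ∘L cfc (fun x : ℝ => (1 + x) ^ (-(1 / 2) : ℝ)) (modeNumber f n)

open Classical in
/-- The operator `W_f = a(f)* (1 + N_f)^{-1/2}` on Fock space. Its restrictions to the spaces `𝓕ₙ`
are uniformly bounded by the canonical commutation relations (they are isometries if `‖f‖ = 1`);
the alternative value `0` never occurs. -/
def W {s : ℕ} (f : OneParticle s) : Fock s →L[ℂ] Fock s :=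
  if h : ∃ C : ℝ, ∀ n, ‖isometryPart f n‖ ≤ C then raising (isometryPart f) h.choose h.choose_spec
  else 0

/-! ### The resolvent algebra -/

/-- The action of the field `φ(f) = a*(f) + a(f)` on sequences of components. -/
def fieldAction {s : ℕ} (f : OneParticle s) (Ψ : (n : ℕ) → Particles s n) :
    (n : ℕ) → Particles s n
  | 0 => annihilation f 0 (Ψ 1)
  | n + 1 => creation f n (Ψ n) + annihilation f (n + 1) (Ψ (n + 2))

/-- The graph of the selfadjoint field operator `φ(f)`: the closure of the graph of
`a*(f) + a(f)` on the vectors with finitely many nonzero components. -/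
def fieldGraph {s : ℕ} (f : OneParticle s) : Set (Fock s × Fock s) :=
  closure {p | (∃ k, ∀ n, k ≤ n → p.1 n = 0) ∧ ∀ n, p.2 n = fieldAction f p.1 n}

/-- `R` is the bounded operator `(iμ + φ(f))⁻¹`, defined on all of Fock space: `R Φ = Ψ` holds
exactly if `Ψ` is in the domain of `φ(f)` and `(iμ + φ(f)) Ψ = Φ`. -/
def IsFieldResolvent {s : ℕ} (μ : ℝ) (f : OneParticle s) (R : Fock s →L[ℂ] Fock s) : Prop :=
  ∀ Φ Ψ : Fock s, R Φ = Ψ ↔ (Ψ, Φ - (Complex.I * μ) • Ψ) ∈ fieldGraph f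

/-- The resolvent algebra: the C*-algebra generated by the resolvents `(iμ + φ(f))⁻¹` with real
`μ ≠ 0` and test functions `f`. -/
def resolventAlgebra (s : ℕ) : StarSubalgebra ℂ (Fock s →L[ℂ] Fock s) :=
  (StarAlgebra.adjoin ℂ
    {R | ∃ μ : ℝ, μ ≠ 0 ∧ ∃ f ∈ testVectors s, IsFieldResolvent μ f R}).topologicalClosure

/-- `T` is a tensor of degree `m` under gauge transformations: `e^{iuN} T e^{-iuN} = e^{ium} T`. -/
def IsTensor {s : ℕ} (m : ℤ) (T : Fock s →L[ℂ] Fock s) : Prop :=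
  ∀ u : ℝ, gauge s u * T * gauge s (-u) = Complex.exp (((u * m : ℝ) : ℂ) * Complex.I) • T

/-- The norm closed subspace of the resolvent algebra generated by its tensors of degrees
`-M ≤ m ≤ M`. -/
def tensorSpace (s M : ℕ) : Submodule ℂ (Fock s →L[ℂ] Fock s) :=
  (Submodule.span ℂ
    {R | R ∈ resolventAlgebra s ∧ ∃ m : ℤ, |m| ≤ M ∧ IsTensor m R}).topologicalClosure

/-- The extended field algebra: the norm closure of the set of all bounded operators `F` for which
there is some `M` such that, for every `n`, `F` agrees on the states with at most `n` particles
with some element of `tensorSpace s M`. -/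
def fieldAlgebra (s : ℕ) : Set (Fock s →L[ℂ] Fock s) :=
  closure {F | ∃ M : ℕ, ∀ n : ℕ, ∃ R ∈ tensorSpace s M, F * atMost s n = R * atMost s n}

end BoseFock

end

noncomputable section

namespace BoseFock

/-! ### Jacobi operators on graded Hilbert spaces -/

section Graded

/-! The commutation relation a(f)a*(f) = N_f + ‖f‖² (`annihilation_creation`) is behind everything.
For ‖f‖ = 1 it gives W_f*W_f = (1+N_f)^{-1/2}(1+N_f)(1+N_f)^{-1/2} = 1, and W_f* has degree -1
because W_f adds one particle. It also forces the spectrum of N_f on the n-particle space into {0,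
…, n}, so (1+N_f)^{-1/2} is there a polynomial in N_f, the same for all normalized f. Polynomials
are Lipschitz on balls, and a*(f) and N_f are Lipschitz in f at fixed particle number. This proves
(i) (`exists_lipschitz_star_W`); the Cauchy property follows, and with ‖W_f*‖ ≤ 1 also the strong
convergence.

For membership in the field algebra, let f first be a test function and put W = W_f. The Wold
decomposition of the isometry W gives W*P_n = ∑_{j<n} W^j(1-WW*)W*^{j+1}P_n, so it suffices that
W^j(1-WW*)W*^k lies in the resolvent algebra (`W_pow_mul_sub_mul_mem`). Every unit vector κ of
finite particle number with W*κ = 0 yields a copy of ℓ² with basis W^jκ, on which φ(zf) acts as the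
field z a* + z̄ a of one oscillator. An operator acting in the same way on all these copies is
determined by this action. Hence the elements of the resolvent algebra which do so (together with
their adjoints) are represented faithfully on ℓ², and their image is a C*-algebra containing all
resolvents of the oscillator. Such an algebra contains the matrix units (`rankOne_modeBasis_mem`): a
product K of resolvents of momentum and position is compact, the gauge average of KK* is diagonal
and vanishes at infinity, so it has a finite rank spectral projection, and the ladder operators,
which are limits of resolvent expressions, do the rest. The matrix unit with indices j, k
corresponds to W^j(1-WW*)W*^k.

For the limit function only the restrictions W_{f_k}*P_n converge, not the operators in the
resolvent algebra which extend them. But a tensor x can be replaced by one with the same restriction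
to P_n and norm at most 2‖xP_n‖, by cutting off its modulus (`exists_tensor_norm_le`). The usual
successive approximation then shows that the restrictions of tensors of fixed degree form a closed
set (`exists_tensor_of_tendsto`).

Resolvents are available because a field is a block Jacobi operator with coefficients of order √n,
so Carleman's criterion makes it essentially selfadjoint. -/

lemma tendsto_apply {G : ℕ → Type*} [∀ n, NormedAddCommGroup (G n)] {ι : Type*} {l : Filter ι}
    {u : ι → lp G 2} {Ψ : lp G 2} (h : Tendsto u l (𝓝 Ψ)) (n : ℕ) :
    Tendsto (fun i => u i n) l (𝓝 (Ψ n)) := by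
  rw [tendsto_iff_norm_sub_tendsto_zero] at h ⊢
  refine squeeze_zero (fun _ => norm_nonneg _) (fun i => ?_) h
  exact lp.norm_apply_le_norm two_ne_zero (u i - Ψ) n

variable {G : ℕ → Type*} [∀ n, NormedAddCommGroup (G n)] [∀ n, InnerProductSpace ℂ (G n)]

/-- The vectors of `⨁ₙ Gₙ` with finitely many nonzero components. -/
def finiteVectors (G : ℕ → Type*) [∀ n, NormedAddCommGroup (G n)]
    [∀ n, InnerProductSpace ℂ (G n)] : Submodule ℂ (lp G 2) where
  carrier := {Ψ | ∃ k, ∀ n, k ≤ n → Ψ n = 0}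
  zero_mem' := ⟨0, fun _ _ => rfl⟩
  add_mem' := by
    rintro Ψ Φ ⟨k, hk⟩ ⟨l, hl⟩
    refine ⟨max k l, fun n hn => ?_⟩
    rw [lp.coeFn_add, Pi.add_apply, hk n (le_of_max_le_left hn), hl n (le_of_max_le_right hn),
      add_zero]
  smul_mem' := by
    rintro c Ψ ⟨k, hk⟩
    refine ⟨k, fun n hn => ?_⟩
    rw [lp.coeFn_smul, Pi.smul_apply, hk n hn, smul_zero]

lemma memℓp_of_finite {G : ℕ → Type*} [∀ n, NormedAddCommGroup (G n)] {x : ∀ n, G n}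
    (h : ∃ k, ∀ n, k ≤ n → x n = 0) : Memℓp x 2 := by
  obtain ⟨k, hk⟩ := h
  have h0 : Memℓp x 0 := memℓp_zero ?_
  · exact h0.of_exponent_ge zero_le
  refine (Set.finite_lt_nat k).subset fun n hn => ?_
  by_contra hlt
  exact hn (hk n (not_lt.1 hlt))

lemma single_mem_finiteVectors (n : ℕ) (x : G n) : lp.single 2 n x ∈ finiteVectors G :=
  ⟨n + 1, fun m hm => lp.single_apply_ne 2 n x (by omega)⟩

lemma dense_finiteVectors : Dense (finiteVectors G : Set (lp G 2)) := by
  intro Ψ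
  refine mem_closure_of_tendsto (lp.hasSum_single ENNReal.ofNat_ne_top Ψ) (Eventually.of_forall ?_)
  intro s
  exact Submodule.sum_mem _ fun n _ => single_mem_finiteVectors n _

lemma inner_eq_sum_of_finite {Φ Ψ : lp G 2} {k : ℕ} (hk : ∀ n, k ≤ n → Φ n = 0) {m : ℕ}
    (hm : k ≤ m) : inner ℂ Φ Ψ = ∑ n ∈ Finset.range m, inner ℂ (Φ n) (Ψ n) := by
  rw [lp.inner_eq_tsum]
  refine tsum_eq_sum fun n hn => ?_
  rw [hk n (hm.trans (not_lt.1 fun h => hn (Finset.mem_range.2 h))), inner_zero_left]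

lemma ext_on_finiteVectors {H : Type*} [NormedAddCommGroup H] [NormedSpace ℂ H]
    {A A' : lp G 2 →L[ℂ] H} (h : ∀ n x, A (lp.single 2 n x) = A' (lp.single 2 n x)) : A = A' := by
  ext Ψ
  have h1 := (lp.hasSum_single ENNReal.ofNat_ne_top Ψ).mapL A
  have h2 := (lp.hasSum_single ENNReal.ofNat_ne_top Ψ).mapL A'
  simp only [h] at h1
  exact h1.unique h2

variable [∀ n, CompleteSpace (G n)]

/-- The action of the symmetric operator `B + B*` on sequences of components, where `B` raises the
degree by one. -/
def jacobi (B : (n : ℕ) → (G n →L[ℂ] G (n + 1))) : (∀ n, G n) →ₗ[ℂ] (∀ n, G n) where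
  toFun Ψ
    | 0 => ContinuousLinearMap.adjoint (B 0) (Ψ 1)
    | n + 1 => B n (Ψ n) + ContinuousLinearMap.adjoint (B (n + 1)) (Ψ (n + 2))
  map_add' Ψ Φ := by
    ext n
    cases n with
    | zero => exact map_add _ _ _
    | succ n =>
      simp only [Pi.add_apply, map_add]
      abel
  map_smul' c Ψ := by
    ext n
    cases n with
    | zero => exact map_smul _ _ _
    | succ n => simp only [Pi.smul_apply, map_smul, smul_add, RingHom.id_apply]

variable (B : (n : ℕ) → (G n →L[ℂ] G (n + 1)))

@[simp] lemma jacobi_zero (Ψ : ∀ n, G n) :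
    jacobi B Ψ 0 = ContinuousLinearMap.adjoint (B 0) (Ψ 1) := rfl

@[simp] lemma jacobi_succ (Ψ : ∀ n, G n) (n : ℕ) :
    jacobi B Ψ (n + 1)
      = B n (Ψ n) + ContinuousLinearMap.adjoint (B (n + 1)) (Ψ (n + 2)) := rfl

lemma jacobi_finite {Ψ : ∀ n, G n} {k : ℕ} (hk : ∀ n, k ≤ n → Ψ n = 0) :
    ∀ n, k + 1 ≤ n → jacobi B Ψ n = 0 := by
  intro n hn
  obtain ⟨n, rfl⟩ : ∃ m, n = m + 1 := ⟨n - 1, by omega⟩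
  rw [jacobi_succ, hk n (by omega), hk (n + 2) (by omega), map_zero, map_zero, add_zero]

/-- The operator `B + B*` on the vectors with finitely many nonzero components. -/
def jacobiFin : finiteVectors G →ₗ[ℂ] finiteVectors G where
  toFun Ψ := ⟨⟨jacobi B Ψ.1, memℓp_of_finite (by
      obtain ⟨k, hk⟩ := Ψ.2
      exact ⟨k + 1, jacobi_finite B hk⟩)⟩, by
    obtain ⟨k, hk⟩ := Ψ.2
    exact ⟨k + 1, jacobi_finite B hk⟩⟩
  map_add' Ψ Φ := by
    ext n
    exact congrFun (map_add (jacobi B) (Ψ.1 : ∀ n, G n) (Φ.1 : ∀ n, G n)) n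
  map_smul' c Ψ := by
    ext n
    exact congrFun (map_smul (jacobi B) c (Ψ.1 : ∀ n, G n)) n

lemma jacobiFin_apply (Ψ : finiteVectors G) (n : ℕ) :
    (jacobiFin B Ψ : lp G 2) n = jacobi B (Ψ.1 : ∀ n, G n) n := rfl

/-- Green's identity for Jacobi operators. -/
lemma jacobi_green (Φ Ψ : ∀ n, G n) (m : ℕ) :
    ∑ n ∈ Finset.range (m + 1), inner ℂ (jacobi B Φ n) (Ψ n)
        - ∑ n ∈ Finset.range (m + 1), inner ℂ (Φ n) (jacobi B Ψ n)
      = inner ℂ (ContinuousLinearMap.adjoint (B m) (Φ (m + 1))) (Ψ m)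
        - inner ℂ (Φ m) (ContinuousLinearMap.adjoint (B m) (Ψ (m + 1))) := by
  induction m with
  | zero => simp
  | succ m ih =>
    rw [Finset.sum_range_succ, Finset.sum_range_succ (fun n => inner ℂ (Φ n) (jacobi B Ψ n)),
      add_sub_add_comm, ih, jacobi_succ, jacobi_succ, inner_add_left, inner_add_right,
      ContinuousLinearMap.adjoint_inner_right (B m) (Φ m) (Ψ (m + 1)),
      ContinuousLinearMap.adjoint_inner_left (B m) (Ψ m) (Φ (m + 1))]
    ring

/-- The boundary terms of Green's identity vanish because Φ is finite. The vector Ψ need not be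
finite: it only has to satisfy the equation componentwise, as vectors in the range of a resolvent
do. -/
lemma jacobiFin_inner (Φ : finiteVectors G) {Ψ Χ : lp G 2}
    (h : ∀ n, jacobi B (Ψ : ∀ n, G n) n = Χ n) :
    inner ℂ (jacobiFin B Φ : lp G 2) Ψ = inner ℂ (Φ : lp G 2) Χ := by
  obtain ⟨k, hk⟩ := Φ.2
  have h1 := inner_eq_sum_of_finite (Φ := (jacobiFin B Φ : lp G 2)) (Ψ := Ψ)
    (jacobi_finite B hk) le_rfl
  have h2 := inner_eq_sum_of_finite (Ψ := Χ) hk (Nat.le_succ k)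
  have h3 := jacobi_green B (Φ.1 : ∀ n, G n) (Ψ : ∀ n, G n) k
  rw [hk k le_rfl, hk (k + 1) (Nat.le_succ k), map_zero, inner_zero_left, inner_zero_left,
    sub_zero, sub_eq_zero] at h3
  rw [h1, h2]
  refine h3.trans (Finset.sum_congr rfl fun n _ => ?_)
  rw [h n]

lemma jacobiFin_symm (Φ Ψ : finiteVectors G) :
    inner ℂ (jacobiFin B Φ : lp G 2) (Ψ : lp G 2)
      = inner ℂ (Φ : lp G 2) (jacobiFin B Ψ : lp G 2) :=
  jacobiFin_inner B Φ fun _ => rfl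

/-- The operator `iμ + B + B*` on the vectors with finitely many nonzero components. -/
def jacobiShift (μ : ℝ) : finiteVectors G →ₗ[ℂ] finiteVectors G :=
  (Complex.I * μ) • LinearMap.id + jacobiFin B

lemma jacobiShift_apply (μ : ℝ) (Ψ : finiteVectors G) :
    jacobiShift B μ Ψ = (Complex.I * μ) • Ψ + jacobiFin B Ψ := rfl

lemma coe_jacobiShift (μ : ℝ) (Ψ : finiteVectors G) :
    (jacobiShift B μ Ψ : lp G 2) = (Complex.I * μ) • (Ψ : lp G 2) + (jacobiFin B Ψ : lp G 2) := rfl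

/-- By symmetry of B + B*, the imaginary part of ⟨Ψ, (iμ + B + B*)Ψ⟩ is μ‖Ψ‖². -/
lemma norm_le_jacobiShift (μ : ℝ) (Ψ : finiteVectors G) :
    |μ| * ‖(Ψ : lp G 2)‖ ≤ ‖(jacobiShift B μ Ψ : lp G 2)‖ := by
  have him : (inner ℂ (Ψ : lp G 2) (jacobiFin B Ψ : lp G 2) : ℂ).im = 0 := by
    rw [← Complex.conj_eq_iff_im, inner_conj_symm]
    exact jacobiFin_symm B Ψ Ψ
  have h1 : (inner ℂ (Ψ : lp G 2) (jacobiShift B μ Ψ : lp G 2) : ℂ).im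
      = μ * ‖(Ψ : lp G 2)‖ ^ 2 := by
    rw [coe_jacobiShift, inner_add_right, inner_smul_right, Complex.add_im, him,
      inner_self_eq_norm_sq_to_K, add_zero]
    simp [← Complex.ofReal_pow]
  have h2 : |μ| * ‖(Ψ : lp G 2)‖ ^ 2
      ≤ ‖(Ψ : lp G 2)‖ * ‖(jacobiShift B μ Ψ : lp G 2)‖ := by
    calc |μ| * ‖(Ψ : lp G 2)‖ ^ 2 = |μ * ‖(Ψ : lp G 2)‖ ^ 2| := by
          rw [abs_mul, abs_of_nonneg (sq_nonneg ‖(Ψ : lp G 2)‖)]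
      _ ≤ _ := by
        rw [← h1]
        exact (Complex.abs_im_le_norm _).trans (norm_inner_le_norm _ _)
  rcases (norm_nonneg (Ψ : lp G 2)).eq_or_lt with h0 | h0
  · rw [← h0, mul_zero]; exact norm_nonneg _
  · refine le_of_mul_le_mul_left ?_ h0
    calc ‖(Ψ : lp G 2)‖ * (|μ| * ‖(Ψ : lp G 2)‖) = |μ| * ‖(Ψ : lp G 2)‖ ^ 2 := by ring
      _ ≤ _ := h2

/-- Carleman's criterion: the deficiency spaces of a Jacobi operator with coefficients of order
`√n` are trivial. -/
lemma eq_zero_of_jacobi_eq {c : ℝ} (hB : ∀ n, ‖B n‖ ≤ c * Real.sqrt (n + 1)) {μ : ℝ} (hμ : μ ≠ 0)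
    {Ψ : lp G 2} (h : ∀ n, jacobi B (Ψ : ∀ n, G n) n = (Complex.I * μ) • Ψ n) : Ψ = 0 := by
  have hc : 0 ≤ c := by simpa using (norm_nonneg _).trans (hB 0)
  set s : ℕ → ℝ := fun m => ∑ n ∈ Finset.range (m + 1), ‖Ψ n‖ ^ 2 with hs
  -- Green's identity with both arguments equal to Ψ: the eigenvalue equation turns the left side
  -- into -2iμ times the partial sum of ‖Ψ n‖², and the right side is a boundary term with
  -- coefficient of order √m.
  have hbound : ∀ m : ℕ, |μ| * s m ≤ c * Real.sqrt (m + 1) * (‖Ψ m‖ * ‖Ψ (m + 1)‖) := by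
    intro m
    have hg := jacobi_green B (Ψ : ∀ n, G n) (Ψ : ∀ n, G n) m
    have hl : ∑ n ∈ Finset.range (m + 1), inner ℂ (jacobi B (Ψ : ∀ n, G n) n) (Ψ n)
        - ∑ n ∈ Finset.range (m + 1), inner ℂ (Ψ n) (jacobi B (Ψ : ∀ n, G n) n)
        = -2 * Complex.I * (μ * s m : ℝ) := by
      rw [← Finset.sum_sub_distrib, hs]
      simp only [h, inner_smul_left, inner_smul_right, inner_self_eq_norm_sq_to_K]
      push_cast
      rw [Finset.mul_sum, Finset.mul_sum]
      refine Finset.sum_congr rfl fun n _ => ?_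
      simp
      ring
    rw [hl] at hg
    have hn := congrArg norm hg
    have hl2 : ‖-2 * Complex.I * ((μ * s m : ℝ) : ℂ)‖ = 2 * (|μ| * s m) := by
      have : 0 ≤ s m := Finset.sum_nonneg fun n _ => sq_nonneg _
      rw [norm_mul, norm_mul, Complex.norm_real, Real.norm_eq_abs, abs_mul, abs_of_nonneg this]
      simp
    have hr : ∀ x y : G m, ‖(inner ℂ x y : ℂ) - inner ℂ y x‖ ≤ 2 * (‖x‖ * ‖y‖) := by
      intro x y
      calc _ ≤ ‖(inner ℂ x y : ℂ)‖ + ‖(inner ℂ y x : ℂ)‖ := norm_sub_le _ _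
        _ ≤ ‖x‖ * ‖y‖ + ‖y‖ * ‖x‖ := add_le_add (norm_inner_le_norm _ _) (norm_inner_le_norm _ _)
        _ = _ := by ring
    have hadj : ‖ContinuousLinearMap.adjoint (B m) (Ψ (m + 1))‖
        ≤ c * Real.sqrt (m + 1) * ‖Ψ (m + 1)‖ := by
      refine ContinuousLinearMap.le_of_opNorm_le _ ?_ _
      rw [LinearIsometryEquiv.norm_map]
      exact hB m
    have h3 := hr (ContinuousLinearMap.adjoint (B m) (Ψ (m + 1))) (Ψ m)
    rw [← hn, hl2] at h3
    have h4 := mul_le_mul_of_nonneg_right hadj (norm_nonneg (Ψ m))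
    calc |μ| * s m ≤ ‖ContinuousLinearMap.adjoint (B m) (Ψ (m + 1))‖ * ‖Ψ m‖ := by linarith
      _ ≤ _ := h4
      _ = _ := by ring
  have hsq : Summable fun n => ‖Ψ n‖ ^ 2 := by
    simpa using (lp.hasSum_norm (p := 2) (by norm_num) Ψ).summable
  have hprod : Summable fun n => ‖Ψ n‖ * ‖Ψ (n + 1)‖ := by
    refine Summable.of_nonneg_of_le (fun n => by positivity) (fun n => ?_)
      (hsq.add ((summable_nat_add_iff 1).2 hsq))
    nlinarith [sq_nonneg (‖Ψ n‖ - ‖Ψ (n + 1)‖), sq_nonneg ‖Ψ n‖, sq_nonneg ‖Ψ (n + 1)‖]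
  by_contra hne
  obtain ⟨k, hk⟩ : ∃ k, Ψ k ≠ 0 := by
    by_contra hall
    push Not at hall
    exact hne (lp.ext (funext hall))
  have hpos : 0 < ‖Ψ k‖ ^ 2 := by positivity
  have hlow : ∀ m, k ≤ m → ‖Ψ k‖ ^ 2 ≤ s m := fun m hm =>
    Finset.single_le_sum (f := fun n => ‖Ψ n‖ ^ 2) (fun n _ => sq_nonneg _)
      (Finset.mem_range.2 (by omega))
  have hμ' : 0 < |μ| := abs_pos.2 hμ
  have hc' : 0 < c := by
    rcases hc.eq_or_lt with h0 | h0
    · have := hbound k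
      rw [← h0] at this
      have h1 := mul_pos hμ' (hpos.trans_le (hlow k le_rfl))
      linarith [show (0 : ℝ) * Real.sqrt (k + 1) * (‖Ψ k‖ * ‖Ψ (k + 1)‖) = 0 by ring]
    · exact h0
  -- Once the partial sums exceed ‖Ψ k‖², the bound gives 1/(n+k+1) ≤ const · ‖Ψ (n+k)‖‖Ψ (n+k+1)‖,
  -- which is summable, contradicting the divergence of the harmonic series. Replacing √N by N is
  -- harmless here.
  have hdiv : Summable fun n : ℕ => ((n + k + 1 : ℕ) : ℝ)⁻¹ := by
    have hs2 := ((summable_nat_add_iff k).2 hprod).mul_left (c / (|μ| * ‖Ψ k‖ ^ 2))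
    refine Summable.of_nonneg_of_le (fun n => by positivity) (fun n => ?_) hs2
    have h1 := hbound (n + k)
    have h2 := mul_le_mul_of_nonneg_left (hlow (n + k) (by omega)) hμ'.le
    set P := ‖Ψ (n + k)‖ * ‖Ψ (n + k + 1)‖
    have hP : 0 ≤ P := by positivity
    set N : ℝ := ((n + k : ℕ) : ℝ) + 1 with hN
    have hN1 : 1 ≤ N := by rw [hN]; linarith [(Nat.cast_nonneg (n + k) : (0 : ℝ) ≤ _)]
    have hsqrt : Real.sqrt N ≤ N := by
      rw [Real.sqrt_le_left (by linarith)]; nlinarith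
    have h3 : |μ| * ‖Ψ k‖ ^ 2 ≤ c * N * P :=
      (h2.trans h1).trans (by gcongr)
    have hNN : ((n + k + 1 : ℕ) : ℝ) = N := by rw [hN]; push_cast; ring
    rw [hNN, inv_le_iff_one_le_mul₀ (by linarith), div_mul_eq_mul_div, div_mul_eq_mul_div,
      le_div_iff₀ (by positivity)]
    linarith
  refine Real.not_summable_natCast_inv ((summable_nat_add_iff (k + 1)).1 ?_)
  exact hdiv

/-- Testing a vector Ψ orthogonal to the range against vectors with a single component, and moving
the operator across by Green's identity, gives (B + B*)Ψ = iμΨ in each component. Carleman's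
criterion then yields Ψ = 0. -/
lemma denseRange_jacobiShift {c : ℝ} (hB : ∀ n, ‖B n‖ ≤ c * Real.sqrt (n + 1)) {μ : ℝ}
    (hμ : μ ≠ 0) : DenseRange ((finiteVectors G).subtype ∘ₗ jacobiShift B μ) := by
  rw [DenseRange, ← LinearMap.coe_range, Submodule.dense_iff_topologicalClosure_eq_top,
    Submodule.topologicalClosure_eq_top_iff, Submodule.eq_bot_iff]
  intro Ψ hΨ
  rw [Submodule.mem_orthogonal] at hΨ
  refine eq_zero_of_jacobi_eq B hB hμ fun n => ?_
  refine ext_inner_left ℂ fun x => ?_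
  have h1 := hΨ _ ⟨⟨lp.single 2 n x, single_mem_finiteVectors n x⟩, rfl⟩
  set e : finiteVectors G := ⟨lp.single 2 n x, single_mem_finiteVectors n x⟩
  have he : ∀ m, n + 1 ≤ m → (e : lp G 2) m = 0 :=
    fun m hm => lp.single_apply_ne 2 n x (by omega)
  have h2 := jacobi_green B (e.1 : ∀ n, G n) (Ψ : ∀ n, G n) (n + 1)
  rw [he (n + 1) le_rfl, he (n + 1 + 1) (by omega), map_zero, inner_zero_left, inner_zero_left,
    sub_zero, sub_eq_zero] at h2
  have h3 := inner_eq_sum_of_finite (Φ := (jacobiFin B e : lp G 2)) (Ψ := Ψ)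
    (jacobi_finite B he) le_rfl
  have h4 : ∑ m ∈ Finset.range (n + 1 + 1), inner ℂ ((e : lp G 2) m) (jacobi B (Ψ : ∀ n, G n) m)
      = inner ℂ x (jacobi B (Ψ : ∀ n, G n) n) := by
    rw [Finset.sum_eq_single n]
    · rw [show (e : lp G 2) n = x from lp.single_apply_self 2 n x]
    · intro m _ hm
      rw [show (e : lp G 2) m = 0 from lp.single_apply_ne 2 n x hm, inner_zero_left]
    · intro hn; exact absurd (Finset.mem_range.2 (by omega)) hn
  have h5 : inner ℂ (jacobiFin B e : lp G 2) Ψ = inner ℂ x (jacobi B (Ψ : ∀ n, G n) n) := by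
    rw [h3, ← h4, ← h2]; rfl
  have h6 : inner ℂ ((Complex.I * μ) • (e : lp G 2) + (jacobiFin B e : lp G 2)) Ψ = 0 := h1
  rw [inner_add_left, h5, inner_smul_left, show (e : lp G 2) = lp.single 2 n x from rfl,
    lp.inner_single_left] at h6
  rw [inner_smul_right]
  simp only [map_mul, Complex.conj_I, Complex.conj_ofReal] at h6
  linear_combination h6

/-- The graph of the closure of `B + B*`. -/
def jacobiGraph : Set (lp G 2 × lp G 2) :=
  closure {p | (∃ k, ∀ n, k ≤ n → p.1 n = 0) ∧ ∀ n, p.2 n = jacobi B (p.1 : ∀ n, G n) n}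

/-- `R` is the resolvent `(iμ + B + B*)⁻¹` of the closure of `B + B*`. -/
def IsJacobiResolvent (μ : ℝ) (R : lp G 2 →L[ℂ] lp G 2) : Prop :=
  ∀ Φ Ψ : lp G 2, R Φ = Ψ ↔ (Ψ, Φ - (Complex.I * μ) • Ψ) ∈ jacobiGraph B

variable {B}

lemma mem_jacobiGraph (Ψ : finiteVectors G) :
    ((Ψ : lp G 2), (jacobiFin B Ψ : lp G 2)) ∈ jacobiGraph B :=
  subset_closure ⟨Ψ.2, fun _ => rfl⟩

lemma IsJacobiResolvent.apply_shift {μ : ℝ} {R : lp G 2 →L[ℂ] lp G 2}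
    (hR : IsJacobiResolvent B μ R) (Ψ : finiteVectors G) :
    R (jacobiShift B μ Ψ : lp G 2) = Ψ := by
  rw [hR, coe_jacobiShift, add_sub_cancel_left]
  exact mem_jacobiGraph Ψ

lemma continuous_jacobi_apply (n : ℕ) :
    Continuous fun Ψ : lp G 2 => jacobi B (Ψ : ∀ n, G n) n := by
  have h : ∀ n, Continuous fun Ψ : lp G 2 => Ψ n := fun n =>
    continuous_iff_continuousAt.2 fun Ψ => tendsto_apply tendsto_id n
  cases n with
  | zero => exact (ContinuousLinearMap.adjoint (B 0)).continuous.comp (h 1)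
  | succ n =>
    exact ((B n).continuous.comp (h n)).add
      ((ContinuousLinearMap.adjoint (B (n + 1))).continuous.comp (h (n + 2)))

/-- Each component of the formal expression involves at most two components of the vector, so it is
continuous, and the closed operator still acts by the same formula. -/
lemma jacobi_of_mem_graph {p : lp G 2 × lp G 2} (hp : p ∈ jacobiGraph B) (n : ℕ) :
    jacobi B (p.1 : ∀ n, G n) n = p.2 n := by
  have hcl : IsClosed {p : lp G 2 × lp G 2 | jacobi B (p.1 : ∀ n, G n) n = p.2 n} :=
    isClosed_eq ((continuous_jacobi_apply n).comp continuous_fst)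
      ((continuous_iff_continuousAt.2 fun Ψ => tendsto_apply tendsto_id n).comp continuous_snd)
  exact closure_minimal (fun q hq => (hq.2 n).symm) hcl hp

lemma IsJacobiResolvent.jacobi_apply {μ : ℝ} {R : lp G 2 →L[ℂ] lp G 2}
    (hR : IsJacobiResolvent B μ R) (Φ : lp G 2) (n : ℕ) :
    jacobi B (R Φ : ∀ n, G n) n = (Φ - (Complex.I * μ) • R Φ) n :=
  jacobi_of_mem_graph ((hR Φ (R Φ)).1 rfl) n

/-- Vectors RΦ satisfy the resolvent equation componentwise, so symmetry against finite vectors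
suffices. It is not necessary to know that the adjoint is itself the resolvent at -μ. -/
lemma IsJacobiResolvent.adjoint_apply_shift {μ : ℝ} {R : lp G 2 →L[ℂ] lp G 2}
    (hR : IsJacobiResolvent B μ R) (Ψ : finiteVectors G) :
    ContinuousLinearMap.adjoint R (jacobiShift B (-μ) Ψ : lp G 2) = Ψ := by
  refine ext_inner_right ℂ fun Φ => ?_
  rw [ContinuousLinearMap.adjoint_inner_left, coe_jacobiShift, inner_add_left,
    jacobiFin_inner B Ψ (hR.jacobi_apply Φ), inner_sub_right, inner_smul_left, inner_smul_right]
  simp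

/-- The inverse of iμ + B + B* on finite vectors is bounded by |μ|⁻¹ and densely defined, so it
extends to R. Both implications of the resolvent property are closed conditions: one is checked on
the dense range, the other on the graph over finite vectors. -/
lemma exists_isJacobiResolvent {c : ℝ} (hB : ∀ n, ‖B n‖ ≤ c * Real.sqrt (n + 1)) {μ : ℝ}
    (hμ : μ ≠ 0) : ∃ R : lp G 2 →L[ℂ] lp G 2, IsJacobiResolvent B μ R ∧ ‖R‖ ≤ |μ|⁻¹ := by
  have hd := denseRange_jacobiShift B hB hμ
  have hn : ∀ Ψ : finiteVectors G, ‖(finiteVectors G).subtype Ψ‖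
      ≤ |μ|⁻¹ * ‖((finiteVectors G).subtype ∘ₗ jacobiShift B μ) Ψ‖ := fun Ψ => by
    rw [le_inv_mul_iff₀ (abs_pos.2 hμ)]
    exact norm_le_jacobiShift B μ Ψ
  set R := (finiteVectors G).subtype.extendOfNorm ((finiteVectors G).subtype ∘ₗ jacobiShift B μ)
  have hR : ∀ Ψ : finiteVectors G, R (jacobiShift B μ Ψ : lp G 2) = Ψ := fun Ψ =>
    LinearMap.extendOfNorm_eq hd ⟨_, hn⟩ Ψ
  refine ⟨R, fun Φ Ψ => ⟨?_, fun h => ?_⟩,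
    LinearMap.opNorm_extendOfNorm_le hd (by positivity) hn⟩
  · rintro rfl
    have hcl : IsClosed {Φ : lp G 2 | (R Φ, Φ - (Complex.I * μ) • R Φ) ∈ jacobiGraph B} :=
      isClosed_closure.preimage (f := fun Φ => (R Φ, Φ - (Complex.I * μ) • R Φ)) (by fun_prop)
    refine hcl.closure_subset_iff.2 ?_ (hd Φ)
    rintro _ ⟨Ψ, rfl⟩
    have : ((finiteVectors G).subtype ∘ₗ jacobiShift B μ) Ψ
        = (jacobiShift B μ Ψ : lp G 2) := rfl
    rw [Set.mem_ofPred_eq, this, hR, coe_jacobiShift, add_sub_cancel_left]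
    exact mem_jacobiGraph Ψ
  · have hcl : IsClosed {p : lp G 2 × lp G 2 | R (p.2 + (Complex.I * μ) • p.1) = p.1} :=
      isClosed_eq (by fun_prop) (by fun_prop)
    have := closure_minimal (fun q hq => ?_) hcl h
    · simpa using this
    · have h1 := hR ⟨q.1, hq.1⟩
      have h2 : (jacobiFin B ⟨q.1, hq.1⟩ : lp G 2) = q.2 := lp.ext (funext fun n => (hq.2 n).symm)
      rw [coe_jacobiShift, h2, add_comm] at h1
      exact h1

end Graded

/-! ### The canonical commutation relations -/

/-- Rectangles form a π-system generating the product σ-algebra. The induction over measurable sets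
is run inside squares of finite measure exhausting the space, where Φ is integrable and complements
can be subtracted. -/
lemma ae_eq_zero_of_setIntegral_prod_eq_zero {X α β : Type*} [MeasurableSpace X]
    [MeasurableSpace α] [MeasurableSpace β] {ρ : Measure X} {μ : Measure α} {ν : Measure β}
    [SigmaFinite μ] [SigmaFinite ν] (e : X ≃ᵐ α × β) (he : MeasurePreserving e ρ (μ.prod ν))
    {Φ : X → ℂ} (hint : ∀ S, MeasurableSet S → ρ S < ∞ → IntegrableOn Φ S ρ)
    (h : ∀ A B, MeasurableSet A → MeasurableSet B → μ A < ∞ → ν B < ∞ →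
      ∫ x in e ⁻¹' (A ×ˢ B), Φ x ∂ρ = 0) : Φ =ᵐ[ρ] 0 := by
  set E : ℕ → Set X := fun k => e ⁻¹' (spanningSets μ k ×ˢ spanningSets ν k) with hE
  have hEm : ∀ k, MeasurableSet (E k) := fun k => e.measurable
    ((measurableSet_spanningSets μ k).prod (measurableSet_spanningSets ν k))
  have hEf : ∀ k, ρ (E k) < ∞ := fun k => by
    rw [hE, he.measure_preimage_equiv, Measure.prod_prod]
    exact ENNReal.mul_lt_top (measure_spanningSets_lt_top μ k) (measure_spanningSets_lt_top ν k)
  have hEu : ⋃ k, E k = Set.univ := by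
    refine Set.eq_univ_of_forall fun x => Set.mem_iUnion.2
      ⟨max (spanningSetsIndex μ (e x).1) (spanningSetsIndex ν (e x).2), ?_, ?_⟩
    · exact monotone_spanningSets μ (le_max_left _ _) (mem_spanningSetsIndex μ _)
    · exact monotone_spanningSets ν (le_max_right _ _) (mem_spanningSetsIndex ν _)
  have hk : ∀ k, Φ =ᵐ[ρ.restrict (E k)] 0 := by
    intro k
    have hi : Integrable Φ (ρ.restrict (E k)) := hint _ (hEm k) (hEf k)
    have h0 : ∀ T : Set (α × β), MeasurableSet T →
        ∫ x in e ⁻¹' T, Φ x ∂(ρ.restrict (E k)) = 0 := by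
      intro T hT
      induction T, hT using MeasurableSpace.induction_on_inter generateFrom_prod.symm
        isPiSystem_prod with
      | empty => simp
      | basic T hT =>
        obtain ⟨A, hA, B, hB, rfl⟩ := hT
        rw [Measure.restrict_restrict (e.measurable (hA.prod hB)), hE, ← Set.preimage_inter,
          Set.prod_inter_prod]
        exact h _ _ (hA.inter (measurableSet_spanningSets μ k))
          (hB.inter (measurableSet_spanningSets ν k))
          ((measure_mono Set.inter_subset_right).trans_lt (measure_spanningSets_lt_top μ k))
          ((measure_mono Set.inter_subset_right).trans_lt (measure_spanningSets_lt_top ν k))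
      | compl T hT ih =>
        have h1 := integral_add_compl (e.measurable hT) hi
        rw [ih, zero_add] at h1
        rw [Set.preimage_compl, h1]
        exact h _ _ (measurableSet_spanningSets μ k) (measurableSet_spanningSets ν k)
          (measure_spanningSets_lt_top μ k) (measure_spanningSets_lt_top ν k)
      | iUnion T hd hT ih =>
        rw [Set.preimage_iUnion, integral_iUnion (fun i => e.measurable (hT i))
          (fun i j hij => (hd hij).preimage e) hi.integrableOn]
        simp [ih]
    refine hi.ae_eq_zero_of_forall_setIntegral_eq_zero fun S hS _ => ?_
    have := h0 (e.symm ⁻¹' S) (e.symm.measurable hS)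
    rwa [← Set.preimage_comp, e.symm_comp_self, Set.preimage_id] at this
  have := (ae_restrict_iUnion_iff E (fun x => Φ x = 0)).2 hk
  rwa [hEu, Measure.restrict_univ] at this

/-! ### Tensoring with a one-particle function, and the action of permutations. -/

section Tensor

variable {s n : ℕ}

lemma coeFn_tensorLeft (f : OneParticle s) (Ψ : WaveFn s n) :
    (tensorLeft f n Ψ : (Fin (n + 1) → Pos s) → ℂ)
      =ᵐ[volume] fun x => f (x 0) * Ψ (Fin.tail x) :=
  (tensor_memLp f Ψ).coeFn_toLp

lemma norm_tensorLeft_le (f : OneParticle s) (n : ℕ) : ‖tensorLeft f n‖ ≤ ‖f‖ :=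
  LinearMap.mkContinuous_norm_le _ (norm_nonneg f) _

lemma coeFn_permute (σ : Equiv.Perm (Fin n)) (Ψ : WaveFn s n) :
    (permute s σ Ψ : (Fin n → Pos s) → ℂ) =ᵐ[volume] fun x => Ψ (x ∘ σ) :=
  Lp.coeFn_compMeasurePreserving Ψ (measurePreserving_perm s σ)

lemma permute_permute (σ τ : Equiv.Perm (Fin n)) (Ψ : WaveFn s n) :
    permute s σ (permute s τ Ψ) = permute s (σ * τ) Ψ := by
  refine Lp.ext ?_
  have h1 := (measurePreserving_perm s σ).quasiMeasurePreserving.ae (coeFn_permute τ Ψ)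
  filter_upwards [coeFn_permute σ (permute s τ Ψ), h1, coeFn_permute (σ * τ) Ψ] with x h1 h2 h3
  rw [h1, h2, h3]
  rfl

lemma permute_one (Ψ : WaveFn s n) : permute s 1 Ψ = Ψ := by
  refine Lp.ext ?_
  filter_upwards [coeFn_permute 1 Ψ] with x h1
  rw [h1]
  rfl

lemma inner_permute_left (σ : Equiv.Perm (Fin n)) (Φ Ψ : WaveFn s n) :
    inner ℂ (permute s σ Φ) Ψ = inner ℂ Φ (permute s σ⁻¹ Ψ) := by
  rw [← (permute s σ).inner_map_map Φ, permute_permute, mul_inv_cancel, permute_one]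

/-- The extension of a permutation of the last `n` coordinates. -/
def liftPerm (e : Equiv.Perm (Fin n)) : Equiv.Perm (Fin (n + 1)) :=
  Equiv.Perm.decomposeFin.symm (0, e)

lemma liftPerm_zero (e : Equiv.Perm (Fin n)) : liftPerm e 0 = 0 := by simp [liftPerm]

lemma liftPerm_succ (e : Equiv.Perm (Fin n)) (i : Fin n) : liftPerm e i.succ = (e i).succ := by
  simp [liftPerm]

/-- The transpositions of 0 with p represent the cosets of the permutations fixing 0. -/
lemma decomposeFin_symm_eq (p : Fin (n + 1)) (e : Equiv.Perm (Fin n)) :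
    Equiv.Perm.decomposeFin.symm (p, e) = Equiv.swap 0 p * liftPerm e := by
  ext i
  refine Fin.cases ?_ (fun j => ?_) i
  · simp [liftPerm_zero]
  · simp [liftPerm_succ]

lemma permute_liftPerm_tensorLeft (e : Equiv.Perm (Fin n)) (f : OneParticle s) (Ψ : WaveFn s n) :
    permute s (liftPerm e) (tensorLeft f n Ψ) = tensorLeft f n (permute s e Ψ) := by
  refine Lp.ext ?_
  have h1 := (measurePreserving_perm s (liftPerm e)).quasiMeasurePreserving.ae
    (coeFn_tensorLeft f Ψ)
  have h2 := (tail_quasiMeasurePreserving s n).ae (coeFn_permute e Ψ)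
  filter_upwards [coeFn_permute (liftPerm e) (tensorLeft f n Ψ), h1,
    coeFn_tensorLeft f (permute s e Ψ), h2] with x h1 h2 h3 h4
  rw [h1, h2, h3, h4]
  have h5 : Fin.tail (x ∘ liftPerm e) = Fin.tail x ∘ e := by
    ext1 i
    simp [Fin.tail, liftPerm_succ]
  rw [h5, Function.comp_apply, liftPerm_zero]

lemma inner_tensorLeft (f g : OneParticle s) (Φ Ψ : WaveFn s n) :
    inner ℂ (tensorLeft f n Φ) (tensorLeft g n Ψ) = inner ℂ f g * inner ℂ Φ Ψ := by
  rw [L2.inner_def, L2.inner_def, L2.inner_def, ← integral_prod_mul]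
  set F : Pos s × (Fin n → Pos s) → ℂ := fun z =>
    inner ℂ (f z.1) (g z.1) * inner ℂ (Φ z.2) (Ψ z.2) with hF
  have h1 : ∫ x, inner ℂ (tensorLeft f n Φ x) (tensorLeft g n Ψ x)
      = ∫ x : Fin (n + 1) → Pos s, F (x 0, Fin.tail x) := by
    refine integral_congr_ae ?_
    filter_upwards [coeFn_tensorLeft f Φ, coeFn_tensorLeft g Ψ] with x h1 h2
    rw [h1, h2, hF]
    simp
    ring
  rw [h1]
  exact (measurePreserving_split s n).integral_comp
    (MeasurableEquiv.piFinSuccAbove (fun _ => Pos s) 0).measurableEmbedding F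

lemma adjoint_tensorLeft_tensorLeft (f g : OneParticle s) (Ψ : WaveFn s n) :
    ContinuousLinearMap.adjoint (tensorLeft f n) (tensorLeft g n Ψ) = (inner ℂ f g : ℂ) • Ψ := by
  refine ext_inner_left ℂ fun Φ => ?_
  rw [ContinuousLinearMap.adjoint_inner_right, inner_tensorLeft, inner_smul_right]

lemma permute_swap_tensorLeft_tensorLeft (f g : OneParticle s) (Ψ : WaveFn s n) :
    permute s (Equiv.swap 0 1) (tensorLeft f (n + 1) (tensorLeft g n Ψ))
      = tensorLeft g (n + 1) (tensorLeft f n Ψ) := by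
  refine Lp.ext ?_
  have h0 : ∀ f g : OneParticle s, (tensorLeft f (n + 1) (tensorLeft g n Ψ) :
      (Fin (n + 2) → Pos s) → ℂ) =ᵐ[volume]
        fun x => f (x 0) * (g (x 1) * Ψ (Fin.tail (Fin.tail x))) := fun f g => by
    filter_upwards [coeFn_tensorLeft f (tensorLeft g n Ψ),
      (tail_quasiMeasurePreserving s (n + 1)).ae (coeFn_tensorLeft g Ψ)] with x h1 h2
    rw [h1, h2]
    rfl
  have h1 := (measurePreserving_perm s (Equiv.swap (0 : Fin (n + 2)) 1)).quasiMeasurePreserving.ae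
    (h0 f g)
  filter_upwards [coeFn_permute (Equiv.swap 0 1) (tensorLeft f (n + 1) (tensorLeft g n Ψ)), h1,
    h0 g f] with x h1 h2 h3
  rw [h1, h2, h3]
  have h5 : Fin.tail (Fin.tail (x ∘ Equiv.swap 0 1)) = Fin.tail (Fin.tail x) := by
    ext1 i
    simp only [Fin.tail, Function.comp_apply]
    rw [Equiv.swap_apply_of_ne_of_ne (Fin.succ_ne_zero _)]
    intro h
    exact Fin.succ_ne_zero i (Fin.succ_injective _ h)
  rw [h5]
  simp
  ring

/-- Indicator functions of rectangles are simple tensors, so Φ integrates to zero over all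
rectangles of finite measure. -/
lemma eq_zero_of_inner_tensorLeft {Φ : WaveFn s (n + 1)}
    (h : ∀ (g : OneParticle s) (Χ : WaveFn s n), inner ℂ (tensorLeft g n Χ) Φ = 0) : Φ = 0 := by
  refine Lp.ext ((ae_eq_zero_of_setIntegral_prod_eq_zero
    (MeasurableEquiv.piFinSuccAbove (fun _ : Fin (n + 1) => Pos s) 0)
    (volume_preserving_piFinSuccAbove (fun _ : Fin (n + 1) => Pos s) 0) ?_ ?_).trans
    (Lp.coeFn_zero ..).symm)
  · intro S _ hS
    have : IsFiniteMeasure ((volume : Measure (Fin (n + 1) → Pos s)).restrict S) :=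
      ⟨by rwa [Measure.restrict_apply_univ]⟩
    exact ((Lp.memLp Φ).restrict S).integrable (by norm_num)
  · intro A B hA hB hAf hBf
    set S := MeasurableEquiv.piFinSuccAbove (fun _ : Fin (n + 1) => Pos s) 0 ⁻¹' (A ×ˢ B)
    have hS : MeasurableSet S := MeasurableEquiv.measurable _ (hA.prod hB)
    have hSf : volume S ≠ ∞ := by
      rw [(volume_preserving_piFinSuccAbove
        (fun _ : Fin (n + 1) => Pos s) 0).measure_preimage_equiv,
        Measure.volume_eq_prod, Measure.prod_prod]
      exact (ENNReal.mul_lt_top hAf hBf).ne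
    rw [← L2.inner_indicatorConstLp_one hS hSf Φ,
      ← h (indicatorConstLp 2 hA hAf.ne 1) (indicatorConstLp 2 hB hBf.ne 1)]
    congr 1
    refine Lp.ext ?_
    have h1 := ((Measure.quasiMeasurePreserving_fst (μ := volume)
      (ν := (volume : Measure (Fin n → Pos s)))).comp
        (measurePreserving_split s n).quasiMeasurePreserving).ae
      (indicatorConstLp_coeFn (p := 2) (hs := hA) (hμs := hAf.ne) (c := (1 : ℂ)))
    have h2 := (tail_quasiMeasurePreserving s n).ae
      (indicatorConstLp_coeFn (p := 2) (hs := hB) (hμs := hBf.ne) (c := (1 : ℂ)))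
    filter_upwards [coeFn_tensorLeft (indicatorConstLp 2 hA hAf.ne (1 : ℂ))
      (indicatorConstLp 2 hB hBf.ne (1 : ℂ)), h1, h2,
      indicatorConstLp_coeFn (p := 2) (hs := hS) (hμs := hSf) (c := (1 : ℂ))] with x h1 h2 h3 h4
    simp only [Function.comp_apply] at h2
    rw [h1, h2, h3, h4]
    have hxS : x ∈ S ↔ x 0 ∈ A ∧ Fin.tail x ∈ B := Iff.rfl
    by_cases hxA : x 0 ∈ A <;> by_cases hxB : Fin.tail x ∈ B <;> simp [hxA, hxB, hxS]

lemma ext_on_tensorLeft {H : Type*} [NormedAddCommGroup H] [InnerProductSpace ℂ H]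
    [CompleteSpace H] {A B : WaveFn s (n + 1) →L[ℂ] H}
    (h : ∀ (g : OneParticle s) (Χ : WaveFn s n), A (tensorLeft g n Χ) = B (tensorLeft g n Χ)) :
    A = B := by
  rw [← sub_eq_zero, ← LinearIsometryEquiv.map_eq_zero_iff ContinuousLinearMap.adjoint]
  ext1 Φ
  refine eq_zero_of_inner_tensorLeft fun g Χ => ?_
  rw [ContinuousLinearMap.adjoint_inner_right, sub_apply, h, sub_self,
    inner_zero_left]

/-- Checked on tensors g ⊗ Χ: the swap carries f ⊗ g ⊗ Χ to g ⊗ f ⊗ Χ, and contracting with f leaves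
⟨f, g⟩ f ⊗ Χ. This identity is the source of the term a*(f)a(f) in the commutation relation. -/
lemma adjoint_tensorLeft_permute_swap (f : OneParticle s) (Ψ : WaveFn s (n + 1)) :
    ContinuousLinearMap.adjoint (tensorLeft f (n + 1))
        (permute s (Equiv.swap 0 1) (tensorLeft f (n + 1) Ψ))
      = tensorLeft f n (ContinuousLinearMap.adjoint (tensorLeft f n) Ψ) := by
  have : ContinuousLinearMap.adjoint (tensorLeft f (n + 1)) ∘L
      (permute s (Equiv.swap 0 1)).toContinuousLinearMap ∘L tensorLeft f (n + 1)
      = tensorLeft f n ∘L ContinuousLinearMap.adjoint (tensorLeft f n) := by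
    refine ext_on_tensorLeft fun g Χ => ?_
    simp only [ContinuousLinearMap.comp_apply, LinearIsometry.coe_toContinuousLinearMap,
      permute_swap_tensorLeft_tensorLeft, adjoint_tensorLeft_tensorLeft, map_smul]
  exact DFunLike.congr_fun this Ψ

lemma tensorLeft_add (f g : OneParticle s) (n : ℕ) :
    tensorLeft (f + g) n = tensorLeft f n + tensorLeft g n := by
  ext1 Ψ
  refine Lp.ext ?_
  have h1 := ((Measure.quasiMeasurePreserving_fst (μ := volume)
    (ν := (volume : Measure (Fin n → Pos s)))).comp
      (measurePreserving_split s n).quasiMeasurePreserving).ae (Lp.coeFn_add f g)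
  filter_upwards [coeFn_tensorLeft (f + g) Ψ, coeFn_tensorLeft f Ψ, coeFn_tensorLeft g Ψ, h1,
    Lp.coeFn_add (tensorLeft f n Ψ) (tensorLeft g n Ψ)] with x h1 h2 h3 h4 h5
  rw [add_apply, h5, Pi.add_apply, h1, h2, h3, ← add_mul]
  simp only [Function.comp_apply, Pi.add_apply] at h4
  rw [h4]

lemma tensorLeft_smul (c : ℂ) (f : OneParticle s) (n : ℕ) :
    tensorLeft (c • f) n = c • tensorLeft f n := by
  ext1 Ψ
  refine Lp.ext ?_
  have h1 := ((Measure.quasiMeasurePreserving_fst (μ := volume)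
    (ν := (volume : Measure (Fin n → Pos s)))).comp
      (measurePreserving_split s n).quasiMeasurePreserving).ae (Lp.coeFn_smul c f)
  filter_upwards [coeFn_tensorLeft (c • f) Ψ, coeFn_tensorLeft f Ψ, h1,
    Lp.coeFn_smul c (tensorLeft f n Ψ)] with x h1 h2 h3 h4
  rw [smul_apply, h4, Pi.smul_apply, h1, h2]
  simp only [Function.comp_apply, Pi.smul_apply] at h3
  rw [h3, smul_eq_mul, smul_eq_mul, mul_assoc]

end Tensor

/-! ### Symmetrization and the relation between creation and annihilation operators. -/

section Creation

variable {s n : ℕ}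

lemma permute_inclusion (σ : Equiv.Perm (Fin n)) (Ψ : Particles s n) :
    permute s σ (inclusion s n Ψ) = inclusion s n Ψ :=
  Ψ.2 σ

lemma inner_inclusion (Φ Ψ : Particles s n) :
    inner ℂ (inclusion s n Φ) (inclusion s n Ψ) = inner ℂ Φ Ψ := rfl

lemma inner_symmetrize_right (Φ : Particles s n) (Ψ : WaveFn s n) :
    inner ℂ Φ (symmetrize s n Ψ) = inner ℂ (inclusion s n Φ) Ψ :=
  Submodule.inner_orthogonalProjectionOnto_eq_of_mem_left (K := symmetricFns s n) Φ Ψ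

lemma inner_symmetrize_left (Φ : WaveFn s n) (Ψ : Particles s n) :
    inner ℂ (symmetrize s n Φ) Ψ = inner ℂ Φ (inclusion s n Ψ) :=
  Submodule.inner_orthogonalProjectionOnto_eq_of_mem_right (K := symmetricFns s n) Ψ Φ

lemma norm_symmetrize_le (s n : ℕ) : ‖symmetrize s n‖ ≤ 1 :=
  Submodule.orthogonalProjectionOnto_norm_le (symmetricFns s n)

lemma norm_inclusion_le (s n : ℕ) : ‖inclusion s n‖ ≤ 1 :=
  Submodule.norm_subtypeL_le (symmetricFns s n)

/-- Symmetrization is the average over all permutations. -/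
lemma inclusion_symmetrize (Ψ : WaveFn s n) :
    inclusion s n (symmetrize s n Ψ)
      = ((n.factorial : ℂ)⁻¹) • ∑ σ : Equiv.Perm (Fin n), permute s σ Ψ := by
  have hmem : ((n.factorial : ℂ)⁻¹) • ∑ σ : Equiv.Perm (Fin n), permute s σ Ψ
      ∈ symmetricFns s n := by
    intro τ
    rw [map_smul, map_sum]
    congr 1
    simp only [permute_permute]
    exact Fintype.sum_equiv (Equiv.mulLeft τ) _ _ fun σ => rfl
  set Χ : Particles s n := ⟨_, hmem⟩
  have h : symmetrize s n Ψ = Χ := by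
    refine ext_inner_right ℂ fun Φ => ?_
    rw [inner_symmetrize_left, ← inner_inclusion]
    change _ = inner ℂ (((n.factorial : ℂ)⁻¹) • ∑ σ : Equiv.Perm (Fin n), permute s σ Ψ) _
    rw [inner_smul_left, sum_inner]
    simp only [inner_permute_left, permute_inclusion]
    rw [Finset.sum_const, Finset.card_univ, Fintype.card_perm, Fintype.card_fin, nsmul_eq_mul,
      map_inv₀, Complex.conj_natCast, inv_mul_cancel_left₀]
    exact_mod_cast n.factorial_ne_zero
  rw [h]
  rfl

/-- For symmetric Ψ, f ⊗ Ψ is invariant under permutations of the last n coordinates, so the average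
over all permutations collapses to the n + 1 coset representatives. -/
lemma inclusion_symmetrize_tensorLeft (f : OneParticle s) (Ψ : Particles s n) :
    inclusion s (n + 1) (symmetrize s (n + 1) (tensorLeft f n (inclusion s n Ψ)))
      = ((n + 1 : ℂ)⁻¹) • ∑ p : Fin (n + 1),
        permute s (Equiv.swap 0 p) (tensorLeft f n (inclusion s n Ψ)) := by
  rw [inclusion_symmetrize, ← Equiv.Perm.decomposeFin.symm.sum_comp, Fintype.sum_prod_type,
    Nat.factorial_succ]
  simp only [decomposeFin_symm_eq, ← permute_permute, permute_liftPerm_tensorLeft,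
    permute_inclusion, Finset.sum_const, Finset.card_univ, Fintype.card_perm, Fintype.card_fin]
  rw [← Finset.smul_sum, ← Nat.cast_smul_eq_nsmul ℂ, smul_smul]
  congr 1
  have : (n.factorial : ℂ) ≠ 0 := by exact_mod_cast n.factorial_ne_zero
  push_cast
  field_simp

lemma creation_apply (f : OneParticle s) (Ψ : Particles s n) :
    creation f n Ψ = ((Real.sqrt (n + 1) : ℝ) : ℂ) •
      symmetrize s (n + 1) (tensorLeft f n (inclusion s n Ψ)) := rfl

lemma norm_creation_le (f : OneParticle s) (n : ℕ) :
    ‖creation f n‖ ≤ ‖f‖ * Real.sqrt (n + 1) := by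
  rw [creation, norm_smul, Complex.norm_real, Real.norm_of_nonneg (Real.sqrt_nonneg _), mul_comm]
  refine mul_le_mul_of_nonneg_right ?_ (Real.sqrt_nonneg _)
  calc ‖symmetrize s (n + 1) ∘L tensorLeft f n ∘L inclusion s n‖
      ≤ ‖symmetrize s (n + 1)‖ * (‖tensorLeft f n‖ * ‖inclusion s n‖) :=
        (ContinuousLinearMap.opNorm_comp_le _ _).trans
          (mul_le_mul_of_nonneg_left (ContinuousLinearMap.opNorm_comp_le _ _) (norm_nonneg _))
    _ ≤ 1 * (‖f‖ * 1) := by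
        gcongr
        · exact norm_symmetrize_le s (n + 1)
        · exact norm_tensorLeft_le f n
        · exact norm_inclusion_le s n
    _ = ‖f‖ := by ring

lemma creation_add (f g : OneParticle s) (n : ℕ) :
    creation (f + g) n = creation f n + creation g n := by
  ext1 Ψ
  simp only [add_apply, creation_apply, tensorLeft_add, map_add, smul_add]

lemma creation_smul (c : ℂ) (f : OneParticle s) (n : ℕ) :
    creation (c • f) n = c • creation f n := by
  ext1 Ψ
  simp only [smul_apply, creation_apply, tensorLeft_smul, map_smul]
  rw [smul_comm]

lemma creation_sub (f g : OneParticle s) (n : ℕ) :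
    creation (f - g) n = creation f n - creation g n := by
  have := creation_add (f - g) g n
  rw [sub_add_cancel] at this
  rw [this, add_sub_cancel_right]

lemma annihilation_smul (c : ℂ) (f : OneParticle s) (n : ℕ) :
    annihilation (c • f) n = (starRingEnd ℂ c) • annihilation f n := by
  rw [annihilation, creation_smul, map_smulₛₗ]
  rfl

lemma symmetric_adjoint_tensorLeft (f : OneParticle s) (Φ : Particles s (n + 1)) :
    ContinuousLinearMap.adjoint (tensorLeft f n) (inclusion s (n + 1) Φ) ∈ symmetricFns s n := by
  intro e
  refine ext_inner_right ℂ fun Χ => ?_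
  rw [inner_permute_left, ContinuousLinearMap.adjoint_inner_left,
    ContinuousLinearMap.adjoint_inner_left, ← permute_liftPerm_tensorLeft,
    ← inv_inv (liftPerm e⁻¹), ← inner_permute_left, permute_inclusion]

/-- Contracting a symmetric function with f leaves a symmetric function, so annihilation needs no
projection. -/
lemma inclusion_annihilation (f : OneParticle s) (Φ : Particles s (n + 1)) :
    inclusion s n (annihilation f n Φ) = ((Real.sqrt (n + 1) : ℝ) : ℂ) •
      ContinuousLinearMap.adjoint (tensorLeft f n) (inclusion s (n + 1) Φ) := by
  set Χ : Particles s n := ⟨_, symmetric_adjoint_tensorLeft f Φ⟩ with hΧ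
  have hi : inclusion s n Χ
      = ContinuousLinearMap.adjoint (tensorLeft f n) (inclusion s (n + 1) Φ) := rfl
  rw [← hi, ← map_smul]
  congr 1
  refine ext_inner_right ℂ fun Ψ => ?_
  rw [annihilation, ContinuousLinearMap.adjoint_inner_left, creation_apply, inner_smul_right,
    inner_smul_left, inner_symmetrize_right, ← inner_inclusion, hi,
    ContinuousLinearMap.adjoint_inner_left, Complex.conj_ofReal]

/-- Permutations of the last coordinates fix both f ⊗ Φ and f ⊗ Ψ, and they conjugate the
transposition of 0 and p into that of 0 and 1. -/
lemma inner_permute_swap (f : OneParticle s) (Φ Ψ : Particles s (n + 1)) {p : Fin (n + 2)}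
    (hp : p ≠ 0) :
    inner ℂ (tensorLeft f (n + 1) (inclusion s (n + 1) Φ))
        (permute s (Equiv.swap 0 p) (tensorLeft f (n + 1) (inclusion s (n + 1) Ψ)))
      = inner ℂ (tensorLeft f (n + 1) (inclusion s (n + 1) Φ))
        (permute s (Equiv.swap 0 1) (tensorLeft f (n + 1) (inclusion s (n + 1) Ψ))) := by
  obtain ⟨q, rfl⟩ := Fin.exists_succ_eq.2 hp
  have hα : ∀ (e : Equiv.Perm (Fin (n + 1))) (Ψ : Particles s (n + 1)),
      permute s (liftPerm e) (tensorLeft f (n + 1) (inclusion s (n + 1) Ψ))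
        = tensorLeft f (n + 1) (inclusion s (n + 1) Ψ) := fun e Ψ => by
    rw [permute_liftPerm_tensorLeft, permute_inclusion]
  have hswap : Equiv.swap 0 q.succ
      = (liftPerm (Equiv.swap 0 q))⁻¹ * (Equiv.swap 0 1 * liftPerm (Equiv.swap 0 q)) := by
    rw [eq_inv_mul_iff_mul_eq, Equiv.mul_swap_eq_swap_mul, liftPerm_zero, liftPerm_succ,
      Equiv.swap_apply_right]
    rfl
  rw [hswap, ← permute_permute, ← permute_permute, hα, ← inner_permute_left, hα]

/-- The canonical commutation relation `a(f) a*(f) = a*(f) a(f) + ‖f‖²`. -/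
lemma annihilation_creation (f : OneParticle s) (Ψ : Particles s n) :
    annihilation f n (creation f n Ψ) = modeNumber f n Ψ + ((‖f‖ : ℂ) ^ 2) • Ψ := by
  refine ext_inner_left ℂ fun Φ => ?_
  have hsq : ∀ m : ℕ, ((Real.sqrt (m + 1) : ℝ) : ℂ) * ((Real.sqrt (m + 1) : ℝ) : ℂ) = m + 1 := by
    intro m
    rw [← Complex.ofReal_mul, Real.mul_self_sqrt (by positivity)]
    push_cast; ring
  have hL : inner ℂ Φ (annihilation f n (creation f n Ψ))
      = ∑ p : Fin (n + 1), inner ℂ (tensorLeft f n (inclusion s n Φ))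
        (permute s (Equiv.swap 0 p) (tensorLeft f n (inclusion s n Ψ))) := by
    rw [annihilation, ContinuousLinearMap.adjoint_inner_right, creation_apply, creation_apply,
      inner_smul_left, inner_smul_right, inner_symmetrize_left, inclusion_symmetrize_tensorLeft,
      inner_smul_right, inner_sum, Complex.conj_ofReal, ← mul_assoc, hsq, mul_inv_cancel_left₀]
    exact_mod_cast n.succ_ne_zero
  -- The summand p = 0 is the identity permutation and gives ‖f‖². The n remaining summands are all
  -- equal and together give N_f.
  rw [hL, Fin.sum_univ_succ, Equiv.swap_self, inner_add_right, inner_smul_right, add_comm]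
  have h0 : inner ℂ (tensorLeft f n (inclusion s n Φ))
      (permute s (Equiv.refl _) (tensorLeft f n (inclusion s n Ψ)))
      = (‖f‖ : ℂ) ^ 2 * inner ℂ Φ Ψ := by
    rw [show (Equiv.refl (Fin (n + 1))) = 1 from rfl, permute_one, inner_tensorLeft,
      inner_self_eq_norm_sq_to_K]
    rfl
  rw [h0]
  congr 1
  cases n with
  | zero => simp [modeNumber]
  | succ n =>
    simp only [inner_permute_swap f Φ Ψ (Fin.succ_ne_zero _)]
    rw [Finset.sum_const, Finset.card_univ, Fintype.card_fin, nsmul_eq_mul,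
      ← ContinuousLinearMap.adjoint_inner_right, adjoint_tensorLeft_permute_swap,
      ← ContinuousLinearMap.adjoint_inner_left (tensorLeft f n)
        (ContinuousLinearMap.adjoint (tensorLeft f n) (inclusion s (n + 1) Ψ))]
    have h1 : inner ℂ Φ (modeNumber f (n + 1) Ψ)
        = inner ℂ (annihilation f n Φ) (annihilation f n Ψ) :=
      (ContinuousLinearMap.adjoint_inner_left (creation f n) (annihilation f n Ψ) Φ).symm
    rw [h1, ← inner_inclusion, inclusion_annihilation, inclusion_annihilation, inner_smul_left,
      inner_smul_right, Complex.conj_ofReal, ← mul_assoc, hsq]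
    push_cast
    rfl

end Creation

/-! ### Diagonal and raising operators -/

section Operators

variable {G : ℕ → Type*} [∀ n, NormedAddCommGroup (G n)] [∀ n, InnerProductSpace ℂ (G n)]

lemma diagonal_apply (c : ℕ → ℂ) (hc : ∀ n, ‖c n‖ ≤ 1) (Ψ : lp G 2) (n : ℕ) :
    diagonal G c hc Ψ n = c n • Ψ n := rfl

lemma norm_le_of_diagonal {T : lp G 2 →L[ℂ] lp G 2} {c : ℕ → ℂ} (h : ∀ Ψ n, T Ψ n = c n • Ψ n)
    {ρ : ℝ} (hρ : 0 ≤ ρ) (hc : ∀ n, ‖c n‖ ≤ ρ) : ‖T‖ ≤ ρ := by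
  refine T.opNorm_le_bound hρ fun Ψ => ?_
  have h1 : ‖T Ψ‖ ≤ ‖(ρ : ℂ) • Ψ‖ := lp.norm_mono two_ne_zero fun n => by
    rw [h, lp.coeFn_smul, Pi.smul_apply, norm_smul, norm_smul, Complex.norm_real,
      Real.norm_of_nonneg hρ]
    exact mul_le_mul_of_nonneg_right (hc n) (norm_nonneg _)
  rwa [norm_smul, Complex.norm_real, Real.norm_of_nonneg hρ] at h1

lemma norm_diagonal_le (c : ℕ → ℂ) (hc : ∀ n, ‖c n‖ ≤ 1) : ‖diagonal G c hc‖ ≤ 1 :=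
  norm_le_of_diagonal (diagonal_apply c hc) zero_le_one hc

lemma norm_raising_le (B : (n : ℕ) → (G n →L[ℂ] G (n + 1))) (C : ℝ) (hC : ∀ n, ‖B n‖ ≤ C) :
    ‖raising B C hC‖ ≤ C :=
  LinearMap.mkContinuous_norm_le _ ((norm_nonneg _).trans (hC 0)) _

@[simp] lemma raising_apply_zero (B : (n : ℕ) → (G n →L[ℂ] G (n + 1))) (C : ℝ)
    (hC : ∀ n, ‖B n‖ ≤ C) (Ψ : lp G 2) : raising B C hC Ψ 0 = 0 := rfl

@[simp] lemma raising_apply_succ (B : (n : ℕ) → (G n →L[ℂ] G (n + 1))) (C : ℝ)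
    (hC : ∀ n, ‖B n‖ ≤ C) (Ψ : lp G 2) (n : ℕ) : raising B C hC Ψ (n + 1) = B n (Ψ n) := rfl

variable [∀ n, CompleteSpace (G n)]

lemma adjoint_raising_apply (B : (n : ℕ) → (G n →L[ℂ] G (n + 1))) (C : ℝ)
    (hC : ∀ n, ‖B n‖ ≤ C) (Ψ : lp G 2) (n : ℕ) :
    ContinuousLinearMap.adjoint (raising B C hC) Ψ n
      = ContinuousLinearMap.adjoint (B n) (Ψ (n + 1)) := by
  refine ext_inner_left ℂ fun x => ?_
  rw [← lp.inner_single_left, ContinuousLinearMap.adjoint_inner_right,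
    ContinuousLinearMap.adjoint_inner_right]
  have : raising B C hC (lp.single 2 n x) = lp.single 2 (n + 1) (B n x) := by
    ext m
    cases m with
    | zero => rw [raising_apply_zero, lp.single_apply_ne _ _ _ (Nat.succ_ne_zero n).symm]
    | succ m =>
      rw [raising_apply_succ]
      by_cases hm : m = n
      · subst hm
        rw [lp.single_apply_self, lp.single_apply_self]
      · rw [lp.single_apply_ne _ _ _ hm, map_zero, lp.single_apply_ne _ _ _ (by omega)]
  rw [this, lp.inner_single_left]

lemma adjoint_diagonal_apply (c : ℕ → ℂ) (hc : ∀ n, ‖c n‖ ≤ 1) (Ψ : lp G 2) (n : ℕ) :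
    ContinuousLinearMap.adjoint (diagonal G c hc) Ψ n = (starRingEnd ℂ (c n)) • Ψ n := by
  refine ext_inner_left ℂ fun x => ?_
  rw [← lp.inner_single_left, ContinuousLinearMap.adjoint_inner_right]
  have : diagonal G c hc (lp.single 2 n x) = lp.single 2 n (c n • x) := by
    ext m
    rw [diagonal_apply]
    by_cases hm : m = n
    · subst hm
      rw [lp.single_apply_self, lp.single_apply_self]
    · rw [lp.single_apply_ne _ _ _ hm, smul_zero, lp.single_apply_ne _ _ _ hm]
  rw [this, lp.inner_single_left, inner_smul_left, inner_smul_right]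

end Operators

/-! ### A single mode -/

/-- The state space of a single mode. -/
abbrev Mode : Type := lp (fun _ : ℕ => ℂ) 2

/-- The coefficients of the operator `z a* + z̄ a` of a single mode. -/
def ladder (z : ℂ) (n : ℕ) : ℂ →L[ℂ] ℂ := (z * (Real.sqrt (n + 1) : ℝ)) • ContinuousLinearMap.id ℂ ℂ

lemma ladder_apply (z : ℂ) (n : ℕ) (x : ℂ) : ladder z n x = z * (Real.sqrt (n + 1) : ℝ) * x := rfl

lemma adjoint_smul_id (c : ℂ) (x : ℂ) :
    ContinuousLinearMap.adjoint (c • ContinuousLinearMap.id ℂ ℂ) x = starRingEnd ℂ c * x := by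
  refine ext_inner_left ℂ fun y => ?_
  rw [ContinuousLinearMap.adjoint_inner_right]
  simp
  ring

lemma adjoint_ladder_apply (z : ℂ) (n : ℕ) (x : ℂ) :
    ContinuousLinearMap.adjoint (ladder z n) x
      = starRingEnd ℂ z * (Real.sqrt (n + 1) : ℝ) * x := by
  rw [ladder, adjoint_smul_id, map_mul, Complex.conj_ofReal]

lemma norm_ladder_le {z : ℂ} (hz : ‖z‖ = 1) (n : ℕ) : ‖ladder z n‖ ≤ 1 * Real.sqrt (n + 1) := by
  refine ContinuousLinearMap.opNorm_le_bound _ (by positivity) fun x => ?_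
  rw [ladder_apply, norm_mul, norm_mul, hz, Complex.norm_real,
    Real.norm_of_nonneg (Real.sqrt_nonneg _)]

lemma jacobi_ladder_zero (z : ℂ) (x : ℕ → ℂ) :
    jacobi (ladder z) x 0 = starRingEnd ℂ z * x 1 := by
  rw [jacobi_zero, adjoint_ladder_apply]; simp

lemma jacobi_ladder_succ (z : ℂ) (x : ℕ → ℂ) (n : ℕ) :
    jacobi (ladder z) x (n + 1) = z * (Real.sqrt (n + 1) : ℝ) * x n
      + starRingEnd ℂ z * (Real.sqrt (n + 2) : ℝ) * x (n + 2) := by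
  rw [jacobi_succ, adjoint_ladder_apply, ladder_apply,
    show (((n + 1 : ℕ) : ℝ) + 1) = n + 2 by push_cast; ring]

/-- The weighted shift with bounded real weights. -/
def weightedShift (c : ℕ → ℝ) (C : ℝ) (hc : ∀ n, |c n| ≤ C) : Mode →L[ℂ] Mode :=
  raising (G := fun _ => ℂ) (fun n => (c n : ℂ) • ContinuousLinearMap.id ℂ ℂ) C fun n => by
    refine (ContinuousLinearMap.opNorm_le_bound _ (abs_nonneg (c n)) fun x => ?_).trans (hc n)
    simp

section WeightedShift

variable {c : ℕ → ℝ} {C : ℝ} {hc : ∀ n, |c n| ≤ C}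

@[simp] lemma weightedShift_zero (x : Mode) : weightedShift c C hc x 0 = 0 := rfl

@[simp] lemma weightedShift_succ (x : Mode) (n : ℕ) :
    weightedShift c C hc x (n + 1) = c n * x n := rfl

@[simp] lemma adjoint_weightedShift (x : Mode) (n : ℕ) :
    ContinuousLinearMap.adjoint (weightedShift c C hc) x n = c n * x (n + 1) := by
  rw [weightedShift, adjoint_raising_apply, adjoint_smul_id, Complex.conj_ofReal]

lemma norm_weightedShift_le : ‖weightedShift c C hc‖ ≤ C := norm_raising_le _ _ _

lemma norm_smul_weightedShift_le (z w : ℂ) (hz : ‖z‖ = 1) (hw : ‖w‖ = 1) (x : Mode) :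
    ‖z • weightedShift c C hc x + w • ContinuousLinearMap.adjoint (weightedShift c C hc) x‖
      ≤ 2 * C * ‖x‖ := by
  refine (norm_add_le _ _).trans ?_
  rw [norm_smul, norm_smul, hz, hw]
  have h1 := (weightedShift c C hc).le_of_opNorm_le norm_weightedShift_le x
  have h2 := (ContinuousLinearMap.adjoint (weightedShift c C hc)).le_of_opNorm_le
    ((LinearIsometryEquiv.norm_map _ _).trans_le norm_weightedShift_le) x
  linarith

end WeightedShift

/-- A cutoff which decreases slowly from `1` to `0`. -/
def tent (m n : ℕ) : ℝ := ((m - n : ℕ) : ℝ) / m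

lemma tent_nonneg (m n : ℕ) : 0 ≤ tent m n := by unfold tent; positivity

lemma tent_le_one (m n : ℕ) : tent m n ≤ 1 := by
  refine div_le_one_of_le₀ ?_ (by positivity)
  exact_mod_cast Nat.sub_le m n

lemma norm_tent_le (m n : ℕ) : ‖(tent m n : ℂ)‖ ≤ 1 := by
  rw [Complex.norm_real, Real.norm_of_nonneg (tent_nonneg m n)]
  exact tent_le_one m n

lemma tent_eq_zero {m n : ℕ} (h : m ≤ n) : tent m n = 0 := by
  simp [tent, Nat.sub_eq_zero_of_le h]

lemma tent_sub_tent (m n : ℕ) : tent m n - tent m (n + 1) = if n < m then (m : ℝ)⁻¹ else 0 := by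
  split_ifs with h
  · have : ((m - n : ℕ) : ℝ) = ((m - (n + 1) : ℕ) : ℝ) + 1 := by
      have : m - n = m - (n + 1) + 1 := by omega
      exact_mod_cast this
    rw [tent, tent, this]
    ring
  · rw [tent_eq_zero (by omega), tent_eq_zero (by omega), sub_zero]

lemma tendsto_tent (n : ℕ) : Tendsto (fun m => tent m n) atTop (𝓝 1) := by
  have h : Tendsto (fun m : ℕ => 1 - (n : ℝ) * (m : ℝ)⁻¹) atTop (𝓝 (1 - n * 0)) :=
    tendsto_const_nhds.sub (tendsto_inv_atTop_nhds_zero_nat.const_mul _)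
  rw [mul_zero, sub_zero] at h
  refine h.congr' ?_
  filter_upwards [eventually_gt_atTop n] with m hm
  have : (m : ℝ) ≠ 0 := by exact_mod_cast (by omega : m ≠ 0)
  rw [tent, Nat.cast_sub hm.le]
  field_simp

/-- Multiplication by the cutoff. -/
def tentOp (m : ℕ) : Mode →L[ℂ] Mode := diagonal _ (fun n => (tent m n : ℂ)) (norm_tent_le m)

lemma tentOp_apply (m : ℕ) (x : Mode) (n : ℕ) : tentOp m x n = tent m n * x n := rfl

lemma tentOp_mem (m : ℕ) (x : Mode) : tentOp m x ∈ finiteVectors (fun _ : ℕ => ℂ) :=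
  ⟨m, fun n hn => by rw [tentOp_apply, tent_eq_zero hn, Complex.ofReal_zero, zero_mul]⟩

lemma norm_tentOp_le (m : ℕ) (x : Mode) : ‖tentOp m x‖ ≤ ‖x‖ := by
  simpa using (tentOp m).le_of_opNorm_le (norm_diagonal_le _ _) x

/-- The slope of the cutoff is 1/m and it acts only for n < m, where √(n+1) ≤ √m. Hence the
commutator of a field with the cutoff is of order 1/√m. -/
lemma abs_tentWeight_le {m : ℕ} (hm : m ≠ 0) (n : ℕ) :
    |Real.sqrt (n + 1) * (tent m n - tent m (n + 1))| ≤ (Real.sqrt m)⁻¹ := by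
  have hm' : (0 : ℝ) < m := by positivity
  rw [tent_sub_tent]
  split_ifs with h
  · rw [abs_of_nonneg (by positivity), ← div_eq_mul_inv, div_le_iff₀ hm', ← div_eq_inv_mul,
      Real.div_sqrt]
    exact Real.sqrt_le_sqrt (by exact_mod_cast h)
  · simp

/-- The commutator of `z a* + z̄ a` with the cutoff. -/
def tentComm {m : ℕ} (hm : m ≠ 0) (z : ℂ) : Mode →L[ℂ] Mode :=
  z • weightedShift _ _ (abs_tentWeight_le hm)
    + (-starRingEnd ℂ z) • ContinuousLinearMap.adjoint (weightedShift _ _ (abs_tentWeight_le hm))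

lemma tentComm_apply_zero {m : ℕ} (hm : m ≠ 0) (z : ℂ) (x : Mode) :
    tentComm hm z x 0 = -starRingEnd ℂ z
      * ((Real.sqrt (((0 : ℕ) : ℝ) + 1) * (tent m 0 - tent m (0 + 1)) : ℝ) * x 1) := by
  rw [tentComm, add_apply, smul_apply, smul_apply, lp.coeFn_add, Pi.add_apply, lp.coeFn_smul,
    lp.coeFn_smul, Pi.smul_apply, Pi.smul_apply, weightedShift_zero, adjoint_weightedShift]
  simp

lemma tentComm_apply_succ {m : ℕ} (hm : m ≠ 0) (z : ℂ) (x : Mode) (n : ℕ) :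
    tentComm hm z x (n + 1)
      = z * ((Real.sqrt (n + 1) * (tent m n - tent m (n + 1)) : ℝ) * x n)
        + -starRingEnd ℂ z * ((Real.sqrt (((n + 1 : ℕ) : ℝ) + 1)
          * (tent m (n + 1) - tent m (n + 1 + 1)) : ℝ) * x (n + 2)) := by
  rw [tentComm, add_apply, smul_apply, smul_apply, lp.coeFn_add, Pi.add_apply, lp.coeFn_smul,
    lp.coeFn_smul, Pi.smul_apply, Pi.smul_apply, weightedShift_succ, adjoint_weightedShift]
  rfl

lemma jacobi_tentOp {m : ℕ} (hm : m ≠ 0) (z : ℂ) (x : Mode) (n : ℕ) :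
    jacobi (ladder z) (tentOp m x : ∀ _, ℂ) n
      = tent m n * jacobi (ladder z) (x : ∀ _, ℂ) n + tentComm hm z x n := by
  cases n with
  | zero =>
    rw [jacobi_ladder_zero, jacobi_ladder_zero, tentComm_apply_zero, tentOp_apply]
    simp
    ring
  | succ n =>
    rw [jacobi_ladder_succ, jacobi_ladder_succ, tentComm_apply_succ, tentOp_apply, tentOp_apply,
      show (((n + 1 : ℕ) : ℝ) + 1) = n + 2 by push_cast; ring]
    push_cast
    ring

lemma norm_tentComm_le {m : ℕ} (hm : m ≠ 0) {z : ℂ} (hz : ‖z‖ = 1) (x : Mode) :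
    ‖tentComm hm z x‖ ≤ 2 * (Real.sqrt m)⁻¹ * ‖x‖ :=
  norm_smul_weightedShift_le z (-starRingEnd ℂ z) hz (by simpa using hz) x

lemma tentComm_eq_zero {m : ℕ} (hm : m ≠ 0) (z : ℂ) (x : Mode) {n : ℕ} (hn : m + 1 ≤ n) :
    tentComm hm z x n = 0 := by
  obtain ⟨n, rfl⟩ : ∃ k, n = k + 1 := ⟨n - 1, by omega⟩
  rw [tentComm_apply_succ, tent_sub_tent, tent_sub_tent, if_neg (by omega), if_neg (by omega)]
  simp

/-- A field grows only like √m on vectors of degree at most m. Applied to the commutator with the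
cutoff, of order 1/√m, it thus gives a bound independent of m. -/
lemma norm_jacobiFin_ladder_le {z : ℂ} (hz : ‖z‖ = 1) {m : ℕ} (x : finiteVectors fun _ : ℕ => ℂ)
    (hx : ∀ n, m + 1 ≤ n → (x : Mode) n = 0) :
    ‖(jacobiFin (ladder z) x : Mode)‖ ≤ 2 * Real.sqrt (m + 1) * ‖(x : Mode)‖ := by
  -- Removing the weights beyond m does not change the action on x and makes the shift bounded.
  set c : ℕ → ℝ := fun n => if n ≤ m then Real.sqrt (n + 1) else 0
  have hc : ∀ n, |c n| ≤ Real.sqrt (m + 1) := by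
    intro n
    by_cases h : n ≤ m
    · simp only [c, if_pos h, abs_of_nonneg (Real.sqrt_nonneg _)]
      exact Real.sqrt_le_sqrt (by simpa using h)
    · simp only [c, if_neg h, abs_zero]
      positivity
  have h := norm_smul_weightedShift_le (hc := hc) z (starRingEnd ℂ z) hz (by simpa using hz) x
  convert h using 2
  ext n
  rw [jacobiFin_apply, lp.coeFn_add, Pi.add_apply, lp.coeFn_smul, lp.coeFn_smul, Pi.smul_apply,
    Pi.smul_apply, adjoint_weightedShift, smul_eq_mul, smul_eq_mul]
  have hcx : ∀ k, (c k : ℂ) * (x : Mode) k = (Real.sqrt (k + 1) : ℝ) * (x : Mode) k := by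
    intro k
    by_cases h : k ≤ m
    · simp only [c, if_pos h]
    · rw [hx k (by omega), mul_zero, mul_zero]
  have hcx' : ∀ k, (c k : ℂ) * (x : Mode) (k + 1)
      = (Real.sqrt (k + 1) : ℝ) * (x : Mode) (k + 1) := by
    intro k
    by_cases h : k ≤ m
    · simp only [c, if_pos h]
    · rw [hx (k + 1) (by omega), mul_zero, mul_zero]
  cases n with
  | zero =>
    rw [jacobi_ladder_zero, weightedShift_zero, hcx']
    simp
  | succ n =>
    rw [jacobi_ladder_succ, weightedShift_succ, hcx', hcx,
      show (((n + 1 : ℕ) : ℝ) + 1) = n + 2 by push_cast; ring]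
    ring

lemma sqrt_mul_sqrt (n : ℕ) :
    ((Real.sqrt (n + 1) : ℝ) : ℂ) * ((Real.sqrt (n + 1) : ℝ) : ℂ) = n + 1 := by
  rw [← Complex.ofReal_mul, Real.mul_self_sqrt (by positivity)]
  push_cast; ring

/-- The canonical commutation relation `[q, p] = 2i` of a single mode. -/
lemma jacobi_ladder_comm (x : ℕ → ℂ) (n : ℕ) :
    jacobi (ladder Complex.I) (jacobi (ladder 1) x) n
      = jacobi (ladder 1) (jacobi (ladder Complex.I) x) n - 2 * Complex.I * x n := by
  have hs : ∀ n : ℕ, ((Real.sqrt (n + 2) : ℝ) : ℂ) * ((Real.sqrt (n + 2) : ℝ) : ℂ) = n + 2 := by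
    intro n
    rw [← Complex.ofReal_mul, Real.mul_self_sqrt (by positivity)]
    push_cast; ring
  match n with
  | 0 =>
    rw [jacobi_ladder_zero, jacobi_ladder_zero, jacobi_ladder_succ, jacobi_ladder_succ]
    simp
    ring
  | 1 =>
    have h1 : ∀ z (y : ℕ → ℂ), jacobi (ladder z) y 1
        = z * (Real.sqrt ((0 : ℕ) + 1) : ℝ) * y 0
          + starRingEnd ℂ z * (Real.sqrt ((0 : ℕ) + 2) : ℝ) * y 2 :=
      fun z y => jacobi_ladder_succ z y 0
    have h2 : ∀ z (y : ℕ → ℂ), jacobi (ladder z) y 2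
        = z * (Real.sqrt ((1 : ℕ) + 1) : ℝ) * y 1
          + starRingEnd ℂ z * (Real.sqrt ((1 : ℕ) + 2) : ℝ) * y 3 :=
      fun z y => jacobi_ladder_succ z y 1
    have h3 := hs 0
    rw [h1, h1, h2, h2, jacobi_ladder_zero, jacobi_ladder_zero,
      show (((1 : ℕ) : ℝ) + 1) = (0 : ℕ) + 2 by push_cast; ring]
    simp only [map_one, Complex.conj_I, Nat.cast_zero, zero_add, Real.sqrt_one,
      Complex.ofReal_one] at h3 ⊢
    linear_combination (-2 * Complex.I * x 1) * h3
  | n + 2 =>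
    have h0 : ∀ z (y : ℕ → ℂ), jacobi (ladder z) y (n + 1)
        = z * (Real.sqrt (n + 1) : ℝ) * y n
          + starRingEnd ℂ z * (Real.sqrt (n + 2) : ℝ) * y (n + 2) :=
      fun z y => jacobi_ladder_succ z y n
    have h1 : ∀ z (y : ℕ → ℂ), jacobi (ladder z) y (n + 2)
        = z * (Real.sqrt (n + 2) : ℝ) * y (n + 1)
          + starRingEnd ℂ z * (Real.sqrt ((n + 1 : ℕ) + 2) : ℝ) * y (n + 3) := fun z y => by
      rw [jacobi_ladder_succ, show (((n + 1 : ℕ) : ℝ) + 1) = n + 2 by push_cast; ring]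
    have h2 : ∀ z (y : ℕ → ℂ), jacobi (ladder z) y (n + 3)
        = z * (Real.sqrt ((n + 1 : ℕ) + 2) : ℝ) * y (n + 2)
          + starRingEnd ℂ z * (Real.sqrt ((n + 2 : ℕ) + 2) : ℝ) * y (n + 4) := fun z y => by
      rw [jacobi_ladder_succ, show (((n + 2 : ℕ) : ℝ) + 1) = (n + 1 : ℕ) + 2 by push_cast; ring]
    have h3 := hs n
    have h4 := hs (n + 1)
    simp only [h0, h1, h2, map_one, Complex.conj_I]
    push_cast at h4 ⊢
    linear_combination (2 * Complex.I * x (n + 2)) * (h3 - h4)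

/-- The finite vectors of a single mode. -/
abbrev FiniteMode : Submodule ℂ Mode := finiteVectors fun _ : ℕ => ℂ

lemma coe_jacobiShift_one (z : ℂ) (x : FiniteMode) :
    (jacobiShift (ladder z) 1 x : Mode)
      = Complex.I • (x : Mode) + (jacobiFin (ladder z) x : Mode) := by
  rw [coe_jacobiShift]; simp

lemma norm_le_jacobiShift_one (z : ℂ) (x : FiniteMode) :
    ‖(x : Mode)‖ ≤ ‖(jacobiShift (ladder z) 1 x : Mode)‖ := by
  simpa using norm_le_jacobiShift (ladder z) 1 x

/-! ### Compactness of the product of the resolvents of momentum and position. -/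

section Compactness

variable {Rq Rp : Mode →L[ℂ] Mode} (hq : IsJacobiResolvent (ladder 1) 1 Rq)
  (hp : IsJacobiResolvent (ladder Complex.I) 1 Rp) (hq1 : ‖Rq‖ ≤ 1) (hp1 : ‖Rp‖ ≤ 1)

include hq hp hq1 hp1

/-- Write q, p for the fields with z = 1, i, and φ = (i+q)⁻¹Χ, ψ = (i+p)⁻¹φ. Formally pψ = φ - iψ,
and (i+p)qψ = qφ - 2iψ with qφ = Χ - iφ, so qψ is bounded because ‖qψ‖ ≤ ‖(i+p)qψ‖. As q + ip = 2a,
the vector aψ is bounded, which is a weighted bound on the components of ψ. The cutoff makes this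
rigorous on finite vectors, at the price of commutators bounded uniformly in m. -/
lemma weighted_sum_tent_le (Χ : Mode) {m : ℕ} (hm : m ≠ 0) (F : Finset ℕ) :
    ∑ n ∈ F, (n + 1 : ℝ) * ‖(tent m (n + 1) : ℂ) * Rp (Rq Χ) (n + 1)‖ ^ 2 ≤ (8 * ‖Χ‖) ^ 2 := by
  set φ := Rq Χ with hφ
  set ψ := Rp φ with hψ
  have hφΧ : ‖φ‖ ≤ ‖Χ‖ := by simpa using Rq.le_of_opNorm_le hq1 Χ
  have hψΧ : ‖ψ‖ ≤ ‖Χ‖ := (by simpa using Rp.le_of_opNorm_le hp1 φ : ‖ψ‖ ≤ ‖φ‖).trans hφΧ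
  have hsm : (1 : ℝ) ≤ Real.sqrt m :=
    Real.one_le_sqrt.2 (by exact_mod_cast Nat.one_le_iff_ne_zero.2 hm)
  have hsm' : (Real.sqrt m)⁻¹ ≤ 1 := inv_le_one_of_one_le₀ hsm
  have hI : ∀ x : Mode, ‖Complex.I • x‖ = ‖x‖ := fun x => by rw [norm_smul]; simp
  have hφ' : ‖Χ - Complex.I • φ‖ ≤ 2 * ‖Χ‖ := by
    have := norm_sub_le Χ (Complex.I • φ); rw [hI] at this; linarith
  have hψ' : ‖φ - Complex.I • ψ‖ ≤ 2 * ‖Χ‖ := by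
    have := norm_sub_le φ (Complex.I • ψ); rw [hI] at this; linarith
  -- the truncated vectors
  set w : FiniteMode := ⟨tentOp m ψ, tentOp_mem m ψ⟩
  set v : FiniteMode := ⟨tentOp m φ, tentOp_mem m φ⟩
  set k : FiniteMode := ⟨tentComm hm Complex.I ψ, m + 1, fun n hn => tentComm_eq_zero hm _ ψ hn⟩
  have hwn : ‖(w : Mode)‖ ≤ ‖Χ‖ := (norm_tentOp_le m ψ).trans hψΧ
  have hk1 : ‖(k : Mode)‖ ≤ 2 * (Real.sqrt m)⁻¹ * ‖Χ‖ :=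
    (norm_tentComm_le hm (by simp) ψ).trans (by gcongr)
  have hk2 : ‖(k : Mode)‖ ≤ 2 * ‖Χ‖ := hk1.trans (by nlinarith [norm_nonneg Χ])
  have hPw : (jacobiFin (ladder Complex.I) w : Mode) = tentOp m (φ - Complex.I • ψ) + k := by
    ext n
    rw [jacobiFin_apply]
    refine (jacobi_tentOp hm Complex.I ψ n).trans ?_
    rw [hp.jacobi_apply φ n, Complex.ofReal_one, mul_one]
    rfl
  have hQv : (jacobiFin (ladder 1) v : Mode)
      = tentOp m (Χ - Complex.I • φ) + tentComm hm 1 φ := by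
    ext n
    rw [jacobiFin_apply]
    refine (jacobi_tentOp hm 1 φ n).trans ?_
    rw [hq.jacobi_apply Χ n, Complex.ofReal_one, mul_one]
    rfl
  have hPwn : ‖(jacobiFin (ladder Complex.I) w : Mode)‖ ≤ 4 * ‖Χ‖ := by
    rw [hPw]
    have h1 := norm_tentOp_le m (φ - Complex.I • ψ)
    have h2 := norm_add_le (tentOp m (φ - Complex.I • ψ)) (k : Mode)
    linarith
  have hQvn : ‖(jacobiFin (ladder 1) v : Mode)‖ ≤ 4 * ‖Χ‖ := by
    rw [hQv]
    have h1 := norm_tentOp_le m (Χ - Complex.I • φ)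
    have h2 := norm_add_le (tentOp m (Χ - Complex.I • φ)) (tentComm hm 1 φ)
    have h3 : ‖tentComm hm 1 φ‖ ≤ 2 * 1 * ‖Χ‖ :=
      (norm_tentComm_le hm (by simp) φ).trans (by gcongr)
    linarith
  have hQkn : ‖(jacobiFin (ladder 1) k : Mode)‖ ≤ 6 * ‖Χ‖ := by
    refine (norm_jacobiFin_ladder_le (by simp) k
      fun n hn => tentComm_eq_zero hm _ ψ hn).trans ?_
    have h1 : Real.sqrt (m + 1) ≤ 3 / 2 * Real.sqrt m := by
      rw [Real.sqrt_le_left (by positivity), mul_pow, Real.sq_sqrt (Nat.cast_nonneg m)]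
      have : (1 : ℝ) ≤ m := by exact_mod_cast Nat.one_le_iff_ne_zero.2 hm
      linarith
    calc 2 * Real.sqrt (m + 1) * ‖(k : Mode)‖
        ≤ 2 * (3 / 2 * Real.sqrt m) * (2 * (Real.sqrt m)⁻¹ * ‖Χ‖) := by gcongr
      _ = 6 * ‖Χ‖ := by field_simp; ring
  have hsw : jacobiShift (ladder Complex.I) 1 w = v + k := by
    refine Subtype.ext ?_
    rw [coe_jacobiShift_one, hPw, map_sub, map_smul]
    change Complex.I • tentOp m ψ + _ = tentOp m φ + (k : Mode)
    abel
  have hcomm : jacobiShift (ladder Complex.I) 1 (jacobiFin (ladder 1) w)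
      = jacobiFin (ladder 1) v + jacobiFin (ladder 1) k - (2 * Complex.I) • w := by
    rw [← map_add, ← hsw]
    refine Subtype.ext (lp.ext (funext fun n => ?_))
    have h1 := jacobi_ladder_comm ((w : Mode) : ℕ → ℂ) n
    have h2 : jacobiFin (ladder 1) (jacobiShift (ladder Complex.I) 1 w)
        = Complex.I • jacobiFin (ladder 1) w
          + jacobiFin (ladder 1) (jacobiFin (ladder Complex.I) w) := by
      rw [jacobiShift_apply, map_add, map_smul]; simp
    rw [h2, coe_jacobiShift_one]
    change (Complex.I • (jacobiFin (ladder 1) w : Mode)) n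
        + jacobi (ladder Complex.I) (jacobi (ladder 1) ((w : Mode) : ℕ → ℂ)) n
      = (Complex.I • (jacobiFin (ladder 1) w : Mode)) n
        + jacobi (ladder 1) (jacobi (ladder Complex.I) ((w : Mode) : ℕ → ℂ)) n
        - 2 * Complex.I * (w : Mode) n
    rw [h1]
    ring
  -- The constant 12 is 4 + 6 + 2, from the cut off vector φ, the commutator k and the canonical
  -- commutator 2i.
  have hQwn : ‖(jacobiFin (ladder 1) w : Mode)‖ ≤ 12 * ‖Χ‖ := by
    refine (norm_le_jacobiShift_one Complex.I _).trans ?_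
    rw [hcomm]
    have h1 := norm_sub_le ((jacobiFin (ladder 1) v : Mode) + (jacobiFin (ladder 1) k : Mode))
      ((2 * Complex.I) • (w : Mode))
    have h2 := norm_add_le (jacobiFin (ladder 1) v : Mode) (jacobiFin (ladder 1) k : Mode)
    have h3 : ‖(2 * Complex.I) • (w : Mode)‖ = 2 * ‖(w : Mode)‖ := by rw [norm_smul]; simp
    change ‖(jacobiFin (ladder 1) v : Mode) + (jacobiFin (ladder 1) k : Mode)
      - (2 * Complex.I) • (w : Mode)‖ ≤ _
    linarith
  -- This is 2a applied to w, so its squared components carry the factor 4(n+1); hence the bound 16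
  -- for y becomes 8.
  set y : Mode := (jacobiFin (ladder 1) w : Mode)
    + Complex.I • (jacobiFin (ladder Complex.I) w : Mode) with hy
  have hyn : ‖y‖ ≤ 16 * ‖Χ‖ := by
    have := norm_add_le (jacobiFin (ladder 1) w : Mode)
      (Complex.I • (jacobiFin (ladder Complex.I) w : Mode))
    rw [hI] at this
    linarith
  have hyapp : ∀ n : ℕ, y n = 2 * (Real.sqrt (n + 1) : ℝ) * (w : Mode) (n + 1) := by
    intro n
    have h1 : y n = jacobi (ladder 1) ((w : Mode) : ℕ → ℂ) n
        + Complex.I * jacobi (ladder Complex.I) ((w : Mode) : ℕ → ℂ) n := rfl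
    rw [h1]
    cases n with
    | zero =>
      rw [jacobi_ladder_zero, jacobi_ladder_zero]
      simp only [map_one, Complex.conj_I, Nat.cast_zero, zero_add, Real.sqrt_one,
        Complex.ofReal_one]
      linear_combination (-(w : Mode) 1) * Complex.I_mul_I
    | succ n =>
      rw [jacobi_ladder_succ, jacobi_ladder_succ,
        show (((n + 1 : ℕ) : ℝ) + 1) = n + 2 by push_cast; ring]
      simp only [map_one, Complex.conj_I]
      linear_combination ((Real.sqrt (n + 1) : ℝ) * (w : Mode) n
        - (Real.sqrt (n + 2) : ℝ) * (w : Mode) (n + 2)) * Complex.I_mul_I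
  have hsum := lp.sum_rpow_le_norm_rpow (p := 2) (by norm_num) y F
  simp only [ENNReal.toReal_ofNat, Real.rpow_ofNat] at hsum
  have h4 : ∑ n ∈ F, ‖y n‖ ^ 2
      = 4 * ∑ n ∈ F, (n + 1 : ℝ) * ‖(tent m (n + 1) : ℂ) * ψ (n + 1)‖ ^ 2 := by
    rw [Finset.mul_sum]
    refine Finset.sum_congr rfl fun n _ => ?_
    rw [hyapp, norm_mul, norm_mul, mul_pow, mul_pow, Complex.norm_real, Real.norm_eq_abs, sq_abs,
      Real.sq_sqrt (by positivity), show (w : Mode) (n + 1) = tent m (n + 1) * ψ (n + 1) from rfl]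
    simp
    ring
  rw [h4] at hsum
  have h5 : ‖y‖ ^ 2 ≤ (16 * ‖Χ‖) ^ 2 := by gcongr
  nlinarith

lemma weighted_sum_le (Χ : Mode) (F : Finset ℕ) :
    ∑ n ∈ F, (n + 1 : ℝ) * ‖Rp (Rq Χ) (n + 1)‖ ^ 2 ≤ (8 * ‖Χ‖) ^ 2 := by
  have h : Tendsto (fun m => ∑ n ∈ F, (n + 1 : ℝ)
      * ‖(tent m (n + 1) : ℂ) * Rp (Rq Χ) (n + 1)‖ ^ 2) atTop
      (𝓝 (∑ n ∈ F, (n + 1 : ℝ) * ‖((1 : ℝ) : ℂ) * Rp (Rq Χ) (n + 1)‖ ^ 2)) := by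
    refine tendsto_finsetSum _ fun n _ => Tendsto.const_mul _ (Tendsto.pow (Tendsto.norm ?_) 2)
    exact ((Complex.continuous_ofReal.tendsto 1).comp (tendsto_tent (n + 1))).mul_const _
  simp only [Complex.ofReal_one, one_mul] at h
  refine le_of_tendsto h ?_
  filter_upwards [eventually_ne_atTop 0] with m hm
  exact weighted_sum_tent_le hq hp hq1 hp1 Χ hm F

end Compactness

/-! ### Projections onto components of bounded degree. -/

section Truncation

variable {G : ℕ → Type*} [∀ n, NormedAddCommGroup (G n)] [∀ n, InnerProductSpace ℂ (G n)]

/-- The projection onto the components of degree at most `k`. -/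
def truncate (G : ℕ → Type*) [∀ n, NormedAddCommGroup (G n)] [∀ n, InnerProductSpace ℂ (G n)]
    (k : ℕ) : lp G 2 →L[ℂ] lp G 2 :=
  diagonal G (fun n => if n ≤ k then 1 else 0) (fun n => by split_ifs <;> simp)

lemma truncate_apply (k : ℕ) (Ψ : lp G 2) (n : ℕ) :
    truncate G k Ψ n = if n ≤ k then Ψ n else 0 := by
  rw [truncate, diagonal_apply]; split_ifs <;> simp

lemma norm_truncate_le (k : ℕ) : ‖truncate G k‖ ≤ 1 := norm_diagonal_le _ _

lemma truncate_mul_self (k : ℕ) : truncate G k * truncate G k = truncate G k := by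
  ext Ψ n
  rw [mul_apply_eq_comp, truncate_apply, truncate_apply]
  split_ifs <;> rfl

variable [∀ n, CompleteSpace (G n)]

lemma star_truncate (k : ℕ) : star (truncate G k) = truncate G k := by
  ext Ψ n
  rw [ContinuousLinearMap.star_eq_adjoint, truncate, adjoint_diagonal_apply, diagonal_apply]
  split_ifs <;> simp

end Truncation

/-- The projection onto the states of a single mode with at most `k` quanta. -/
abbrev modeCut (k : ℕ) : Mode →L[ℂ] Mode := truncate (fun _ => ℂ) k

/-- The weight n + 1 in `weighted_sum_le` is at least k + 1 on the discarded components, so their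
squared norm is at most (8‖Χ‖)²/(k+1). Thus the product of resolvents is a norm limit of finite rank
operators. -/
lemma norm_sub_truncate_le {Rq Rp : Mode →L[ℂ] Mode} (hq : IsJacobiResolvent (ladder 1) 1 Rq)
    (hp : IsJacobiResolvent (ladder Complex.I) 1 Rp) (hq1 : ‖Rq‖ ≤ 1) (hp1 : ‖Rp‖ ≤ 1) (k : ℕ) :
    ‖Rp * Rq - modeCut k * (Rp * Rq)‖ ≤ 8 / Real.sqrt (k + 1) := by
  refine ContinuousLinearMap.opNorm_le_bound _ (by positivity) fun Χ => ?_
  refine lp.norm_le_of_forall_sum_le (by norm_num) (by positivity) fun F => ?_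
  simp only [ENNReal.toReal_ofNat, Real.rpow_ofNat]
  set ψ := Rp (Rq Χ)
  have happ : ∀ n, ((Rp * Rq - modeCut k * (Rp * Rq)) Χ) n
      = if n ≤ k then 0 else ψ n := by
    intro n
    have : ((Rp * Rq - modeCut k * (Rp * Rq)) Χ) n = ψ n - modeCut k ψ n := rfl
    rw [this, truncate_apply]
    split_ifs <;> simp
  simp only [happ]
  set F' := (F.filter fun n => k < n).image fun n => n - 1 with hF'
  have hF : ∑ n ∈ F, ‖(if n ≤ k then 0 else ψ n : ℂ)‖ ^ 2 = ∑ n ∈ F', ‖ψ (n + 1)‖ ^ 2 := by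
    rw [hF', Finset.sum_image (fun a ha b hb hab => by
      have := (Finset.mem_filter.1 ha).2
      have := (Finset.mem_filter.1 hb).2
      omega), Finset.sum_filter]
    refine Finset.sum_congr rfl fun n _ => ?_
    split_ifs with h1 h2 h2
    · omega
    · simp
    · rw [Nat.sub_add_cancel (by omega)]
    · omega
  have h1 : (k + 1 : ℝ) * ∑ n ∈ F', ‖ψ (n + 1)‖ ^ 2 ≤ (8 * ‖Χ‖) ^ 2 := by
    refine le_trans ?_ (weighted_sum_le hq hp hq1 hp1 Χ F')
    rw [Finset.mul_sum]
    refine Finset.sum_le_sum fun n hn => ?_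
    obtain ⟨l, hl, rfl⟩ := Finset.mem_image.1 hn
    have := (Finset.mem_filter.1 hl).2
    have : (k : ℝ) ≤ (l - 1 : ℕ) := by exact_mod_cast (by omega : k ≤ l - 1)
    gcongr
  rw [hF, div_mul_eq_mul_div, div_pow, Real.sq_sqrt (by positivity), le_div_iff₀ (by positivity)]
  linarith

/-! ### Averages over the gauge group of a single mode -/

/-- The standard basis vectors of a single mode. -/
def modeBasis (j : ℕ) : Mode := lp.single 2 j (1 : ℂ)

lemma modeBasis_apply (j n : ℕ) : modeBasis j n = if n = j then 1 else 0 := by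
  split_ifs with h
  · subst h; exact lp.single_apply_self (E := fun _ => ℂ) 2 n 1
  · exact lp.single_apply_ne (E := fun _ => ℂ) 2 j 1 h

lemma norm_modeBasis (j : ℕ) : ‖modeBasis j‖ = 1 := by
  rw [modeBasis, lp.norm_single (by norm_num)]; simp

lemma inner_modeBasis_left (j : ℕ) (x : Mode) : inner ℂ (modeBasis j) x = x j := by
  rw [modeBasis, lp.inner_single_left]; simp

lemma modeBasis_mem (j : ℕ) : modeBasis j ∈ FiniteMode := single_mem_finiteVectors j _

lemma ext_on_modeBasis {H : Type*} [NormedAddCommGroup H] [NormedSpace ℂ H]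
    {A A' : Mode →L[ℂ] H} (h : ∀ j, A (modeBasis j) = A' (modeBasis j)) : A = A' := by
  refine ext_on_finiteVectors fun n x => ?_
  have : (lp.single 2 n x : Mode) = x • modeBasis n := by
    rw [modeBasis, ← lp.single_smul]; simp
  rw [this, map_smul, map_smul, h]

/-- The gauge transformation `z^N` of a single mode, for `|z| = 1`. -/
def modeGauge (z : ℂ) (hz : ‖z‖ = 1) : Mode →L[ℂ] Mode :=
  diagonal _ (fun n => z ^ n) (fun n => by rw [norm_pow, hz, one_pow])

lemma modeGauge_apply (z : ℂ) (hz : ‖z‖ = 1) (x : Mode) (n : ℕ) :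
    modeGauge z hz x n = z ^ n * x n := rfl

lemma star_modeGauge_apply (z : ℂ) (hz : ‖z‖ = 1) (x : Mode) (n : ℕ) :
    star (modeGauge z hz) x n = starRingEnd ℂ z ^ n * x n := by
  rw [ContinuousLinearMap.star_eq_adjoint, modeGauge, adjoint_diagonal_apply, map_pow]; rfl

lemma mul_conj_of_norm_one {z : ℂ} (hz : ‖z‖ = 1) : z * starRingEnd ℂ z = 1 := by
  rw [Complex.mul_conj, Complex.normSq_eq_norm_sq, hz]; simp

lemma star_modeGauge_mul (z : ℂ) (hz : ‖z‖ = 1) : star (modeGauge z hz) * modeGauge z hz = 1 := by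
  ext x n
  rw [mul_apply_eq_comp, star_modeGauge_apply, modeGauge_apply, ← mul_assoc, ← mul_pow,
    mul_comm (starRingEnd ℂ z), mul_conj_of_norm_one hz, one_pow, one_mul]
  rfl

lemma modeGauge_mul_star (z : ℂ) (hz : ‖z‖ = 1) : modeGauge z hz * star (modeGauge z hz) = 1 := by
  ext x n
  rw [mul_apply_eq_comp, modeGauge_apply, star_modeGauge_apply, ← mul_assoc, ← mul_pow,
    mul_conj_of_norm_one hz, one_pow, one_mul]
  rfl

lemma norm_modeGauge_le (z : ℂ) (hz : ‖z‖ = 1) : ‖modeGauge z hz‖ ≤ 1 := norm_diagonal_le _ _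

/-- The gauge transform of the resolvent of `w a* + w̄ a` is the resolvent of `zw a* + z̄w̄ a`. -/
lemma modeGauge_conj_resolvent {z w : ℂ} (hz : ‖z‖ = 1) (hw : ‖w‖ = 1) {μ : ℝ} (hμ : μ ≠ 0)
    {R R' : Mode →L[ℂ] Mode} (hR : IsJacobiResolvent (ladder w) μ R)
    (hR' : IsJacobiResolvent (ladder (z * w)) μ R') :
    modeGauge z hz * R * star (modeGauge z hz) = R' := by
  have hzw : ‖z * w‖ = 1 := by rw [norm_mul, hz, hw, one_mul]
  have hd := denseRange_jacobiShift (ladder (z * w)) (norm_ladder_le hzw) hμ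
  refine ContinuousLinearMap.coeFn_injective (hd.equalizer
    (modeGauge z hz * R * star (modeGauge z hz)).continuous R'.continuous ?_)
  ext1 v
  change modeGauge z hz (R (star (modeGauge z hz) (jacobiShift (ladder (z * w)) μ v : Mode)))
    = R' (jacobiShift (ladder (z * w)) μ v : Mode)
  rw [hR'.apply_shift]
  have hu : star (modeGauge z hz) (v : Mode) ∈ FiniteMode := by
    obtain ⟨k, hk⟩ := v.2
    exact ⟨k, fun n hn => by rw [star_modeGauge_apply, hk n hn, mul_zero]⟩
  set u : FiniteMode := ⟨_, hu⟩
  have hun : ∀ n, (u : Mode) n = starRingEnd ℂ z ^ n * (v : Mode) n := star_modeGauge_apply z hz v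
  have h1 : star (modeGauge z hz) (jacobiShift (ladder (z * w)) μ v : Mode)
      = (jacobiShift (ladder w) μ u : Mode) := by
    ext n
    rw [star_modeGauge_apply]
    have e1 : (jacobiShift (ladder (z * w)) μ v : Mode) n
        = Complex.I * μ * (v : Mode) n + jacobi (ladder (z * w)) ((v : Mode) : ℕ → ℂ) n := rfl
    have e2 : (jacobiShift (ladder w) μ u : Mode) n
        = Complex.I * μ * (u : Mode) n + jacobi (ladder w) ((u : Mode) : ℕ → ℂ) n := rfl
    have hc := mul_conj_of_norm_one hz
    rw [e1, e2, hun]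
    cases n with
    | zero =>
      rw [jacobi_ladder_zero, jacobi_ladder_zero, hun, map_mul]
      ring
    | succ n =>
      rw [jacobi_ladder_succ, jacobi_ladder_succ, hun, hun, map_mul]
      linear_combination (starRingEnd ℂ z ^ n * w * (Real.sqrt (n + 1) : ℝ) * (v : Mode) n) * hc
  rw [h1, hR.apply_shift]
  have := DFunLike.congr_fun (modeGauge_mul_star z hz) (v : Mode)
  exact this

/-- The average of `A` over the gauge transformations by `M`-th roots of unity. -/
def gaugeAverage (z : ℂ) (hz : ‖z‖ = 1) (M : ℕ) (A : Mode →L[ℂ] Mode) : Mode →L[ℂ] Mode :=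
  ((M : ℂ)⁻¹) • ∑ l ∈ Finset.range M, modeGauge (z ^ l) (by rw [norm_pow, hz, one_pow]) * A
    * star (modeGauge (z ^ l) (by rw [norm_pow, hz, one_pow]))

lemma norm_gaugeAverage_le (z : ℂ) (hz : ‖z‖ = 1) (M : ℕ) (A : Mode →L[ℂ] Mode) :
    ‖gaugeAverage z hz M A‖ ≤ ‖A‖ := by
  rcases Nat.eq_zero_or_pos M with rfl | hM
  · simp [gaugeAverage]
  rw [gaugeAverage, norm_smul, norm_inv, Complex.norm_natCast, inv_mul_le_iff₀ (by positivity)]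
  refine (norm_sum_le _ _).trans ?_
  refine (Finset.sum_le_card_nsmul _ _ ‖A‖ fun l _ => ?_).trans_eq (by simp)
  have hz' : ‖z ^ l‖ = 1 := by rw [norm_pow, hz, one_pow]
  have h1 := norm_modeGauge_le (z ^ l) hz'
  calc _ ≤ ‖modeGauge (z ^ l) hz'‖ * ‖A‖ * ‖star (modeGauge (z ^ l) hz')‖ :=
        (norm_mul_le _ _).trans (mul_le_mul_of_nonneg_right (norm_mul_le _ _) (norm_nonneg _))
    _ ≤ 1 * ‖A‖ * 1 := by
        rw [ContinuousLinearMap.star_eq_adjoint, LinearIsometryEquiv.norm_map]; gcongr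
    _ = ‖A‖ := by ring

lemma gaugeAverage_sub (z : ℂ) (hz : ‖z‖ = 1) (M : ℕ) (A B : Mode →L[ℂ] Mode) :
    gaugeAverage z hz M (A - B) = gaugeAverage z hz M A - gaugeAverage z hz M B := by
  simp only [gaugeAverage, mul_sub, sub_mul, Finset.sum_sub_distrib, smul_sub]

lemma star_modeGauge_modeBasis (z : ℂ) (hz : ‖z‖ = 1) (k : ℕ) :
    star (modeGauge z hz) (modeBasis k) = starRingEnd ℂ z ^ k • modeBasis k := by
  ext n
  rw [star_modeGauge_apply, lp.coeFn_smul, Pi.smul_apply, modeBasis_apply, smul_eq_mul]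
  split_ifs with h
  · rw [h]
  · simp

lemma gaugeAverage_entry (z : ℂ) (hz : ‖z‖ = 1) (M : ℕ) (A : Mode →L[ℂ] Mode) (j k : ℕ) :
    gaugeAverage z hz M A (modeBasis k) j
      = (M : ℂ)⁻¹ * (∑ l ∈ Finset.range M, (z ^ j * starRingEnd ℂ z ^ k) ^ l)
        * A (modeBasis k) j := by
  have h : ∀ l, ((modeGauge (z ^ l) (by rw [norm_pow, hz, one_pow]) * A
      * star (modeGauge (z ^ l) (by rw [norm_pow, hz, one_pow]))) (modeBasis k)) j
      = (z ^ j * starRingEnd ℂ z ^ k) ^ l * A (modeBasis k) j := by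
    intro l
    rw [mul_apply_eq_comp, star_modeGauge_modeBasis, mul_apply_eq_comp, modeGauge_apply, map_smul,
      lp.coeFn_smul, Pi.smul_apply, smul_eq_mul, map_pow]
    ring
  rw [gaugeAverage, smul_apply, lp.coeFn_smul, Pi.smul_apply, sum_apply,
    lp.coeFn_sum, Finset.sum_apply, Finset.sum_congr rfl fun l _ => h l, ← Finset.sum_mul,
    smul_eq_mul, mul_assoc]

lemma sum_rootOfUnity {z : ℂ} (hz : ‖z‖ = 1) {M : ℕ} (hprim : IsPrimitiveRoot z M) {j k : ℕ}
    (hj : j < M) (hk : k < M) :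
    (M : ℂ)⁻¹ * (∑ l ∈ Finset.range M, (z ^ j * starRingEnd ℂ z ^ k) ^ l)
      = if j = k then 1 else 0 := by
  have hM : (M : ℂ) ≠ 0 := by exact_mod_cast (by omega : M ≠ 0)
  have hc := mul_conj_of_norm_one hz
  split_ifs with h
  · subst h
    simp [← mul_pow, hc, hM]
  · set w := z ^ j * starRingEnd ℂ z ^ k with hw
    have hw1 : w ≠ 1 := by
      intro h1
      refine h (hprim.pow_inj hj hk ?_)
      have h2 : w * z ^ k = z ^ j := by
        rw [hw, mul_assoc, ← mul_pow, mul_comm (starRingEnd ℂ z), hc, one_pow, mul_one]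
      rw [← h2, h1, one_mul]
    have hwM : w ^ M = 1 := by
      rw [hw, mul_pow, ← pow_mul, ← pow_mul, mul_comm j, mul_comm k, pow_mul, pow_mul,
        hprim.pow_eq_one, ← map_pow, hprim.pow_eq_one]
      simp
    rw [geom_sum_eq hw1, hwM]
    simp

/-- The diagonal part of an operator of norm at most one. -/
def diagonalPart (A : Mode →L[ℂ] Mode) (hA : ‖A‖ ≤ 1) : Mode →L[ℂ] Mode :=
  diagonal _ (fun n => A (modeBasis n) n) fun n => by
    refine (lp.norm_apply_le_norm two_ne_zero _ n).trans ?_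
    simpa [norm_modeBasis] using A.le_of_opNorm_le hA (modeBasis n)

/-- If `A` is approximated by its truncations, then its averages approximate its diagonal part. -/
lemma norm_gaugeAverage_sub_le {z : ℂ} (hz : ‖z‖ = 1) {M : ℕ} (hprim : IsPrimitiveRoot z M)
    {A : Mode →L[ℂ] Mode} (hA : ‖A‖ ≤ 1) {m : ℕ} (hm : m < M) {ε : ℝ}
    (hε : ‖A - modeCut m * A * modeCut m‖ ≤ ε) :
    ‖gaugeAverage z hz M A - diagonalPart A hA‖ ≤ 2 * ε := by
  have hε0 : 0 ≤ ε := (norm_nonneg _).trans hε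
  have hcut : ∀ k, modeCut m (modeBasis k) = if k ≤ m then modeBasis k else 0 := by
    intro k
    ext n
    rw [truncate_apply]
    split_ifs with h1 h2 h2
    · rfl
    · rw [modeBasis_apply, if_neg (by omega)]; rfl
    · rw [modeBasis_apply, if_neg (by omega)]
    · rfl
  have hent : ∀ j k, (modeCut m * A * modeCut m) (modeBasis k) j
      = if j ≤ m ∧ k ≤ m then A (modeBasis k) j else 0 := by
    intro j k
    rw [mul_apply_eq_comp, mul_apply_eq_comp, truncate_apply, hcut]
    by_cases h1 : j ≤ m <;> by_cases h2 : k ≤ m <;> simp [h1, h2]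
  have h1 : ‖gaugeAverage z hz M A - gaugeAverage z hz M (modeCut m * A * modeCut m)‖ ≤ ε := by
    rw [← gaugeAverage_sub]
    exact (norm_gaugeAverage_le _ _ _ _).trans hε
  -- All indices of the truncated operator are at most m < M, so the sums over M-th roots of unity
  -- remove its off-diagonal entries exactly.
  have h2 : gaugeAverage z hz M (modeCut m * A * modeCut m)
      = modeCut m * diagonalPart A hA := by
    refine ext_on_modeBasis fun k => lp.ext (funext fun j => ?_)
    rw [gaugeAverage_entry, hent, mul_apply_eq_comp, truncate_apply, diagonalPart, diagonal_apply,
      modeBasis_apply]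
    by_cases hj : j ≤ m <;> by_cases hk : k ≤ m
    · rw [sum_rootOfUnity hz hprim (by omega) (by omega)]
      by_cases hjk : j = k
      · subst hjk; simp [hj]
      · simp [hjk]
    · simp [hj, hk]
      intro h; omega
    · simp [hj]
    · simp [hj]
  have h3 : ‖diagonalPart A hA - modeCut m * diagonalPart A hA‖ ≤ ε := by
    refine norm_le_of_diagonal (c := fun n => if n ≤ m then 0 else A (modeBasis n) n)
      (fun x n => ?_) hε0 fun n => ?_
    · rw [sub_apply, lp.coeFn_sub, Pi.sub_apply, mul_apply_eq_comp, truncate_apply, diagonalPart,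
        diagonal_apply]
      split_ifs <;> simp
    · split_ifs with h
      · simpa using hε0
      · have h4 : (A - modeCut m * A * modeCut m) (modeBasis n) n = A (modeBasis n) n := by
          rw [sub_apply, lp.coeFn_sub, Pi.sub_apply, hent, if_neg (by omega), sub_zero]
        rw [← h4]
        refine (lp.norm_apply_le_norm two_ne_zero _ n).trans ?_
        simpa [norm_modeBasis] using
          (A - modeCut m * A * modeCut m).le_of_opNorm_le hε (modeBasis n)
  rw [h2] at h1
  calc _ = ‖(gaugeAverage z hz M A - modeCut m * diagonalPart A hA)
        - (diagonalPart A hA - modeCut m * diagonalPart A hA)‖ := by congr 1; abel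
    _ ≤ _ := (norm_sub_le _ _).trans (by linarith)

/-! ### Matrix units in the algebra of a single mode -/

open InnerProductSpace in
/-- The operator with columns `v k` for `k ∈ J`, and all other columns zero. -/
def columns (J : Finset ℕ) (v : ℕ → FiniteMode) : Mode →L[ℂ] Mode :=
  ∑ k ∈ J, rankOne ℂ (v k : Mode) (modeBasis k)

/-- The basis vectors as finite vectors. -/
def finiteBasis (j : ℕ) : FiniteMode := ⟨modeBasis j, modeBasis_mem j⟩

/-- The annihilation operator of a single mode. -/
def lowerFin : FiniteMode →ₗ[ℂ] FiniteMode :=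
  (1 / 2 : ℂ) • (jacobiFin (ladder 1) + Complex.I • jacobiFin (ladder Complex.I))

/-- The creation operator of a single mode. -/
def raiseFin : FiniteMode →ₗ[ℂ] FiniteMode :=
  (1 / 2 : ℂ) • (jacobiFin (ladder 1) - Complex.I • jacobiFin (ladder Complex.I))

lemma lowerFin_apply (x : FiniteMode) (n : ℕ) :
    (lowerFin x : Mode) n = (Real.sqrt (n + 1) : ℝ) * (x : Mode) (n + 1) := by
  have h1 : (lowerFin x : Mode) n = 1 / 2 * (jacobi (ladder 1) ((x : Mode) : ℕ → ℂ) n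
      + Complex.I * jacobi (ladder Complex.I) ((x : Mode) : ℕ → ℂ) n) := rfl
  rw [h1]
  cases n with
  | zero =>
    rw [jacobi_ladder_zero, jacobi_ladder_zero]
    simp only [map_one, Complex.conj_I, Nat.cast_zero, zero_add, Real.sqrt_one,
      Complex.ofReal_one]
    linear_combination (-(x : Mode) 1 / 2) * Complex.I_mul_I
  | succ n =>
    rw [jacobi_ladder_succ, jacobi_ladder_succ,
      show (((n + 1 : ℕ) : ℝ) + 1) = n + 2 by push_cast; ring]
    simp only [map_one, Complex.conj_I]
    linear_combination ((Real.sqrt (n + 1) : ℝ) * (x : Mode) n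
      - (Real.sqrt (n + 2) : ℝ) * (x : Mode) (n + 2)) / 2 * Complex.I_mul_I

lemma raiseFin_apply_zero (x : FiniteMode) : (raiseFin x : Mode) 0 = 0 := by
  have h1 : (raiseFin x : Mode) 0 = 1 / 2 * (jacobi (ladder 1) ((x : Mode) : ℕ → ℂ) 0
      - Complex.I * jacobi (ladder Complex.I) ((x : Mode) : ℕ → ℂ) 0) := rfl
  rw [h1, jacobi_ladder_zero, jacobi_ladder_zero]
  simp only [map_one, Complex.conj_I]
  linear_combination ((x : Mode) 1 / 2) * Complex.I_mul_I

lemma raiseFin_apply_succ (x : FiniteMode) (n : ℕ) :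
    (raiseFin x : Mode) (n + 1) = (Real.sqrt (n + 1) : ℝ) * (x : Mode) n := by
  have h1 : (raiseFin x : Mode) (n + 1) = 1 / 2 * (jacobi (ladder 1) ((x : Mode) : ℕ → ℂ) (n + 1)
      - Complex.I * jacobi (ladder Complex.I) ((x : Mode) : ℕ → ℂ) (n + 1)) := rfl
  rw [h1, jacobi_ladder_succ, jacobi_ladder_succ]
  simp only [map_one, Complex.conj_I]
  linear_combination ((Real.sqrt (n + 2) : ℝ) * (x : Mode) (n + 2)
    - (Real.sqrt (n + 1) : ℝ) * (x : Mode) n) / 2 * Complex.I_mul_I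

lemma lowerFin_basis_zero : lowerFin (finiteBasis 0) = 0 := by
  refine Subtype.ext (lp.ext (funext fun n => ?_))
  rw [lowerFin_apply, finiteBasis, modeBasis_apply, if_neg (by omega), mul_zero]
  rfl

lemma lowerFin_basis_succ (j : ℕ) :
    lowerFin (finiteBasis (j + 1)) = ((Real.sqrt (j + 1) : ℝ) : ℂ) • finiteBasis j := by
  refine Subtype.ext (lp.ext (funext fun n => ?_))
  have h : ((((Real.sqrt (j + 1) : ℝ) : ℂ) • finiteBasis j : FiniteMode) : Mode) n
    = (Real.sqrt (j + 1) : ℝ) * modeBasis j n := rfl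
  rw [lowerFin_apply, h, finiteBasis, modeBasis_apply, modeBasis_apply]
  by_cases hn : n = j
  · subst hn; simp
  · simp [hn]

lemma raiseFin_basis (j : ℕ) :
    raiseFin (finiteBasis j) = ((Real.sqrt (j + 1) : ℝ) : ℂ) • finiteBasis (j + 1) := by
  refine Subtype.ext (lp.ext (funext fun n => ?_))
  have h : ((((Real.sqrt (j + 1) : ℝ) : ℂ) • finiteBasis (j + 1) : FiniteMode) : Mode) n
    = (Real.sqrt (j + 1) : ℝ) * modeBasis (j + 1) n := rfl
  rw [h, modeBasis_apply]
  cases n with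
  | zero => rw [raiseFin_apply_zero]; simp
  | succ n =>
    rw [raiseFin_apply_succ, finiteBasis, modeBasis_apply]
    by_cases hn : n = j
    · subst hn; simp
    · simp [hn]

lemma lowerFin_pow_of_lt {l j : ℕ} (h : j < l) : (lowerFin ^ l) (finiteBasis j) = 0 := by
  induction l generalizing j with
  | zero => omega
  | succ l ih =>
    rw [pow_succ, Module.End.mul_apply]
    cases j with
    | zero => rw [lowerFin_basis_zero, map_zero]
    | succ j => rw [lowerFin_basis_succ, map_smul, ih (by omega), smul_zero]

lemma lowerFin_pow_self (l : ℕ) :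
    ∃ c : ℂ, c ≠ 0 ∧ (lowerFin ^ l) (finiteBasis l) = c • finiteBasis 0 := by
  induction l with
  | zero => exact ⟨1, one_ne_zero, by simp⟩
  | succ l ih =>
    obtain ⟨c, hc, h⟩ := ih
    refine ⟨(Real.sqrt (l + 1) : ℝ) * c, mul_ne_zero ?_ hc, ?_⟩
    · exact_mod_cast (Real.sqrt_pos.2 (by positivity)).ne'
    · rw [pow_succ, Module.End.mul_apply, lowerFin_basis_succ, map_smul, h, smul_smul]

lemma columns_add_smul (J : Finset ℕ) (v w : ℕ → FiniteMode) (a b : ℂ) :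
    columns J (fun k => a • v k + b • w k) = a • columns J v + b • columns J w := by
  rw [columns, columns, columns, Finset.smul_sum, Finset.smul_sum, ← Finset.sum_add_distrib]
  refine Finset.sum_congr rfl fun k _ => ?_
  ext1 x
  simp only [InnerProductSpace.rankOne_apply, add_apply, smul_apply, Submodule.coe_add,
    Submodule.coe_smul, smul_add]
  rw [smul_comm a, smul_comm b]

/-- A diagonal operator which vanishes at infinity has a spectral projection onto the set where its
coefficients are maximal. -/
lemma exists_projection_of_diagonal {𝔟 : StarSubalgebra ℂ (Mode →L[ℂ] Mode)}
    (hcl : IsClosed (𝔟 : Set (Mode →L[ℂ] Mode))) {D : Mode →L[ℂ] Mode} (hD : D ∈ 𝔟) {h : ℕ → ℝ}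
    (hDh : ∀ x n, D x n = h n * x n) (h0 : ∀ n, 0 ≤ h n) (hlim : Tendsto h atTop (𝓝 0)) {n₀ : ℕ}
    (hn₀ : 0 < h n₀) : ∃ J : Finset ℕ, J.Nonempty ∧ columns J finiteBasis ∈ 𝔟 := by
  have hfin : ∀ δ, 0 < δ → {n | δ ≤ h n}.Finite := by
    intro δ hδ
    obtain ⟨N, hN⟩ := eventually_atTop.1 (hlim.eventually_lt_const hδ)
    refine (Set.finite_lt_nat N).subset fun n hn => ?_
    by_contra hlt
    exact absurd (hN n (not_lt.1 hlt)) (not_lt.2 hn)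
  obtain ⟨a, ha, hmax⟩ := Set.exists_max_image _ h (hfin _ hn₀) ⟨n₀, le_refl (h n₀)⟩
  have hmax' : ∀ n, h n ≤ h a := fun n => by
    rcases le_total (h n₀) (h n) with h1 | h1
    · exact hmax n h1
    · exact h1.trans ha
  have hδ : 0 < h a := hn₀.trans_le ha
  have hJf : {n | h n = h a}.Finite := (hfin _ hδ).subset fun n hn => hn.ge
  set J := hJf.toFinset
  have hJ : ∀ n, n ∈ J ↔ h n = h a := fun n => hJf.mem_toFinset
  -- The maximum is isolated: only finitely many coefficients exceed half of it, so those different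
  -- from the maximum stay below some ρ < h a.
  obtain ⟨ρ, hρ0, hρa, hρ⟩ : ∃ ρ, 0 ≤ ρ ∧ ρ < h a ∧ ∀ n, n ∉ J → h n ≤ ρ := by
    by_cases hne : ({n | h a / 2 ≤ h n} \ {n | h n = h a}).Nonempty
    · obtain ⟨b, hb, hbm⟩ := Set.exists_max_image _ h
        ((hfin _ (half_pos hδ)).subset Set.sdiff_subset) hne
      refine ⟨h b, h0 b, (hmax' b).lt_of_ne hb.2, fun n hn => ?_⟩
      rcases le_total (h a / 2) (h n) with h1 | h1
      · exact hbm n ⟨h1, fun h2 => hn ((hJ n).2 h2)⟩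
      · exact h1.trans hb.1
    · refine ⟨h a / 2, (half_pos hδ).le, half_lt_self hδ, fun n hn => ?_⟩
      by_contra h1
      exact hne ⟨n, (not_le.1 h1).le, fun h2 => hn ((hJ n).2 h2)⟩
  refine ⟨J, ⟨a, (hJ a).2 rfl⟩, ?_⟩
  set P := columns J finiteBasis with hP
  have hPapp : ∀ x n, P x n = if n ∈ J then x n else 0 := by
    intro x n
    rw [hP, columns, sum_apply, lp.coeFn_sum, Finset.sum_apply]
    have : ∀ k, (InnerProductSpace.rankOne ℂ (finiteBasis k : Mode) (modeBasis k) x) n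
        = if n = k then x n else 0 := by
      intro k
      rw [InnerProductSpace.rankOne_apply, inner_modeBasis_left, lp.coeFn_smul, Pi.smul_apply,
        finiteBasis, modeBasis_apply]
      split_ifs with hk
      · subst hk; simp
      · simp
    simp only [this, Finset.sum_ite_eq]
  have hpow : ∀ k x n, (((h a : ℂ)⁻¹ • D) ^ k) x n = ((h n / h a : ℝ) : ℂ) ^ k * x n := by
    intro k
    induction k with
    | zero => intro x n; simp
    | succ k ih =>
      intro x n
      rw [pow_succ', mul_apply_eq_comp, smul_apply, lp.coeFn_smul, Pi.smul_apply, hDh, ih]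
      push_cast
      rw [smul_eq_mul]
      ring
  -- Powers of the normalized operator are 1 on J and at most (ρ / h a)^k elsewhere.
  have hlimP : Tendsto (fun k => ((h a : ℂ)⁻¹ • D) ^ k) atTop (𝓝 P) := by
    rw [tendsto_iff_norm_sub_tendsto_zero]
    refine squeeze_zero' (Eventually.of_forall fun _ => norm_nonneg _) ?_
      (tendsto_pow_atTop_nhds_zero_of_lt_one (div_nonneg hρ0 hδ.le) ((div_lt_one hδ).2 hρa))
    filter_upwards with k
    refine norm_le_of_diagonal (G := fun _ => ℂ)
      (c := fun n => if n ∈ J then 0 else ((h n / h a : ℝ) : ℂ) ^ k) (fun x n => ?_)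
      (pow_nonneg (div_nonneg hρ0 hδ.le) k) fun n => ?_
    · rw [sub_apply, lp.coeFn_sub, Pi.sub_apply, hpow, hPapp]
      split_ifs with hn
      · rw [(hJ n).1 hn, div_self hδ.ne']; simp
      · simp
    · split_ifs with hn
      · simpa using pow_nonneg (div_nonneg hρ0 hδ.le) k
      · rw [norm_pow, Complex.norm_real, Real.norm_of_nonneg (div_nonneg (h0 n) hδ.le)]
        exact pow_le_pow_left₀ (div_nonneg (h0 n) hδ.le)
          (div_le_div_of_nonneg_right (hρ n hn) hδ.le) k
  exact hcl.mem_of_tendsto hlimP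
    (Eventually.of_forall fun k => pow_mem (𝔟.smul_mem hD _) k)

/-! ### C*-algebras containing all resolvents of a single mode. -/

section ModeAlgebra

variable {𝔟 : StarSubalgebra ℂ (Mode →L[ℂ] Mode)}
  (hcl : IsClosed (𝔟 : Set (Mode →L[ℂ] Mode)))
  (hres : ∀ z : ℂ, ‖z‖ = 1 → ∀ μ : ℝ, μ ≠ 0 → ∀ R, IsJacobiResolvent (ladder z) μ R → R ∈ 𝔟)

include hcl hres

/-- With K the product of the two resolvents, T = KK* is compact and positive. Gauge transformations
rotate resolvents into resolvents, so averages of T stay in the algebra and converge in norm to its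
diagonal part. The diagonal entries are ‖K*eₙ‖², which tend to zero and are not all zero. -/
lemma exists_projection : ∃ J : Finset ℕ, J.Nonempty ∧ columns J finiteBasis ∈ 𝔟 := by
  have hex : ∀ z : ℂ, ‖z‖ = 1 → ∃ R, IsJacobiResolvent (ladder z) 1 R ∧ ‖R‖ ≤ 1 := fun z hz => by
    simpa using exists_isJacobiResolvent (norm_ladder_le hz) (one_ne_zero (α := ℝ))
  obtain ⟨Rq, hq, hq1⟩ := hex 1 (by simp)
  obtain ⟨Rp, hp, hp1⟩ := hex Complex.I (by simp)
  set K := Rp * Rq with hK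
  set T := K * star K with hT
  have hK1 : ‖K‖ ≤ 1 := (norm_mul_le _ _).trans (mul_le_one₀ hp1 (norm_nonneg _) hq1)
  have hKs : ‖star K‖ ≤ 1 := by
    rwa [ContinuousLinearMap.star_eq_adjoint, LinearIsometryEquiv.norm_map]
  have hT1 : ‖T‖ ≤ 1 := (norm_mul_le _ _).trans (mul_le_one₀ hK1 (norm_nonneg _) hKs)
  have hcut : ∀ m, ‖T - modeCut m * T * modeCut m‖ ≤ 16 / Real.sqrt (m + 1) := by
    intro m
    have h1 := norm_sub_truncate_le hq hp hq1 hp1 m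
    rw [← hK] at h1
    have h2 : ‖star K - star K * modeCut m‖ ≤ 8 / Real.sqrt (m + 1) := by
      have h3 : star (K - modeCut m * K) = star K - star K * modeCut m := by
        rw [star_sub, star_mul (modeCut m) K, star_truncate]
      rw [← h3, ContinuousLinearMap.star_eq_adjoint, LinearIsometryEquiv.norm_map]
      exact h1
    have h3 : T - modeCut m * T * modeCut m
        = (K - modeCut m * K) * star K + modeCut m * K * (star K - star K * modeCut m) := by
      rw [hT]; noncomm_ring
    have h4 : ‖modeCut m * K‖ ≤ 1 := (norm_mul_le _ _).trans
      (mul_le_one₀ (norm_truncate_le m) (norm_nonneg _) hK1)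
    rw [h3]
    calc _ ≤ ‖K - modeCut m * K‖ * ‖star K‖ + ‖modeCut m * K‖ * ‖star K - star K * modeCut m‖ :=
          (norm_add_le _ _).trans (add_le_add (norm_mul_le _ _) (norm_mul_le _ _))
      _ ≤ 8 / Real.sqrt (m + 1) * 1 + 1 * (8 / Real.sqrt (m + 1)) := by gcongr
      _ = 16 / Real.sqrt (m + 1) := by ring
  have hsmall : Tendsto (fun m : ℕ => 16 / Real.sqrt (m + 1)) atTop (𝓝 0) := by
    refine Tendsto.div_atTop tendsto_const_nhds ?_
    refine Real.tendsto_sqrt_atTop.comp ?_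
    exact tendsto_atTop_add_const_right _ _ tendsto_natCast_atTop_atTop
  -- the averages belong to the algebra
  have havg : ∀ (z : ℂ) (hz : ‖z‖ = 1) (M : ℕ), gaugeAverage z hz M T ∈ 𝔟 := by
    intro z hz M
    refine 𝔟.smul_mem (sum_mem fun l _ => ?_) _
    have hz' : ‖z ^ l‖ = 1 := by rw [norm_pow, hz, one_pow]
    set u := modeGauge (z ^ l) hz'
    have hu : star u * u = 1 := star_modeGauge_mul _ hz'
    have hmem : ∀ w : ℂ, ‖w‖ = 1 → ∀ R, IsJacobiResolvent (ladder w) 1 R → u * R * star u ∈ 𝔟 := by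
      intro w hw R hR
      have hzw : ‖z ^ l * w‖ = 1 := by rw [norm_mul, hz', hw, one_mul]
      obtain ⟨R', hR', -⟩ := hex _ hzw
      rw [modeGauge_conj_resolvent hz' hw one_ne_zero hR hR']
      exact hres _ hzw 1 one_ne_zero R' hR'
    have hKu : u * K * star u ∈ 𝔟 := by
      have h1 : u * K * star u = (u * Rp * star u) * (u * Rq * star u) := by
        calc u * K * star u = u * Rp * 1 * Rq * star u := by rw [hK]; noncomm_ring
          _ = _ := by rw [← hu]; noncomm_ring
      rw [h1]
      exact mul_mem (hmem _ (by simp) _ hp) (hmem _ (by simp) _ hq)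
    have h2 : u * T * star u = (u * K * star u) * star (u * K * star u) := by
      rw [star_mul, star_mul, star_star]
      calc u * T * star u = u * K * 1 * star K * star u := by rw [hT]; noncomm_ring
        _ = _ := by rw [← hu]; noncomm_ring
    rw [h2]
    exact mul_mem hKu (star_mem hKu)
  have hD : diagonalPart T hT1 ∈ 𝔟 := by
    rw [← SetLike.mem_coe, ← hcl.closure_eq, Metric.mem_closure_iff]
    intro ε hε
    obtain ⟨m, hm⟩ := (hsmall.eventually_lt_const (half_pos hε)).exists
    have hprim := Complex.isPrimitiveRoot_exp (m + 1) m.succ_ne_zero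
    have hz := hprim.norm'_eq_one m.succ_ne_zero
    refine ⟨_, havg _ hz (m + 1), ?_⟩
    rw [dist_comm, dist_eq_norm]
    have := norm_gaugeAverage_sub_le hz hprim hT1 m.lt_succ_self (hcut m)
    linarith
  have hTn : ∀ n, T (modeBasis n) n = ((‖star K (modeBasis n)‖ ^ 2 : ℝ) : ℂ) := by
    intro n
    rw [← inner_modeBasis_left, hT, mul_apply_eq_comp,
      ← ContinuousLinearMap.adjoint_inner_left, ← ContinuousLinearMap.star_eq_adjoint,
      inner_self_eq_norm_sq_to_K]
    push_cast
    rfl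
  have hne : ∃ n, 0 < ‖star K (modeBasis n)‖ ^ 2 := by
    by_contra! hall
    have h1 : star K = 0 := ext_on_modeBasis fun n => by
      have := hall n
      have h2 : ‖star K (modeBasis n)‖ = 0 := by nlinarith [norm_nonneg (star K (modeBasis n))]
      simpa using h2
    have h2 : K = 0 := by rwa [star_eq_zero] at h1
    have h3 : ∀ v : FiniteMode, Rp (v : Mode) = 0 := fun v => by
      have := DFunLike.congr_fun h2 (jacobiShift (ladder 1) 1 v : Mode)
      rwa [hK, mul_apply_eq_comp, hq.apply_shift] at this
    have h4 := h3 (jacobiShift (ladder Complex.I) 1 (finiteBasis 0))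
    rw [hp.apply_shift] at h4
    have := norm_modeBasis 0
    rw [show modeBasis 0 = (finiteBasis 0 : Mode) from rfl, h4, norm_zero] at this
    exact zero_ne_one this
  obtain ⟨n₀, hn₀⟩ := hne
  refine exists_projection_of_diagonal hcl hD (h := fun n => ‖star K (modeBasis n)‖ ^ 2)
    (fun x n => ?_) (fun n => sq_nonneg _) ?_ hn₀
  · rw [diagonalPart, diagonal_apply, hTn]; rfl
  · refine squeeze_zero' (Eventually.of_forall fun n => sq_nonneg _) ?_
      -- The truncation at n - 1 does not see the entry (n, n), so this entry is bounded by the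
      -- truncation error.
      (hsmall.comp (tendsto_sub_atTop_nat 1))
    filter_upwards [eventually_gt_atTop 0] with n hn
    have h1 : (T - modeCut (n - 1) * T * modeCut (n - 1)) (modeBasis n) n
        = T (modeBasis n) n := by
      have h0 : (modeCut (n - 1) * T * modeCut (n - 1)) (modeBasis n) n = 0 :=
        (truncate_apply (n - 1) (T (modeCut (n - 1) (modeBasis n))) n).trans (if_neg (by omega))
      rw [sub_apply, lp.coeFn_sub, Pi.sub_apply, h0, sub_zero]
    have h2 := lp.norm_apply_le_norm two_ne_zero
      ((T - modeCut (n - 1) * T * modeCut (n - 1)) (modeBasis n)) n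
    have h3 := (T - modeCut (n - 1) * T * modeCut (n - 1)).le_of_opNorm_le (hcut (n - 1))
      (modeBasis n)
    rw [h1, hTn, Complex.norm_real, Real.norm_of_nonneg (sq_nonneg _)] at h2
    rw [norm_modeBasis, mul_one] at h3
    exact h2.trans h3

/-- With ν = N + 1, the bounded operators iν(1 - iν(iν + φ)⁻¹), with φ the field, converge to φ on
finite vectors. Multiplication by an operator with finitely many columns turns this strong
convergence into norm convergence. -/
lemma columns_jacobiFin_mem {z : ℂ} (hz : ‖z‖ = 1) {J : Finset ℕ} {v : ℕ → FiniteMode}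
    (hv : columns J v ∈ 𝔟) : columns J (fun k => jacobiFin (ladder z) (v k)) ∈ 𝔟 := by
  have hex : ∀ N : ℕ, ∃ R, IsJacobiResolvent (ladder z) (N + 1 : ℝ) R ∧ ‖R‖ ≤ |(N + 1 : ℝ)|⁻¹ :=
    fun N => exists_isJacobiResolvent (norm_ladder_le hz) (by positivity)
  choose R hR hRn using hex
  set A : ℕ → Mode →L[ℂ] Mode := fun N =>
    (Complex.I * (N + 1 : ℝ)) • (1 - (Complex.I * (N + 1 : ℝ)) • R N)
  have hA : ∀ N, A N ∈ 𝔟 := fun N =>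
    𝔟.smul_mem (sub_mem (one_mem _) (𝔟.smul_mem (hres z hz _ (by positivity) _ (hR N)) _)) _
  have hshift : ∀ (N : ℕ) (y : FiniteMode), (y : Mode) - (Complex.I * (N + 1 : ℝ)) • R N y
      = R N (jacobiFin (ladder z) y) := by
    intro N y
    have h1 := (hR N).apply_shift y
    rw [coe_jacobiShift, map_add, map_smul] at h1
    rw [sub_eq_iff_eq_add, add_comm]
    exact h1.symm
  have hlim : ∀ y : FiniteMode,
      Tendsto (fun N => A N y) atTop (𝓝 (jacobiFin (ladder z) y : Mode)) := by
    intro y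
    set y' := jacobiFin (ladder z) y
    -- The resolvent identity 1 - iνR = Rφ, used twice, leaves φy minus Rφ²y, and ‖R‖ ≤ 1/ν.
    have h1 : ∀ N, A N y = (y' : Mode) - R N (jacobiFin (ladder z) y') := by
      intro N
      rw [← hshift N y', sub_sub_cancel, ← hshift N y]
      rfl
    simp only [h1]
    rw [tendsto_iff_norm_sub_tendsto_zero]
    have h2 : Tendsto (fun N : ℕ => 1 / ((N : ℝ) + 1) * ‖(jacobiFin (ladder z) y' : Mode)‖) atTop
        (𝓝 (0 * ‖(jacobiFin (ladder z) y' : Mode)‖)) :=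
      tendsto_one_div_add_atTop_nhds_zero_nat.mul_const _
    rw [zero_mul] at h2
    refine squeeze_zero (fun _ => norm_nonneg _) (fun N => ?_) h2
    rw [sub_sub_cancel_left, norm_neg]
    refine (R N).le_of_opNorm_le ((hRn N).trans_eq ?_) _
    rw [abs_of_pos (by positivity), one_div]
  have hcol : Tendsto (fun N => A N * columns J v) atTop
      (𝓝 (columns J fun k => jacobiFin (ladder z) (v k))) := by
    have h1 : ∀ N, A N * columns J v
        = ∑ k ∈ J, InnerProductSpace.rankOne ℂ (A N (v k)) (modeBasis k) := by
      intro N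
      rw [columns, Finset.mul_sum]
      exact Finset.sum_congr rfl fun k _ => InnerProductSpace.comp_rankOne _ _ _
    simp only [h1]
    refine tendsto_finsetSum _ fun k _ => ?_
    have h2 : Continuous fun x : Mode => InnerProductSpace.rankOne ℂ x (modeBasis k) := by
      fun_prop
    exact (h2.tendsto _).comp (hlim (v k))
  exact hcl.mem_of_tendsto hcol (Eventually.of_forall fun N => mul_mem (hA N) hv)

lemma columns_lowerFin_mem {J : Finset ℕ} {v : ℕ → FiniteMode} (hv : columns J v ∈ 𝔟) :
    columns J (fun k => lowerFin (v k)) ∈ 𝔟 := by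
  have h : (fun k => lowerFin (v k)) = fun k => (1 / 2 : ℂ) • jacobiFin (ladder 1) (v k)
      + (1 / 2 * Complex.I) • jacobiFin (ladder Complex.I) (v k) := by
    ext1 k
    rw [lowerFin, LinearMap.smul_apply, LinearMap.add_apply, smul_add, LinearMap.smul_apply,
      smul_smul]
  rw [h, columns_add_smul]
  exact add_mem (𝔟.smul_mem (columns_jacobiFin_mem hcl hres (by simp) hv) _)
    (𝔟.smul_mem (columns_jacobiFin_mem hcl hres (by simp) hv) _)

lemma columns_raiseFin_mem {J : Finset ℕ} {v : ℕ → FiniteMode} (hv : columns J v ∈ 𝔟) :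
    columns J (fun k => raiseFin (v k)) ∈ 𝔟 := by
  have h : (fun k => raiseFin (v k)) = fun k => (1 / 2 : ℂ) • jacobiFin (ladder 1) (v k)
      + (-(1 / 2 * Complex.I)) • jacobiFin (ladder Complex.I) (v k) := by
    ext1 k
    rw [raiseFin, LinearMap.smul_apply, LinearMap.sub_apply, smul_sub, LinearMap.smul_apply,
      smul_smul, neg_smul, sub_eq_add_neg]
  rw [h, columns_add_smul]
  exact add_mem (𝔟.smul_mem (columns_jacobiFin_mem hcl hres (by simp) hv) _)
    (𝔟.smul_mem (columns_jacobiFin_mem hcl hres (by simp) hv) _)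

/-- A C*-algebra on a single mode which contains the resolvents of all fields contains the matrix
units. -/
theorem rankOne_modeBasis_mem (j k : ℕ) :
    InnerProductSpace.rankOne ℂ (modeBasis j) (modeBasis k) ∈ 𝔟 := by
  obtain ⟨J, hJ, hmem⟩ := exists_projection hcl hres
  have hpow : ∀ l, columns J (fun k => (lowerFin ^ l) (finiteBasis k)) ∈ 𝔟 := by
    intro l
    induction l with
    | zero => simpa using hmem
    | succ l ih =>
      simp only [pow_succ', Module.End.mul_apply]
      exact columns_lowerFin_mem hcl hres ih
  -- Lowering m times kills every column but the largest and leaves a nonzero multiple of the matrix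
  -- unit (0, m). Multiplying by its adjoint gives (0, 0), from which the creation operator builds
  -- all (j, 0).
  set m := J.max' hJ
  obtain ⟨c, hc, hcm⟩ := lowerFin_pow_self m
  have h1 : columns J (fun k => (lowerFin ^ m) (finiteBasis k))
      = c • InnerProductSpace.rankOne ℂ (modeBasis 0) (modeBasis m) := by
    rw [columns, Finset.sum_eq_single m]
    · rw [hcm]
      ext1 x
      simp only [InnerProductSpace.rankOne_apply, smul_apply, Submodule.coe_smul]
      rw [smul_comm]
      rfl
    · intro k hk hkm
      rw [lowerFin_pow_of_lt ((J.le_max' k hk).lt_of_ne hkm)]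
      simp
    · intro hm; exact absurd (J.max'_mem hJ) hm
  have h2 : InnerProductSpace.rankOne ℂ (modeBasis 0) (modeBasis m) ∈ 𝔟 := by
    have := 𝔟.smul_mem (hpow m) c⁻¹
    rwa [h1, smul_smul, inv_mul_cancel₀ hc, one_smul] at this
  have hstar : ∀ x y : Mode, star (InnerProductSpace.rankOne ℂ x y)
      = InnerProductSpace.rankOne ℂ y x := fun x y => InnerProductSpace.adjoint_rankOne x y
  have hmul : ∀ a b c : ℕ, InnerProductSpace.rankOne ℂ (modeBasis a) (modeBasis b)
      * InnerProductSpace.rankOne ℂ (modeBasis b) (modeBasis c)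
      = InnerProductSpace.rankOne ℂ (modeBasis a) (modeBasis c) := by
    intro a b c
    have := InnerProductSpace.rankOne_comp_rankOne (𝕜 := ℂ) (modeBasis a) (modeBasis b)
      (modeBasis b) (modeBasis c)
    rw [inner_modeBasis_left, modeBasis_apply, if_pos rfl, one_smul] at this
    exact this
  have h3 : ∀ j, InnerProductSpace.rankOne ℂ (modeBasis j) (modeBasis 0) ∈ 𝔟 := by
    intro j
    induction j with
    | zero =>
      have := mul_mem h2 (star_mem h2)
      rwa [hstar, hmul] at this
    | succ j ih =>
      have hcol : ∀ v : ℕ → FiniteMode,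
          columns {0} v = InnerProductSpace.rankOne ℂ (v 0 : Mode) (modeBasis 0) := fun v => by
        rw [columns, Finset.sum_singleton]
      have h4 := columns_raiseFin_mem hcl hres (J := {0}) (v := fun _ => finiteBasis j)
        (by rw [hcol]; exact ih)
      rw [hcol, raiseFin_basis] at h4
      have hs : ((Real.sqrt (j + 1) : ℝ) : ℂ) ≠ 0 := by
        exact_mod_cast (Real.sqrt_pos.2 (by positivity)).ne'
      have h5 := 𝔟.smul_mem h4 ((Real.sqrt (j + 1) : ℝ) : ℂ)⁻¹
      rw [Submodule.coe_smul, map_smul, smul_apply, smul_smul, inv_mul_cancel₀ hs,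
        one_smul] at h5
      exact h5
  have := mul_mem (h3 j) (star_mem (h3 k))
  rwa [hstar, hmul] at this

end ModeAlgebra

/-! ### The inverse square root -/

section InvSqrt

variable {H : Type*} [NormedAddCommGroup H] [InnerProductSpace ℂ H] [CompleteSpace H]

/-- The operator `(1 + T)^{-1/2}`. -/
abbrev invSqrt (T : H →L[ℂ] H) : H →L[ℂ] H := cfc (fun x : ℝ => (1 + x) ^ (-(1 / 2) : ℝ)) T

variable {T : H →L[ℂ] H}

lemma continuousOn_invSqrt (hT : 0 ≤ T) :
    ContinuousOn (fun x : ℝ => (1 + x) ^ (-(1 / 2) : ℝ)) (spectrum ℝ T) := by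
  refine ContinuousOn.rpow_const (by fun_prop) fun x hx => Or.inl ?_
  have := spectrum_nonneg_of_nonneg hT hx
  positivity

lemma invSqrt_nonneg (hT : 0 ≤ T) : 0 ≤ invSqrt T :=
  cfc_nonneg fun x hx => Real.rpow_nonneg (by linarith [spectrum_nonneg_of_nonneg hT hx]) _

lemma isSelfAdjoint_invSqrt (T : H →L[ℂ] H) : IsSelfAdjoint (invSqrt T) := cfc_predicate _ _

lemma norm_invSqrt_le (hT : 0 ≤ T) : ‖invSqrt T‖ ≤ 1 := by
  refine norm_cfc_le zero_le_one fun x hx => ?_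
  have := spectrum_nonneg_of_nonneg hT hx
  rw [Real.norm_of_nonneg (by positivity)]
  exact Real.rpow_le_one_of_one_le_of_nonpos (by linarith) (by norm_num)

lemma commute_invSqrt (hT : 0 ≤ T) : Commute (invSqrt T) T := by
  have hsa : IsSelfAdjoint T := IsSelfAdjoint.of_nonneg hT
  have := cfc_commute_cfc (fun x : ℝ => (1 + x) ^ (-(1 / 2) : ℝ)) id T
  rwa [cfc_id ℝ T] at this

lemma invSqrt_mul_invSqrt_mul (hT : 0 ≤ T) : invSqrt T * (invSqrt T * (1 + T)) = 1 := by
  have hsa : IsSelfAdjoint T := IsSelfAdjoint.of_nonneg hT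
  have hc := continuousOn_invSqrt hT
  have h1 : cfc (fun x : ℝ => 1 + x) T = 1 + T := by
    rw [cfc_const_add 1 (fun x => x) T, cfc_id' ℝ T, map_one]
  rw [← h1, ← cfc_mul _ _ T hc (by fun_prop), invSqrt,
    ← cfc_mul (fun x : ℝ => (1 + x) ^ (-(1 / 2) : ℝ))
    (fun x : ℝ => (1 + x) ^ (-(1 / 2) : ℝ) * (1 + x)) T hc (hc.mul (by fun_prop)),
    ← cfc_const_one ℝ T]
  refine cfc_congr fun x hx => ?_
  have hx0 : 0 < 1 + x := by linarith [spectrum_nonneg_of_nonneg hT hx]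
  change (1 + x) ^ (-(1 / 2) : ℝ) * ((1 + x) ^ (-(1 / 2) : ℝ) * (1 + x)) = 1
  rw [← mul_assoc, ← Real.rpow_add hx0, show (-(1 / 2) : ℝ) + -(1 / 2) = -1 by norm_num,
    Real.rpow_neg_one, inv_mul_cancel₀ hx0.ne']

lemma invSqrt_apply_invSqrt_apply (hT : 0 ≤ T) (v : H) :
    invSqrt T (invSqrt T v + T (invSqrt T v)) = v := by
  have h1 := DFunLike.congr_fun (invSqrt_mul_invSqrt_mul hT) v
  have h2 : T (invSqrt T v) = invSqrt T (T v) :=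
    (DFunLike.congr_fun (commute_invSqrt hT).eq v).symm
  rw [h2, ← map_add]
  exact h1

lemma invSqrt_injective (hT : 0 ≤ T) {v : H} (h : invSqrt T v = 0) : v = 0 := by
  have := invSqrt_apply_invSqrt_apply hT v
  rwa [h, map_zero, add_zero, map_zero, eq_comm] at this

/-- With B = (1+T)^{-1/2} and c = (j+1)^{-1/2}, B²v = c²v, so w = Bv - cv satisfies Bw = -cw. As B
is positive and c > 0, w = 0. -/
lemma invSqrt_apply_of_eigen (hT : 0 ≤ T) {v : H} {j : ℕ} (h : T v = (j : ℂ) • v) :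
    invSqrt T v = ((Real.sqrt (j + 1) : ℝ) : ℂ)⁻¹ • v := by
  set c : ℂ := ((Real.sqrt (j + 1) : ℝ) : ℂ)⁻¹ with hc
  have hcpos : 0 < (Real.sqrt (j + 1))⁻¹ := inv_pos.2 (Real.sqrt_pos.2 (by positivity))
  have hj : (j + 1 : ℂ) ≠ 0 := by exact_mod_cast j.succ_ne_zero
  have hcc : c * c * (j + 1) = 1 := by
    rw [hc, ← mul_inv, sqrt_mul_sqrt, inv_mul_cancel₀ hj]
  have h1 : (1 + j : ℂ) • invSqrt T (invSqrt T v) = v := by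
    have := DFunLike.congr_fun (invSqrt_mul_invSqrt_mul hT) v
    rw [mul_apply_eq_comp, mul_apply_eq_comp, add_apply, h] at this
    rw [← map_smul, ← map_smul, add_smul, one_smul]
    exact this
  have h2 : invSqrt T (invSqrt T v) = (c * c) • v := by
    conv_rhs => rw [← h1]
    rw [smul_smul, add_comm (1 : ℂ), hcc, one_smul]
  set w := invSqrt T v - c • v with hw
  have h3 : invSqrt T w = -(c • w) := by
    rw [hw, map_sub, map_smul, h2, smul_sub, smul_smul]
    abel
  have hpos := ((ContinuousLinearMap.nonneg_iff_isPositive _).1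
    (invSqrt_nonneg hT)).inner_nonneg_right w
  rw [h3, inner_neg_right, inner_smul_right, inner_self_eq_norm_sq_to_K, hc] at hpos
  have h4 : (0 : ℝ) ≤ -((Real.sqrt (j + 1))⁻¹ * ‖w‖ ^ 2) := by
    have := (Complex.le_def.1 hpos).1
    simpa [← Complex.ofReal_pow, ← Complex.ofReal_inv, ← Complex.ofReal_mul] using this
  have h5 : ‖w‖ ^ 2 = 0 := by
    have := sq_nonneg ‖w‖
    nlinarith
  have h6 : w = 0 := by simpa using h5
  exact sub_eq_zero.1 h6

end InvSqrt

/-! ### Lipschitz estimates -/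

lemma exists_lipschitz_aeval {A : Type*} [NormedRing A] [NormedAlgebra ℝ A] (p : Polynomial ℝ)
    (C : ℝ) : ∃ L, 0 ≤ L ∧ ∀ a b : A, ‖a‖ ≤ C → ‖b‖ ≤ C →
      ‖Polynomial.aeval a p - Polynomial.aeval b p‖ ≤ L * ‖a - b‖ := by
  by_cases hC : 0 ≤ C
  swap
  · exact ⟨0, le_rfl, fun a _ ha => absurd ((norm_nonneg a).trans ha) hC⟩
  have hpow : ∀ k : ℕ, ∃ L, 0 ≤ L ∧ ∀ a b : A, ‖a‖ ≤ C → ‖b‖ ≤ C →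
      ‖a ^ k - b ^ k‖ ≤ L * ‖a - b‖ := by
    intro k
    induction k with
    | zero => exact ⟨0, le_rfl, fun a b _ _ => by simp⟩
    | succ k ih =>
      obtain ⟨L, hL, h⟩ := ih
      -- Treated apart because the norm of the unit of the algebra is not assumed to be at most one.
      by_cases hk : k = 0
      · subst hk
        exact ⟨1, zero_le_one, fun a b _ _ => by simp⟩
      refine ⟨C ^ k + L * C, by positivity, fun a b ha hb => ?_⟩
      have e : a ^ (k + 1) - b ^ (k + 1) = a ^ k * (a - b) + (a ^ k - b ^ k) * b := by
        rw [pow_succ, pow_succ]; noncomm_ring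
      have h1 : ‖a ^ k‖ ≤ C ^ k := (norm_pow_le' a (Nat.pos_of_ne_zero hk)).trans (by gcongr)
      calc ‖a ^ (k + 1) - b ^ (k + 1)‖ ≤ ‖a ^ k‖ * ‖a - b‖ + ‖a ^ k - b ^ k‖ * ‖b‖ := by
            rw [e]
            exact (norm_add_le _ _).trans (add_le_add (norm_mul_le _ _) (norm_mul_le _ _))
        _ ≤ C ^ k * ‖a - b‖ + L * ‖a - b‖ * C := by
            gcongr
            exact h a b ha hb
        _ = _ := by ring
  induction p using Polynomial.induction_on' with
  | add p q hp hq =>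
    obtain ⟨L, hL, h⟩ := hp
    obtain ⟨L', hL', h'⟩ := hq
    refine ⟨L + L', by positivity, fun a b ha hb => ?_⟩
    rw [map_add, map_add, add_sub_add_comm, add_mul]
    exact (norm_add_le _ _).trans (add_le_add (h a b ha hb) (h' a b ha hb))
  | monomial k r =>
    obtain ⟨L, hL, h⟩ := hpow k
    refine ⟨‖r‖ * L, by positivity, fun a b ha hb => ?_⟩
    rw [Polynomial.aeval_monomial, Polynomial.aeval_monomial, ← mul_sub, mul_assoc,
      ← Algebra.smul_def, norm_smul]
    gcongr
    exact h a b ha hb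

/-! ### Spectrum of N_f on the n-particle space, and Lipschitz dependence on f. -/

section Mode

variable {s : ℕ}

lemma modeNumber_nonneg (f : OneParticle s) (n : ℕ) : 0 ≤ modeNumber f n := by
  cases n with
  | zero => exact le_rfl
  | succ n =>
    rw [ContinuousLinearMap.nonneg_iff_isPositive]
    exact ContinuousLinearMap.isPositive_self_comp_adjoint (creation f n)

lemma norm_annihilation_le (f : OneParticle s) (n : ℕ) :
    ‖annihilation f n‖ ≤ ‖f‖ * Real.sqrt (n + 1) := by
  rw [annihilation, LinearIsometryEquiv.norm_map]
  exact norm_creation_le f n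

lemma norm_annihilation_sub_le (f g : OneParticle s) (n : ℕ) :
    ‖annihilation f n - annihilation g n‖ ≤ ‖f - g‖ * Real.sqrt (n + 1) := by
  rw [annihilation, annihilation, ← map_sub, LinearIsometryEquiv.norm_map, ← creation_sub]
  exact norm_creation_le _ n

lemma norm_modeNumber_le {f : OneParticle s} (hf : ‖f‖ = 1) (n : ℕ) : ‖modeNumber f n‖ ≤ n := by
  cases n with
  | zero => simp [modeNumber]
  | succ n =>
    have h1 := norm_creation_le f n
    have h2 := norm_annihilation_le f n
    rw [hf, one_mul] at h1 h2
    calc ‖creation f n ∘L annihilation f n‖ ≤ ‖creation f n‖ * ‖annihilation f n‖ :=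
          ContinuousLinearMap.opNorm_comp_le _ _
      _ ≤ Real.sqrt (n + 1) * Real.sqrt (n + 1) := by gcongr
      _ = ((n + 1 : ℕ) : ℝ) := by rw [Real.mul_self_sqrt (by positivity)]; push_cast; rfl

lemma norm_modeNumber_sub_le {f g : OneParticle s} (hf : ‖f‖ = 1) (hg : ‖g‖ = 1) (n : ℕ) :
    ‖modeNumber f n - modeNumber g n‖ ≤ 2 * n * ‖f - g‖ := by
  cases n with
  | zero => simp [modeNumber]
  | succ n =>
    have h1 := norm_creation_le f n
    have h2 := norm_annihilation_le g n
    have h3 := norm_creation_le (f - g) n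
    have h4 := norm_annihilation_sub_le f g n
    rw [hf, one_mul] at h1
    rw [hg, one_mul] at h2
    have e : modeNumber f (n + 1) - modeNumber g (n + 1)
        = creation f n ∘L (annihilation f n - annihilation g n)
          + creation (f - g) n ∘L annihilation g n := by
      ext1 Ψ
      change creation f n (annihilation f n Ψ) - creation g n (annihilation g n Ψ)
        = creation f n (annihilation f n Ψ - annihilation g n Ψ)
          + creation (f - g) n (annihilation g n Ψ)
      rw [map_sub, creation_sub, sub_apply]
      abel
    rw [e]
    calc _ ≤ ‖creation f n‖ * ‖annihilation f n - annihilation g n‖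
          + ‖creation (f - g) n‖ * ‖annihilation g n‖ := (norm_add_le _ _).trans
            (add_le_add (ContinuousLinearMap.opNorm_comp_le _ _)
              (ContinuousLinearMap.opNorm_comp_le _ _))
      _ ≤ Real.sqrt (n + 1) * (‖f - g‖ * Real.sqrt (n + 1))
          + ‖f - g‖ * Real.sqrt (n + 1) * Real.sqrt (n + 1) := by gcongr
      _ = 2 * (Real.sqrt (n + 1) * Real.sqrt (n + 1)) * ‖f - g‖ := by ring
      _ = _ := by rw [Real.mul_self_sqrt (by positivity)]; push_cast; ring

/-- A polynomial with roots `0, …, n`, annihilating `N_f` on the `n`-particle space. -/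
def rootPoly : ℕ → Polynomial ℝ
  | 0 => Polynomial.X
  | n + 1 => Polynomial.X * (rootPoly n).comp (Polynomial.X - 1)

lemma eval_rootPoly {n : ℕ} {x : ℝ} (h : (rootPoly n).eval x = 0) : ∃ j ≤ n, x = j := by
  induction n generalizing x with
  | zero => exact ⟨0, le_rfl, by simpa [rootPoly] using h⟩
  | succ n ih =>
    rw [rootPoly, Polynomial.eval_mul, Polynomial.eval_X, Polynomial.eval_comp] at h
    rcases mul_eq_zero.1 h with h | h
    · exact ⟨0, by omega, by simpa using h⟩
    · obtain ⟨j, hj, hx⟩ := ih h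
      refine ⟨j + 1, by omega, ?_⟩
      simp at hx
      push_cast
      linarith

/-- The commutation relation says (N_f - 1)a*(f) = a*(f)N_f, which passes to polynomials. -/
lemma aeval_comp_creation {f : OneParticle s} (hf : ‖f‖ = 1) (n : ℕ) (p : Polynomial ℝ)
    (Ψ : Particles s n) :
    Polynomial.aeval (modeNumber f (n + 1) - 1) p (creation f n Ψ)
      = creation f n (Polynomial.aeval (modeNumber f n) p Ψ) := by
  induction p using Polynomial.induction_on' with
  | add p q hp hq => rw [map_add, map_add, add_apply, add_apply, map_add, hp, hq]
  | monomial k r =>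
    rw [Polynomial.aeval_monomial, Polynomial.aeval_monomial, ← Algebra.smul_def,
      ← Algebra.smul_def, smul_apply, smul_apply]
    have hk : ((modeNumber f (n + 1) - 1) ^ k) (creation f n Ψ)
        = creation f n ((modeNumber f n ^ k) Ψ) := by
      induction k generalizing Ψ with
      | zero => simp
      | succ k ih =>
        rw [pow_succ, pow_succ, mul_apply_eq_comp, mul_apply_eq_comp, ← ih]
        congr 1
        have h1 := annihilation_creation f Ψ
        rw [hf] at h1
        change creation f n (annihilation f n (creation f n Ψ)) - creation f n Ψ = _
        rw [h1, map_add]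
        simp
    rw [hk, ← Complex.coe_smul, ← Complex.coe_smul, map_smul]

/-- As N_f = a*a, the factor X supplies a*a, and pulling the shifted polynomial through a* lowers n
by one. -/
lemma aeval_rootPoly {f : OneParticle s} (hf : ‖f‖ = 1) (n : ℕ) :
    Polynomial.aeval (modeNumber f n) (rootPoly n) = 0 := by
  induction n with
  | zero => simp [rootPoly, modeNumber]
  | succ n ih =>
    ext1 Ψ
    rw [rootPoly, mul_comm, map_mul, Polynomial.aeval_X, mul_apply_eq_comp, Polynomial.aeval_comp,
      map_sub, Polynomial.aeval_X, map_one]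
    change Polynomial.aeval (modeNumber f (n + 1) - 1) (rootPoly n)
      (creation f n (annihilation f n Ψ)) = 0
    rw [aeval_comp_creation hf, ih]
    simp

lemma exists_eq_of_mem_spectrum {f : OneParticle s} (hf : ‖f‖ = 1) {n : ℕ} {x : ℝ}
    (hx : x ∈ spectrum ℝ (modeNumber f n)) : ∃ j ≤ n, x = j := by
  refine eval_rootPoly ?_
  have h1 := spectrum.subset_polynomial_aeval (modeNumber f n) (rootPoly n) ⟨x, hx, rfl⟩
  rw [aeval_rootPoly hf] at h1
  -- The spectrum of 0 is {0} only in a nontrivial algebra; otherwise the spectrum is empty.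
  have : Nontrivial (Particles s n →L[ℂ] Particles s n) := by
    by_contra hne
    rw [not_nontrivial_iff_subsingleton] at hne
    rw [spectrum.of_subsingleton] at hx
    exact hx
  simpa [spectrum.zero_eq] using h1

/-- The polynomial which agrees with `(1 + x)^{-1/2}` at `0, …, n`. -/
def invSqrtPoly (n : ℕ) : Polynomial ℝ :=
  Lagrange.interpolate (Finset.range (n + 1)) (fun j : ℕ => (j : ℝ))
    fun j : ℕ => (1 + (j : ℝ)) ^ (-(1 / 2) : ℝ)

/-- The interpolation polynomial agrees with the function on the spectrum, which is contained in {0,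
…, n}. It does not depend on f, which is what makes the Lipschitz estimate possible. -/
lemma invSqrt_modeNumber {f : OneParticle s} (hf : ‖f‖ = 1) (n : ℕ) :
    invSqrt (modeNumber f n) = Polynomial.aeval (modeNumber f n) (invSqrtPoly n) := by
  have hsa : IsSelfAdjoint (modeNumber f n) := IsSelfAdjoint.of_nonneg (modeNumber_nonneg f n)
  rw [← cfc_polynomial (invSqrtPoly n) (modeNumber f n)]
  refine cfc_congr fun x hx => ?_
  obtain ⟨j, hj, rfl⟩ := exists_eq_of_mem_spectrum hf hx
  exact (Lagrange.eval_interpolate_at_node (s := Finset.range (n + 1)) (v := fun j : ℕ => (j : ℝ))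
    (i := j) (fun j : ℕ => (1 + (j : ℝ)) ^ (-(1 / 2) : ℝ)) (fun a _ b _ h => Nat.cast_injective h)
    (Finset.mem_range.2 (by omega))).symm

lemma exists_lipschitz_isometryPart (s n : ℕ) : ∃ L, 0 ≤ L ∧ ∀ f g : OneParticle s, ‖f‖ = 1 →
    ‖g‖ = 1 → ‖isometryPart f n - isometryPart g n‖ ≤ L * ‖f - g‖ := by
  obtain ⟨L, hL, h⟩ := exists_lipschitz_aeval (A := Particles s n →L[ℂ] Particles s n)
    (invSqrtPoly n) n
  refine ⟨Real.sqrt (n + 1) * (L * (2 * n)) + Real.sqrt (n + 1), by positivity,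
    fun f g hf hg => ?_⟩
  have h1 := norm_creation_le f n
  have h2 := norm_creation_le (f - g) n
  rw [hf, one_mul] at h1
  have h3 : ‖invSqrt (modeNumber f n) - invSqrt (modeNumber g n)‖ ≤ L * (2 * n * ‖f - g‖) := by
    rw [invSqrt_modeNumber hf, invSqrt_modeNumber hg]
    exact (h _ _ (norm_modeNumber_le hf n) (norm_modeNumber_le hg n)).trans
      (mul_le_mul_of_nonneg_left (norm_modeNumber_sub_le hf hg n) hL)
  have e : isometryPart f n - isometryPart g n
      = creation f n ∘L (invSqrt (modeNumber f n) - invSqrt (modeNumber g n))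
        + creation (f - g) n ∘L invSqrt (modeNumber g n) := by
    ext1 Ψ
    change creation f n (invSqrt (modeNumber f n) Ψ) - creation g n (invSqrt (modeNumber g n) Ψ)
      = creation f n (invSqrt (modeNumber f n) Ψ - invSqrt (modeNumber g n) Ψ)
        + creation (f - g) n (invSqrt (modeNumber g n) Ψ)
    rw [map_sub, creation_sub, sub_apply]
    abel
  rw [e]
  have h4 := norm_invSqrt_le (modeNumber_nonneg g n)
  calc _ ≤ ‖creation f n‖ * ‖invSqrt (modeNumber f n) - invSqrt (modeNumber g n)‖
          + ‖creation (f - g) n‖ * ‖invSqrt (modeNumber g n)‖ := (norm_add_le _ _).trans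
            (add_le_add (ContinuousLinearMap.opNorm_comp_le _ _)
              (ContinuousLinearMap.opNorm_comp_le _ _))
    _ ≤ Real.sqrt (n + 1) * (L * (2 * n * ‖f - g‖))
          + ‖f - g‖ * Real.sqrt (n + 1) * 1 := by gcongr
    _ = _ := by ring

/-! ### The isometries `W_f` -/

lemma adjoint_isometryPart (f : OneParticle s) (n : ℕ) (Ψ : Particles s (n + 1)) :
    ContinuousLinearMap.adjoint (isometryPart f n) Ψ
      = invSqrt (modeNumber f n) (annihilation f n Ψ) := by
  rw [isometryPart, ContinuousLinearMap.adjoint_comp,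
    (isSelfAdjoint_invSqrt (modeNumber f n)).adjoint_eq]
  rfl

lemma adjoint_isometryPart_isometryPart {f : OneParticle s} (hf : ‖f‖ = 1) (n : ℕ)
    (Ψ : Particles s n) :
    ContinuousLinearMap.adjoint (isometryPart f n) (isometryPart f n Ψ) = Ψ := by
  rw [adjoint_isometryPart]
  change invSqrt (modeNumber f n)
    (annihilation f n (creation f n (invSqrt (modeNumber f n) Ψ))) = Ψ
  rw [annihilation_creation, hf, add_comm]
  simpa using invSqrt_apply_invSqrt_apply (modeNumber_nonneg f n) Ψ

lemma norm_isometryPart_le {f : OneParticle s} (hf : ‖f‖ = 1) (n : ℕ) :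
    ‖isometryPart f n‖ ≤ 1 := by
  refine ContinuousLinearMap.opNorm_le_bound _ zero_le_one fun Ψ => ?_
  have h : inner ℂ (isometryPart f n Ψ) (isometryPart f n Ψ) = (inner ℂ Ψ Ψ : ℂ) := by
    rw [← ContinuousLinearMap.adjoint_inner_left, adjoint_isometryPart_isometryPart hf]
  rw [inner_self_eq_norm_sq_to_K, inner_self_eq_norm_sq_to_K] at h
  have h' : ‖isometryPart f n Ψ‖ ^ 2 = ‖Ψ‖ ^ 2 := by exact_mod_cast h
  rw [one_mul]
  exact ((pow_left_inj₀ (norm_nonneg _) (norm_nonneg _) two_ne_zero).1 h').le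

lemma exists_W_eq {f : OneParticle s} (hf : ‖f‖ = 1) :
    ∃ (C : ℝ) (hC : ∀ n, ‖isometryPart f n‖ ≤ C), W f = raising (isometryPart f) C hC := by
  have h : ∃ C : ℝ, ∀ n, ‖isometryPart f n‖ ≤ C := ⟨1, norm_isometryPart_le hf⟩
  exact ⟨h.choose, h.choose_spec, by rw [W, dif_pos h]⟩

lemma W_apply_zero {f : OneParticle s} (hf : ‖f‖ = 1) (Ψ : Fock s) : W f Ψ 0 = 0 := by
  obtain ⟨C, hC, h⟩ := exists_W_eq hf
  rw [h, raising_apply_zero]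

lemma W_apply_succ {f : OneParticle s} (hf : ‖f‖ = 1) (Ψ : Fock s) (n : ℕ) :
    W f Ψ (n + 1) = isometryPart f n (Ψ n) := by
  obtain ⟨C, hC, h⟩ := exists_W_eq hf
  rw [h, raising_apply_succ]

lemma star_W_apply {f : OneParticle s} (hf : ‖f‖ = 1) (Ψ : Fock s) (n : ℕ) :
    star (W f) Ψ n = ContinuousLinearMap.adjoint (isometryPart f n) (Ψ (n + 1)) := by
  obtain ⟨C, hC, h⟩ := exists_W_eq hf
  rw [h, ContinuousLinearMap.star_eq_adjoint, adjoint_raising_apply]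

lemma star_W_mul_W {f : OneParticle s} (hf : ‖f‖ = 1) : star (W f) * W f = 1 := by
  ext1 Ψ
  refine lp.ext (funext fun n => ?_)
  rw [mul_apply_eq_comp, star_W_apply hf, W_apply_succ hf, adjoint_isometryPart_isometryPart hf]
  rfl

end Mode

/-! ### Tensors -/

section Tensor

variable {s : ℕ}

lemma gauge_apply (u : ℝ) (Ψ : Fock s) (n : ℕ) :
    gauge s u Ψ n = Complex.exp (((u * n : ℝ) : ℂ) * Complex.I) • Ψ n := rfl

lemma gauge_neg_mul_gauge (u : ℝ) : gauge s (-u) * gauge s u = 1 := by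
  ext1 Ψ
  refine lp.ext (funext fun n => ?_)
  rw [mul_apply_eq_comp, gauge_apply, gauge_apply, smul_smul, ← Complex.exp_add]
  have : ((-u * n : ℝ) : ℂ) * Complex.I + ((u * n : ℝ) : ℂ) * Complex.I = 0 := by
    push_cast; ring
  rw [this, Complex.exp_zero, one_smul]
  rfl

lemma gauge_mul_gauge_neg (u : ℝ) : gauge s u * gauge s (-u) = 1 := by
  simpa using gauge_neg_mul_gauge (s := s) (-u)

lemma star_gauge (u : ℝ) : star (gauge s u) = gauge s (-u) := by
  ext1 Ψ
  refine lp.ext (funext fun n => ?_)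
  rw [ContinuousLinearMap.star_eq_adjoint, gauge, adjoint_diagonal_apply, gauge_apply,
    ← Complex.exp_conj, map_mul, Complex.conj_ofReal, Complex.conj_I]
  push_cast
  ring_nf

lemma isTensor_one : IsTensor 0 (1 : Fock s →L[ℂ] Fock s) := fun u => by
  rw [mul_one, gauge_mul_gauge_neg]
  simp

lemma IsTensor.mul {m k : ℤ} {S T : Fock s →L[ℂ] Fock s} (hS : IsTensor m S)
    (hT : IsTensor k T) : IsTensor (m + k) (S * T) := fun u => by
  calc gauge s u * (S * T) * gauge s (-u)
      = (gauge s u * S * gauge s (-u)) * (gauge s u * T * gauge s (-u)) := by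
        have := gauge_neg_mul_gauge (s := s) u
        calc _ = gauge s u * S * 1 * T * gauge s (-u) := by noncomm_ring
          _ = _ := by rw [← this]; noncomm_ring
    _ = _ := by
      rw [hS u, hT u, smul_mul_smul_comm, ← Complex.exp_add]
      congr 2
      push_cast
      ring

lemma IsTensor.star {m : ℤ} {T : Fock s →L[ℂ] Fock s} (hT : IsTensor m T) :
    IsTensor (-m) (star T) := fun u => by
  have h := congrArg Star.star (hT u)
  rw [star_mul, star_mul, star_gauge, star_gauge, neg_neg, star_smul, ← mul_assoc] at h
  rw [h]
  congr 1
  rw [← starRingEnd_apply, ← Complex.exp_conj, map_mul, Complex.conj_ofReal, Complex.conj_I]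
  push_cast
  ring_nf

lemma IsTensor.pow {m : ℤ} {T : Fock s →L[ℂ] Fock s} (hT : IsTensor m T) (n : ℕ) :
    IsTensor (n * m) (T ^ n) := by
  induction n with
  | zero => simpa using isTensor_one
  | succ n ih =>
    rw [pow_succ]
    have := ih.mul hT
    rwa [show (n * m + m : ℤ) = ((n + 1 : ℕ) : ℤ) * m by push_cast; ring] at this

lemma IsTensor.sub {m : ℤ} {S T : Fock s →L[ℂ] Fock s} (hS : IsTensor m S)
    (hT : IsTensor m T) : IsTensor m (S - T) := fun u => by
  rw [mul_sub, sub_mul, hS u, hT u, smul_sub]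

lemma IsTensor.add {m : ℤ} {S T : Fock s →L[ℂ] Fock s} (hS : IsTensor m S)
    (hT : IsTensor m T) : IsTensor m (S + T) := fun u => by
  rw [mul_add, add_mul, hS u, hT u, smul_add]

lemma IsTensor.smul {m : ℤ} {T : Fock s →L[ℂ] Fock s} (c : ℂ) (hT : IsTensor m T) :
    IsTensor m (c • T) := fun u => by
  rw [mul_smul_comm, smul_mul_assoc, hT u, smul_comm]

lemma IsTensor.zero (m : ℤ) : IsTensor m (0 : Fock s →L[ℂ] Fock s) := fun u => by simp

lemma isClosed_isTensor (m : ℤ) : IsClosed {T : Fock s →L[ℂ] Fock s | IsTensor m T} := by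
  have : {T : Fock s →L[ℂ] Fock s | IsTensor m T} = ⋂ u : ℝ, {T | gauge s u * T * gauge s (-u)
      = Complex.exp (((u * m : ℝ) : ℂ) * Complex.I) • T} := by
    ext T; simp [IsTensor]
  rw [this]
  exact isClosed_iInter fun u => isClosed_eq (by fun_prop) (by fun_prop)

lemma IsTensor.commute_gauge {T : Fock s →L[ℂ] Fock s} (hT : IsTensor 0 T) (u : ℝ) :
    Commute (gauge s u) T := by
  have h := congrArg (· * gauge s u) (hT u)
  simp only [mul_assoc, gauge_neg_mul_gauge, mul_one] at h
  change gauge s u * T = T * gauge s u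
  simpa using h

lemma isTensor_of_commute_gauge {T : Fock s →L[ℂ] Fock s} (hT : ∀ u, Commute (gauge s u) T) :
    IsTensor 0 T := fun u => by
  rw [(hT u).eq, mul_assoc, gauge_mul_gauge_neg]
  simp

lemma isTensor_W {f : OneParticle s} (hf : ‖f‖ = 1) : IsTensor 1 (W f) := fun u => by
  ext1 Ψ
  refine lp.ext (funext fun n => ?_)
  rw [mul_apply_eq_comp, mul_apply_eq_comp, gauge_apply, smul_apply, lp.coeFn_smul, Pi.smul_apply]
  cases n with
  | zero => rw [W_apply_zero hf, W_apply_zero hf, smul_zero, smul_zero]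
  | succ n =>
    rw [W_apply_succ hf, W_apply_succ hf, gauge_apply, map_smul, smul_smul, ← Complex.exp_add]
    congr 2
    push_cast
    ring

/-- An operator commuting with all gauge transformations preserves the particle number. -/
lemma IsTensor.commute_atMost {T : Fock s →L[ℂ] Fock s} (hT : IsTensor 0 T) (n : ℕ) :
    Commute (atMost s n) T := by
  refine ext_on_finiteVectors fun k x => ?_
  set e : Fock s := lp.single 2 k x with he
  have hg : ∀ u, gauge s u e = Complex.exp (((u * k : ℝ) : ℂ) * Complex.I) • e := by
    intro u
    refine lp.ext (funext fun m => ?_)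
    rw [gauge_apply, lp.coeFn_smul, Pi.smul_apply]
    by_cases h : m = k
    · rw [h]
    · rw [he, lp.single_apply_ne 2 k x h, smul_zero, smul_zero]
  have h0 : ∀ m, m ≠ k → T e m = 0 := by
    intro m hm
    have hmk : (m : ℝ) - k ≠ 0 := sub_ne_zero.2 (by exact_mod_cast hm)
    -- This angle makes the phases on m and k particles differ by the factor -1.
    set u : ℝ := Real.pi / (m - k)
    have h1 : gauge s u (T e) = T (gauge s u e) := DFunLike.congr_fun (hT.commute_gauge u).eq e
    rw [hg, map_smul] at h1
    have h2 : gauge s u (T e) m = (Complex.exp (((u * k : ℝ) : ℂ) * Complex.I) • T e) m := by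
      rw [h1]
    rw [gauge_apply, lp.coeFn_smul, Pi.smul_apply, ← sub_eq_zero, ← sub_smul, smul_eq_zero] at h2
    refine h2.resolve_left fun h3 => ?_
    have h4 : ((u * m : ℝ) : ℂ) * Complex.I = ((u * k : ℝ) : ℂ) * Complex.I
        + Real.pi * Complex.I := by
      have : u * m = u * k + Real.pi := by
        have : u * (m - k) = Real.pi := div_mul_cancel₀ _ hmk
        linarith
      rw [this]; push_cast; ring
    rw [h4, Complex.exp_add, Complex.exp_pi_mul_I] at h3
    have h5 : Complex.exp (((u * k : ℝ) : ℂ) * Complex.I) = 0 := by linear_combination (-1 / 2) * h3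
    exact Complex.exp_ne_zero _ h5
  have hP : ∀ Ψ : Fock s, (∀ m, m ≠ k → Ψ m = 0) →
      atMost s n Ψ = (if k ≤ n then (1 : ℂ) else 0) • Ψ := by
    intro Ψ hΨ
    refine lp.ext (funext fun m => ?_)
    change (if m ≤ n then (1 : ℂ) else 0) • Ψ m = (if k ≤ n then (1 : ℂ) else 0) • Ψ m
    by_cases h : m = k
    · rw [h]
    · rw [hΨ m h, smul_zero, smul_zero]
  change atMost s n (T e) = T (atMost s n e)
  rw [hP _ h0, hP e fun m hm => lp.single_apply_ne 2 k x hm, map_smul]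

end Tensor

/-! ### Dependence of `W_f` on `f` -/

section Lipschitz

variable {s : ℕ}

lemma atMost_apply (n : ℕ) (Ψ : Fock s) (k : ℕ) :
    atMost s n Ψ k = if k ≤ n then Ψ k else 0 := truncate_apply n Ψ k

lemma exists_lipschitz_star_W (s n : ℕ) : ∃ L, 0 ≤ L ∧ ∀ f g : OneParticle s, ‖f‖ = 1 →
    ‖g‖ = 1 → ‖(star (W f) - star (W g)) * atMost s n‖ ≤ L * ‖f - g‖ := by
  choose L hL h using exists_lipschitz_isometryPart s
  refine ⟨∑ k ∈ Finset.range n, L k, Finset.sum_nonneg fun k _ => hL k, fun f g hf hg => ?_⟩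
  -- Component k of W*P_nΨ involves only Ψ (k+1), so it vanishes unless k < n. The sum of the
  -- finitely many Lipschitz constants serves as a common bound.
  set B : (k : ℕ) → (Particles s k →L[ℂ] Particles s (k + 1)) := fun k =>
    if k < n then isometryPart f k - isometryPart g k else 0 with hB
  have hBn : ∀ k, ‖B k‖ ≤ (∑ k ∈ Finset.range n, L k) * ‖f - g‖ := by
    intro k
    by_cases hk : k < n
    · simp only [hB, if_pos hk]
      refine (h k f g hf hg).trans (mul_le_mul_of_nonneg_right ?_ (norm_nonneg _))
      exact Finset.single_le_sum (fun k _ => hL k) (Finset.mem_range.2 hk)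
    · simp only [hB, if_neg hk, norm_zero]
      exact mul_nonneg (Finset.sum_nonneg fun k _ => hL k) (norm_nonneg _)
  have e : (star (W f) - star (W g)) * atMost s n
      = ContinuousLinearMap.adjoint (raising B _ hBn) := by
    ext1 Ψ
    refine lp.ext (funext fun k => ?_)
    rw [adjoint_raising_apply, mul_apply_eq_comp, sub_apply, lp.coeFn_sub, Pi.sub_apply,
      star_W_apply hf, star_W_apply hg, atMost_apply]
    by_cases hk : k < n
    · simp only [hB, if_pos hk, if_pos (Nat.succ_le_of_lt hk), map_sub]
      rfl
    · simp [hB, if_neg hk]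
  rw [e, LinearIsometryEquiv.norm_map]
  exact norm_raising_le _ _ _

lemma norm_W_apply {f : OneParticle s} (hf : ‖f‖ = 1) (Ψ : Fock s) : ‖W f Ψ‖ = ‖Ψ‖ := by
  have h : inner ℂ (W f Ψ) (W f Ψ) = (inner ℂ Ψ Ψ : ℂ) := by
    rw [← ContinuousLinearMap.adjoint_inner_left, ← ContinuousLinearMap.star_eq_adjoint,
      ← mul_apply_eq_comp, star_W_mul_W hf]
    rfl
  rw [inner_self_eq_norm_sq_to_K, inner_self_eq_norm_sq_to_K] at h
  have h' : ‖W f Ψ‖ ^ 2 = ‖Ψ‖ ^ 2 := by exact_mod_cast h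
  exact (pow_left_inj₀ (norm_nonneg _) (norm_nonneg _) two_ne_zero).1 h'

lemma norm_star_W_le {f : OneParticle s} (hf : ‖f‖ = 1) : ‖star (W f)‖ ≤ 1 := by
  rw [ContinuousLinearMap.star_eq_adjoint, LinearIsometryEquiv.norm_map]
  exact ContinuousLinearMap.opNorm_le_bound _ zero_le_one fun Ψ => by
    rw [norm_W_apply hf, one_mul]

lemma star_W_pow_apply_eq_zero {f : OneParticle s} (hf : ‖f‖ = 1) {n : ℕ} {Ψ : Fock s}
    (h : ∀ k, n ≤ k → Ψ k = 0) : (star (W f) ^ n) Ψ = 0 := by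
  induction n generalizing Ψ with
  | zero => exact lp.ext (funext fun k => h k (Nat.zero_le k))
  | succ n ih =>
    rw [pow_succ, mul_apply_eq_comp]
    refine ih fun k hk => ?_
    rw [star_W_apply hf, h (k + 1) (by omega), map_zero]

lemma star_W_mem_finiteVectors {f : OneParticle s} (hf : ‖f‖ = 1) {Ψ : Fock s}
    (h : Ψ ∈ finiteVectors (Particles s)) : star (W f) Ψ ∈ finiteVectors (Particles s) := by
  obtain ⟨k, hk⟩ := h
  exact ⟨k, fun n hn => by rw [star_W_apply hf, hk (n + 1) (by omega), map_zero]⟩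

lemma W_mem_finiteVectors {f : OneParticle s} (hf : ‖f‖ = 1) {Ψ : Fock s}
    (h : Ψ ∈ finiteVectors (Particles s)) : W f Ψ ∈ finiteVectors (Particles s) := by
  obtain ⟨k, hk⟩ := h
  refine ⟨k + 1, fun n hn => ?_⟩
  obtain ⟨n, rfl⟩ : ∃ m, n = m + 1 := ⟨n - 1, by omega⟩
  rw [W_apply_succ hf, hk n (by omega), map_zero]

end Lipschitz

/-! ### Eigenvectors of the mode number -/

section Eigen

variable {s : ℕ} {f : OneParticle s}

/-- `Ψ` is an eigenvector of `N_f` for the eigenvalue `j`. -/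
def HasModeNumber (f : OneParticle s) (j : ℕ) (Ψ : Fock s) : Prop :=
  ∀ n, modeNumber f n (Ψ n) = (j : ℂ) • Ψ n

lemma sqrt_ne_zero (j : ℕ) : ((Real.sqrt (j + 1) : ℝ) : ℂ) ≠ 0 := by
  have : 0 < Real.sqrt (j + 1) := Real.sqrt_pos.2 (by positivity)
  exact_mod_cast this.ne'

/-- On an eigenvector of N_f the factor (1+N_f)^{-1/2} is the number (j+1)^{-1/2}, so a*(f) is a
multiple of W_f there. -/
lemma HasModeNumber.creation_apply (hf : ‖f‖ = 1) {j : ℕ} {Ψ : Fock s}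
    (h : HasModeNumber f j Ψ) (n : ℕ) :
    creation f n (Ψ n) = ((Real.sqrt (j + 1) : ℝ) : ℂ) • W f Ψ (n + 1) := by
  rw [W_apply_succ hf]
  change _ = _ • creation f n (invSqrt (modeNumber f n) (Ψ n))
  rw [invSqrt_apply_of_eigen (modeNumber_nonneg f n) (h n), map_smul, smul_smul,
    mul_inv_cancel₀ (sqrt_ne_zero j), one_smul]

lemma HasModeNumber.annihilation_apply (hf : ‖f‖ = 1) {j : ℕ} {Ψ : Fock s}
    (h : HasModeNumber f j Ψ) (n : ℕ) :
    annihilation f n (W f Ψ (n + 1)) = ((Real.sqrt (j + 1) : ℝ) : ℂ) • Ψ n := by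
  have h1 := annihilation_creation f (Ψ n)
  rw [h n, h.creation_apply hf, map_smul, hf, ← add_smul] at h1
  have h2 := congrArg (fun Φ => ((Real.sqrt (j + 1) : ℝ) : ℂ)⁻¹ • Φ) h1
  simp only [smul_smul, inv_mul_cancel₀ (sqrt_ne_zero j), one_smul] at h2
  rw [h2]
  congr 1
  rw [inv_mul_eq_iff_eq_mul₀ (sqrt_ne_zero j), sqrt_mul_sqrt]
  simp

lemma HasModeNumber.W (hf : ‖f‖ = 1) {j : ℕ} {Ψ : Fock s}
    (h : HasModeNumber f j Ψ) : HasModeNumber f (j + 1) (W f Ψ) := by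
  intro n
  cases n with
  | zero => rw [W_apply_zero hf, map_zero, smul_zero]
  | succ n =>
    change creation f n (annihilation f n (BoseFock.W f Ψ (n + 1))) = _
    rw [h.annihilation_apply hf, map_smul, h.creation_apply hf, smul_smul, sqrt_mul_sqrt]
    push_cast
    rfl

lemma annihilation_of_star_W_eq_zero (hf : ‖f‖ = 1) {κ : Fock s} (h : star (W f) κ = 0) (n : ℕ) :
    annihilation f n (κ (n + 1)) = 0 := by
  refine invSqrt_injective (modeNumber_nonneg f n) ?_
  rw [← adjoint_isometryPart, ← star_W_apply hf, h]
  rfl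

lemma hasModeNumber_zero (hf : ‖f‖ = 1) {κ : Fock s} (h : star (W f) κ = 0) :
    HasModeNumber f 0 κ := by
  intro n
  cases n with
  | zero => simp [modeNumber]
  | succ n =>
    change creation f n (annihilation f n (κ (n + 1))) = _
    rw [annihilation_of_star_W_eq_zero hf h, map_zero]
    simp

lemma hasModeNumber_pow (hf : ‖f‖ = 1) {κ : Fock s} (h : star (W f) κ = 0) (j : ℕ) :
    HasModeNumber f j ((BoseFock.W f ^ j) κ) := by
  induction j with
  | zero => simpa using hasModeNumber_zero hf h
  | succ j ih =>
    rw [pow_succ', mul_apply_eq_comp]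
    exact ih.W hf

lemma jacobi_creation_pow_zero (hf : ‖f‖ = 1) {κ : Fock s} (h : star (W f) κ = 0) (z : ℂ) (n : ℕ) :
    jacobi (creation (z • f)) (κ : ∀ n, Particles s n) n = z • W f κ n := by
  have h1 : ∀ n, ContinuousLinearMap.adjoint (creation (z • f) n) (κ (n + 1)) = 0 := fun n => by
    change annihilation (z • f) n (κ (n + 1)) = 0
    rw [annihilation_smul, smul_apply, annihilation_of_star_W_eq_zero hf h, smul_zero]
  cases n with
  | zero => rw [jacobi_zero, h1, W_apply_zero hf, smul_zero]
  | succ n =>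
    rw [jacobi_succ, h1, add_zero, creation_smul, smul_apply,
      (hasModeNumber_zero hf h).creation_apply hf]
    simp

/-- The field φ(zf) acts on the vectors W^jκ with the same coefficients as z a* + z̄ a on the basis
of a single mode. -/
lemma jacobi_creation_pow_succ (hf : ‖f‖ = 1) {κ : Fock s} (h : star (W f) κ = 0) (z : ℂ)
    (j n : ℕ) :
    jacobi (creation (z • f)) ((W f ^ (j + 1)) κ : Fock s) n
      = (z * (Real.sqrt ((j + 1 : ℕ) + 1) : ℝ)) • (W f ^ (j + 2)) κ n
        + (starRingEnd ℂ z * (Real.sqrt (j + 1) : ℝ)) • (W f ^ j) κ n := by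
  have h1 : ∀ n, ContinuousLinearMap.adjoint (creation (z • f) n) ((W f ^ (j + 1)) κ (n + 1))
      = (starRingEnd ℂ z * (Real.sqrt (j + 1) : ℝ)) • (W f ^ j) κ n := fun n => by
    change annihilation (z • f) n _ = _
    rw [annihilation_smul, smul_apply, pow_succ', mul_apply_eq_comp,
      (hasModeNumber_pow hf h j).annihilation_apply hf, smul_smul]
  have h2 : W f ((W f ^ (j + 1)) κ) = (W f ^ (j + 2)) κ := by
    rw [pow_succ' (W f) (j + 1), mul_apply_eq_comp]
  cases n with
  | zero => rw [jacobi_zero, h1, ← h2, W_apply_zero hf, smul_zero, zero_add]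
  | succ n =>
    rw [jacobi_succ, h1, creation_smul, smul_apply,
      (hasModeNumber_pow hf h (j + 1)).creation_apply hf, smul_smul, h2]

end Eigen

/-! ### Embeddings of the single mode space -/

section Embedding

variable {s : ℕ} {f : OneParticle s}

/-- The unit vectors with finitely many particles which are annihilated by `W_f*`. -/
structure IsVacuum (f : OneParticle s) (κ : Fock s) : Prop where
  finite : κ ∈ finiteVectors (Particles s)
  norm_eq : ‖κ‖ = 1
  star_W : star (W f) κ = 0

lemma star_W_W (hf : ‖f‖ = 1) (Ψ : Fock s) : star (W f) (W f Ψ) = Ψ := by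
  rw [← mul_apply_eq_comp, star_W_mul_W hf]
  rfl

lemma star_W_pow_W_pow (hf : ‖f‖ = 1) {κ : Fock s} (h : star (W f) κ = 0) (j k : ℕ) :
    (star (W f) ^ j) ((W f ^ k) κ) = if j ≤ k then (W f ^ (k - j)) κ else 0 := by
  induction j generalizing k with
  | zero => simp
  | succ j ih =>
    rw [pow_succ, mul_apply_eq_comp]
    cases k with
    | zero => rw [pow_zero, one_apply_eq_self, h, map_zero, if_neg (by omega)]
    | succ k =>
      rw [pow_succ', mul_apply_eq_comp, star_W_W hf, ih]
      simp

lemma IsVacuum.orthonormal (hf : ‖f‖ = 1) {κ : Fock s} (h : IsVacuum f κ) :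
    Orthonormal ℂ fun j : ℕ => (W f ^ j) κ := by
  have hn : ∀ j, ‖(W f ^ j) κ‖ = 1 := by
    intro j
    induction j with
    | zero => simpa using h.norm_eq
    | succ j ih => rw [pow_succ', mul_apply_eq_comp, norm_W_apply hf, ih]
  have hlt : ∀ j k, j < k → inner ℂ ((W f ^ j) κ) ((W f ^ k) κ) = (0 : ℂ) := by
    intro j k hjk
    rw [← inner_conj_symm, map_eq_zero, ← star_star (W f ^ k), ContinuousLinearMap.star_eq_adjoint,
      ContinuousLinearMap.adjoint_inner_left, star_pow, star_W_pow_W_pow hf h.star_W,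
      if_neg (by omega), inner_zero_right]
  refine ⟨hn, fun j k hjk => ?_⟩
  rcases lt_or_gt_of_ne hjk with hlt' | hlt'
  · exact hlt j k hlt'
  · change inner ℂ ((W f ^ j) κ) ((W f ^ k) κ) = (0 : ℂ)
    rw [← inner_conj_symm, hlt k j hlt', map_zero]

/-- The embedding of the single mode space which maps the basis to the vectors `W_fʲ κ`. -/
def embedding (hf : ‖f‖ = 1) {κ : Fock s} (h : IsVacuum f κ) : Mode →ₗᵢ[ℂ] Fock s :=
  (h.orthonormal hf).orthogonalFamily.linearIsometry

variable (hf : ‖f‖ = 1) {κ : Fock s} (h : IsVacuum f κ)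

lemma embedding_modeBasis (j : ℕ) : embedding hf h (modeBasis j) = (W f ^ j) κ := by
  rw [embedding, modeBasis, OrthogonalFamily.linearIsometry_apply_single]
  simp

/-- The embedding as a continuous linear map. -/
def embeddingL : Mode →L[ℂ] Fock s := (embedding hf h).toContinuousLinearMap

lemma embeddingL_modeBasis (j : ℕ) : embeddingL hf h (modeBasis j) = (W f ^ j) κ :=
  embedding_modeBasis hf h j

lemma finiteMode_induction {p : FiniteMode → Prop} (hb : ∀ j, p (finiteBasis j))
    (hadd : ∀ x y, p x → p y → p (x + y)) (hsmul : ∀ (c : ℂ) x, p x → p (c • x)) (x : FiniteMode) :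
    p x := by
  obtain ⟨k, hk⟩ := x.2
  have h0 : p 0 := by simpa using hsmul 0 _ (hb 0)
  have e : x = ∑ j ∈ Finset.range k, (x : Mode) j • finiteBasis j := by
    refine Subtype.ext (lp.ext (funext fun n => ?_))
    have : ((∑ j ∈ Finset.range k, (x : Mode) j • finiteBasis j : FiniteMode) : Mode) n
        = ∑ j ∈ Finset.range k, (x : Mode) j * (modeBasis j) n := by
      rw [Submodule.coe_sum, lp.coeFn_sum, Finset.sum_apply]
      rfl
    rw [this]
    by_cases hn : n < k
    · rw [Finset.sum_eq_single n]
      · rw [modeBasis_apply, if_pos rfl, mul_one]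
      · intro j _ hj
        rw [modeBasis_apply, if_neg hj.symm, mul_zero]
      · intro h
        exact absurd (Finset.mem_range.2 hn) h
    · rw [hk n (not_lt.1 hn), Finset.sum_eq_zero]
      intro j hj
      rw [modeBasis_apply, if_neg (by have := Finset.mem_range.1 hj; omega), mul_zero]
  rw [e]
  exact Finset.sum_induction _ p hadd h0 fun j _ => hsmul _ _ (hb j)

lemma W_pow_mem_finiteVectors (hf : ‖f‖ = 1) {Ψ : Fock s} (hΨ : Ψ ∈ finiteVectors (Particles s))
    (j : ℕ) : (W f ^ j) Ψ ∈ finiteVectors (Particles s) := by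
  induction j with
  | zero => simpa using hΨ
  | succ j ih =>
    rw [pow_succ', mul_apply_eq_comp]
    exact W_mem_finiteVectors hf ih

lemma embeddingL_mem (x : FiniteMode) : embeddingL hf h x ∈ finiteVectors (Particles s) := by
  refine finiteMode_induction (p := fun x => embeddingL hf h x ∈ finiteVectors (Particles s))
    (fun j => ?_) (fun x y hx hy => ?_) (fun c x hx => ?_) x
  · change embeddingL hf h (modeBasis j) ∈ _
    rw [embeddingL_modeBasis]
    exact W_pow_mem_finiteVectors hf h.finite j
  · rw [Submodule.coe_add, map_add]
    exact add_mem hx hy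
  · rw [Submodule.coe_smul, map_smul]
    exact Submodule.smul_mem _ c hx

/-- The embedding of the finite vectors. -/
def embeddingFin : FiniteMode →ₗ[ℂ] finiteVectors (Particles s) where
  toFun x := ⟨embeddingL hf h x, embeddingL_mem hf h x⟩
  map_add' x y := Subtype.ext (map_add (embeddingL hf h) (x : Mode) y)
  map_smul' c x := Subtype.ext (map_smul (embeddingL hf h) c (x : Mode))

lemma jacobiFin_ladder_zero (z : ℂ) :
    jacobiFin (ladder z) (finiteBasis 0) = z • finiteBasis 1 := by
  refine Subtype.ext (lp.ext (funext fun n => ?_))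
  change jacobi (ladder z) (modeBasis 0 : ℕ → ℂ) n = z * modeBasis 1 n
  cases n with
  | zero => simp [modeBasis_apply]
  | succ n =>
    rw [jacobi_ladder_succ, modeBasis_apply, modeBasis_apply, modeBasis_apply,
      if_neg (by omega : ¬ n + 2 = 0)]
    by_cases hn : n = 0
    · subst hn; simp
    · simp [hn]

lemma jacobiFin_ladder_succ (z : ℂ) (j : ℕ) :
    jacobiFin (ladder z) (finiteBasis (j + 1))
      = (z * (Real.sqrt ((j + 1 : ℕ) + 1) : ℝ)) • finiteBasis (j + 2)
        + (starRingEnd ℂ z * (Real.sqrt (j + 1) : ℝ)) • finiteBasis j := by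
  refine Subtype.ext (lp.ext (funext fun n => ?_))
  change jacobi (ladder z) (modeBasis (j + 1) : ℕ → ℂ) n
    = z * (Real.sqrt ((j + 1 : ℕ) + 1) : ℝ) * modeBasis (j + 2) n
      + starRingEnd ℂ z * (Real.sqrt (j + 1) : ℝ) * modeBasis j n
  cases n with
  | zero =>
    rw [jacobi_ladder_zero, modeBasis_apply, modeBasis_apply, modeBasis_apply]
    rcases Nat.eq_zero_or_pos j with rfl | hj
    · simp
    · rw [if_neg (by omega), if_neg (by omega), if_neg (by omega)]
      simp
  | succ n =>
    rw [jacobi_ladder_succ, modeBasis_apply, modeBasis_apply, modeBasis_apply, modeBasis_apply]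
    by_cases h1 : n = j + 1
    · subst h1
      rw [if_pos rfl, if_neg (by omega), if_pos rfl, if_neg (by omega)]
      simp
    · by_cases h2 : n + 1 = j
      · subst h2
        rw [if_neg (by omega), if_pos rfl, if_neg (by omega), if_pos rfl]
        push_cast
        rw [add_assoc (n : ℝ) 1 1, one_add_one_eq_two]
        simp
      · rw [if_neg h1, if_neg (by omega), if_neg (by omega), if_neg (by omega)]
        simp

lemma jacobiFin_embeddingFin (z : ℂ) (x : FiniteMode) :
    jacobiFin (creation (z • f)) (embeddingFin hf h x)
      = embeddingFin hf h (jacobiFin (ladder z) x) := by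
  refine finiteMode_induction (p := fun x => jacobiFin (creation (z • f)) (embeddingFin hf h x)
      = embeddingFin hf h (jacobiFin (ladder z) x)) (fun j => ?_) (fun x y hx hy => ?_)
      (fun c x hx => ?_) x
  · have hb : ∀ j, (embeddingFin hf h (finiteBasis j) : Fock s) = (W f ^ j) κ :=
      embeddingL_modeBasis hf h
    refine Subtype.ext (lp.ext (funext fun n => ?_))
    rw [jacobiFin_apply, hb]
    cases j with
    | zero =>
      rw [jacobiFin_ladder_zero, map_smul, Submodule.coe_smul, hb, pow_zero, pow_one]
      exact jacobi_creation_pow_zero hf h.star_W z n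
    | succ j =>
      rw [jacobiFin_ladder_succ, map_add, map_smul, map_smul, Submodule.coe_add, Submodule.coe_smul,
        Submodule.coe_smul, hb, hb]
      exact jacobi_creation_pow_succ hf h.star_W z j n
  · rw [map_add, map_add, map_add, map_add, hx, hy]
  · rw [map_smul, map_smul, map_smul, map_smul, hx]

lemma jacobiShift_embeddingFin (z : ℂ) (μ : ℝ) (x : FiniteMode) :
    (jacobiShift (creation (z • f)) μ (embeddingFin hf h x) : Fock s)
      = embeddingL hf h (jacobiShift (ladder z) μ x : Mode) := by
  rw [coe_jacobiShift, jacobiFin_embeddingFin, coe_jacobiShift, map_add, map_smul]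
  rfl

lemma resolvent_comp_embeddingL {z : ℂ} (hz : ‖z‖ = 1) {μ : ℝ} (hμ : μ ≠ 0)
    {R : Fock s →L[ℂ] Fock s} (hR : IsJacobiResolvent (creation (z • f)) μ R) {r : Mode →L[ℂ] Mode}
    (hr : IsJacobiResolvent (ladder z) μ r) :
    R ∘L embeddingL hf h = embeddingL hf h ∘L r := by
  refine ContinuousLinearMap.coeFn_injective
    ((denseRange_jacobiShift (ladder z) (norm_ladder_le hz) hμ).equalizer
      (R ∘L embeddingL hf h).continuous (embeddingL hf h ∘L r).continuous (funext fun x => ?_))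
  change R (embeddingL hf h (jacobiShift (ladder z) μ x : Mode))
    = embeddingL hf h (r (jacobiShift (ladder z) μ x : Mode))
  rw [hr.apply_shift, ← jacobiShift_embeddingFin, hR.apply_shift]
  rfl

/-- Both adjoints invert the shift by -μ on finite vectors, so the two sides agree on its dense
range. This makes the set of intertwined pairs stable under adjoints. -/
lemma adjoint_resolvent_comp_embeddingL {z : ℂ} (hz : ‖z‖ = 1) {μ : ℝ} (hμ : μ ≠ 0)
    {R : Fock s →L[ℂ] Fock s} (hR : IsJacobiResolvent (creation (z • f)) μ R) {r : Mode →L[ℂ] Mode}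
    (hr : IsJacobiResolvent (ladder z) μ r) :
    star R ∘L embeddingL hf h = embeddingL hf h ∘L star r := by
  refine ContinuousLinearMap.coeFn_injective
    ((denseRange_jacobiShift (ladder z) (norm_ladder_le hz) (neg_ne_zero.2 hμ)).equalizer
      (star R ∘L embeddingL hf h).continuous (embeddingL hf h ∘L star r).continuous
      (funext fun x => ?_))
  change ContinuousLinearMap.adjoint R (embeddingL hf h (jacobiShift (ladder z) (-μ) x : Mode))
    = embeddingL hf h (ContinuousLinearMap.adjoint r (jacobiShift (ladder z) (-μ) x : Mode))
  rw [hr.adjoint_apply_shift, ← jacobiShift_embeddingFin, hR.adjoint_apply_shift]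
  rfl

end Embedding

/-! ### Transfer of operators from a single mode to Fock space -/

section Transfer

variable {s : ℕ} {f : OneParticle s}

lemma isClosed_resolventAlgebra (s : ℕ) :
    IsClosed (resolventAlgebra s : Set (Fock s →L[ℂ] Fock s)) :=
  StarSubalgebra.isClosed_topologicalClosure _

/-- The operators in the resolvent algebra together with operators on the single mode space by
which they act on all vectors `W_fʲ κ`. -/
def intertwined (hf : ‖f‖ = 1) : StarSubalgebra ℂ ((Fock s →L[ℂ] Fock s) × (Mode →L[ℂ] Mode)) where
  carrier := {p | p.1 ∈ resolventAlgebra s ∧ ∀ (κ : Fock s) (h : IsVacuum f κ),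
    p.1 ∘L embeddingL hf h = embeddingL hf h ∘L p.2 ∧
    star p.1 ∘L embeddingL hf h = embeddingL hf h ∘L star p.2}
  mul_mem' {p q} hp hq := by
    refine ⟨mul_mem hp.1 hq.1, fun κ h => ⟨?_, ?_⟩⟩
    · change p.1 ∘L q.1 ∘L embeddingL hf h = _
      rw [(hq.2 κ h).1, ← ContinuousLinearMap.comp_assoc, (hp.2 κ h).1]
      rfl
    · rw [Prod.fst_mul, Prod.snd_mul, star_mul, star_mul]
      change star q.1 ∘L star p.1 ∘L embeddingL hf h = _
      rw [(hp.2 κ h).2, ← ContinuousLinearMap.comp_assoc, (hq.2 κ h).2]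
      rfl
  add_mem' {p q} hp hq := by
    refine ⟨add_mem hp.1 hq.1, fun κ h => ⟨?_, ?_⟩⟩
    · rw [Prod.fst_add, Prod.snd_add, ContinuousLinearMap.add_comp, ContinuousLinearMap.comp_add,
        (hp.2 κ h).1, (hq.2 κ h).1]
    · rw [Prod.fst_add, Prod.snd_add, star_add, star_add, ContinuousLinearMap.add_comp,
        ContinuousLinearMap.comp_add, (hp.2 κ h).2, (hq.2 κ h).2]
  algebraMap_mem' c := by
    refine ⟨algebraMap_mem _ c, fun κ h => ⟨?_, ?_⟩⟩
    · change (algebraMap ℂ (Fock s →L[ℂ] Fock s) c) ∘L embeddingL hf h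
        = embeddingL hf h ∘L (algebraMap ℂ (Mode →L[ℂ] Mode) c)
      rw [Algebra.algebraMap_eq_smul_one, Algebra.algebraMap_eq_smul_one]
      ext1 x
      exact (map_smul (embeddingL hf h) c x).symm
    · change star (algebraMap ℂ (Fock s →L[ℂ] Fock s) c) ∘L embeddingL hf h
        = embeddingL hf h ∘L star (algebraMap ℂ (Mode →L[ℂ] Mode) c)
      rw [Algebra.algebraMap_eq_smul_one, Algebra.algebraMap_eq_smul_one, star_smul, star_smul,
        star_one, star_one]
      ext1 x
      exact (map_smul (embeddingL hf h) (star c) x).symm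
  star_mem' {p} hp := by
    refine ⟨star_mem hp.1, fun κ h => ⟨(hp.2 κ h).2, ?_⟩⟩
    rw [Prod.fst_star, Prod.snd_star, star_star, star_star]
    exact (hp.2 κ h).1

lemma isClosed_intertwined (hf : ‖f‖ = 1) :
    IsClosed (intertwined hf : Set ((Fock s →L[ℂ] Fock s) × (Mode →L[ℂ] Mode))) := by
  have : (intertwined hf : Set ((Fock s →L[ℂ] Fock s) × (Mode →L[ℂ] Mode)))
      = Prod.fst ⁻¹' (resolventAlgebra s : Set (Fock s →L[ℂ] Fock s)) ∩
        ⋂ (κ : Fock s) (h : IsVacuum f κ), {p | p.1 ∘L embeddingL hf h = embeddingL hf h ∘L p.2 ∧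
          star p.1 ∘L embeddingL hf h = embeddingL hf h ∘L star p.2} := by
    ext p
    simp only [Set.mem_inter_iff, Set.mem_iInter]
    rfl
  rw [this]
  refine ((isClosed_resolventAlgebra s).preimage continuous_fst).inter
    (isClosed_iInter fun κ => isClosed_iInter fun h => ?_)
  have h1 : Continuous fun p : (Fock s →L[ℂ] Fock s) × (Mode →L[ℂ] Mode) => star p.1 :=
    continuous_fst.star
  have h2 : Continuous fun p : (Fock s →L[ℂ] Fock s) × (Mode →L[ℂ] Mode) => star p.2 :=
    continuous_snd.star
  exact (isClosed_eq (continuous_fst.clm_comp continuous_const)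
    (continuous_const.clm_comp continuous_snd)).inter
    (isClosed_eq (h1.clm_comp continuous_const) (continuous_const.clm_comp h2))

/-- Wold decomposition by telescoping: the i-th summand is (W^iW*^i - W^{i+1}W*^{i+1})Ψ. -/
lemma sub_W_pow (j : ℕ) (Ψ : Fock s) :
    Ψ = ∑ i ∈ Finset.range j, (W f ^ i) (((1 : Fock s →L[ℂ] Fock s) - W f * star (W f))
      ((star (W f) ^ i) Ψ)) + (W f ^ j) ((star (W f) ^ j) Ψ) := by
  induction j with
  | zero => simp
  | succ j ih =>
    conv_lhs => rw [ih]
    rw [Finset.sum_range_succ, add_assoc]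
    congr 1
    rw [sub_apply, one_apply_eq_self, mul_apply_eq_comp, map_sub, pow_succ, pow_succ',
      mul_apply_eq_comp, mul_apply_eq_comp, sub_add_cancel]

/-- Operators on Fock space are determined by their values on the vectors `W_fʲ κ`. -/
lemma ext_on_vacuum (hf : ‖f‖ = 1) {A B : Fock s →L[ℂ] Fock s}
    (hAB : ∀ κ, IsVacuum f κ → ∀ j, A ((W f ^ j) κ) = B ((W f ^ j) κ)) : A = B := by
  have h0 : ∀ κ : Fock s, κ ∈ finiteVectors (Particles s) → star (W f) κ = 0 → ∀ j,
      A ((W f ^ j) κ) = B ((W f ^ j) κ) := by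
    intro κ hκ hW j
    by_cases hκ0 : κ = 0
    · rw [hκ0, map_zero, map_zero, map_zero]
    have hn : (‖κ‖ : ℂ) ≠ 0 := by exact_mod_cast norm_ne_zero_iff.2 hκ0
    have := hAB ((‖κ‖ : ℂ)⁻¹ • κ) ⟨Submodule.smul_mem _ _ hκ, by
      rw [norm_smul, norm_inv, Complex.norm_real, norm_norm,
        inv_mul_cancel₀ (norm_ne_zero_iff.2 hκ0)],
      by rw [map_smul, hW, smul_zero]⟩ j
    simp only [map_smul] at this
    exact smul_right_injective _ (inv_ne_zero hn) this
  refine ext_on_finiteVectors fun n x => ?_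
  obtain ⟨k, hk⟩ := single_mem_finiteVectors n x
  set Ψ : Fock s := lp.single 2 n x
  -- A vector with finitely many particles is killed by a high power of W*, so the remainder
  -- vanishes and Ψ is a sum of vectors W^iκ with W*κ = 0.
  rw [sub_W_pow (f := f) k Ψ, star_W_pow_apply_eq_zero hf hk, map_zero, add_zero, map_sum, map_sum]
  refine Finset.sum_congr rfl fun i _ => h0 _ ?_ ?_ i
  · have hi : ∀ i : ℕ, (star (W f) ^ i) Ψ ∈ finiteVectors (Particles s) := by
      intro i
      induction i with
      | zero => exact ⟨k, hk⟩
      | succ i ih =>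
        rw [pow_succ', mul_apply_eq_comp]
        exact star_W_mem_finiteVectors hf ih
    rw [sub_apply, one_apply_eq_self, mul_apply_eq_comp]
    exact sub_mem (hi i) (W_mem_finiteVectors hf (star_W_mem_finiteVectors hf (hi i)))
  · rw [sub_apply, one_apply_eq_self, mul_apply_eq_comp, map_sub, star_W_W hf, sub_self]

lemma smul_mem_testVectors (z : ℂ) (hf : f ∈ testVectors s) : z • f ∈ testVectors s := by
  obtain ⟨g, hg⟩ := hf
  refine ⟨z • g, ?_⟩
  filter_upwards [Lp.coeFn_smul z f, hg] with x h1 h2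
  rw [h1, Pi.smul_apply, h2]
  rfl

lemma isFieldResolvent_of_isJacobiResolvent {μ : ℝ} {R : Fock s →L[ℂ] Fock s}
    (hR : IsJacobiResolvent (creation f) μ R) : IsFieldResolvent μ f R := by
  have h : ∀ Ψ : ∀ n, Particles s n, fieldAction f Ψ = jacobi (creation f) Ψ := by
    intro Ψ
    ext1 n
    cases n <;> rfl
  intro Φ Ψ
  rw [hR Φ Ψ, fieldGraph, jacobiGraph]
  simp only [h]

lemma resolvent_mem {μ : ℝ} (hμ : μ ≠ 0) (hf : f ∈ testVectors s) {R : Fock s →L[ℂ] Fock s}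
    (hR : IsJacobiResolvent (creation f) μ R) : R ∈ resolventAlgebra s :=
  StarSubalgebra.le_topologicalClosure _
    (StarAlgebra.subset_adjoin ℂ _ ⟨μ, hμ, f, hf, isFieldResolvent_of_isJacobiResolvent hR⟩)

/-- The projection of the intertwined pairs to the single mode is injective by `ext_on_vacuum`. An
injective *-homomorphism of C*-algebras is isometric, so its range is closed. The range contains all
resolvents of the single mode, hence the matrix units. -/
lemma exists_intertwined_rankOne (hf : ‖f‖ = 1) (hft : f ∈ testVectors s) (j k : ℕ) :
    ∃ A : Fock s →L[ℂ] Fock s,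
      (A, InnerProductSpace.rankOne ℂ (modeBasis j) (modeBasis k)) ∈ intertwined hf := by
  have : IsClosed (intertwined hf : Set ((Fock s →L[ℂ] Fock s) × (Mode →L[ℂ] Mode))) :=
    isClosed_intertwined hf
  let φ : intertwined hf →⋆ₐ[ℂ] (Mode →L[ℂ] Mode) :=
    (StarAlgHom.snd ℂ (Fock s →L[ℂ] Fock s) (Mode →L[ℂ] Mode)).comp (intertwined hf).subtype
  have hinj : Function.Injective φ := by
    rintro ⟨⟨A, a⟩, hA⟩ ⟨⟨B, b⟩, hB⟩ hab
    obtain rfl : a = b := hab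
    refine Subtype.ext (Prod.ext (ext_on_vacuum hf fun κ h j => ?_) rfl)
    have h1 := DFunLike.congr_fun (hA.2 κ h).1 (modeBasis j)
    have h2 := DFunLike.congr_fun (hB.2 κ h).1 (modeBasis j)
    rw [← embeddingL_modeBasis hf h]
    exact h1.trans h2.symm
  have hiso : Isometry φ := NonUnitalStarAlgHom.isometry φ hinj
  have hcl : IsClosed (φ.range : Set (Mode →L[ℂ] Mode)) := by
    have := this.completeSpace_coe
    change IsClosed (Set.range φ)
    exact hiso.isClosedEmbedding.isClosed_range
  have hmem := rankOne_modeBasis_mem hcl (fun z hz μ hμ r hr => ?_) j k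
  · obtain ⟨⟨⟨A, a⟩, hA⟩, hAa⟩ := hmem
    obtain rfl : a = _ := hAa
    exact ⟨A, hA⟩
  · have hB : ∀ n, ‖creation (z • f) n‖ ≤ 1 * Real.sqrt (n + 1) := fun n => by
      have := norm_creation_le (z • f) n
      rwa [norm_smul, hz, hf, one_mul] at this
    obtain ⟨R, hR, -⟩ := exists_isJacobiResolvent hB hμ
    exact ⟨⟨(R, r), resolvent_mem hμ (smul_mem_testVectors z hft) hR, fun κ h =>
      ⟨resolvent_comp_embeddingL hf h hz hμ hR hr,
        adjoint_resolvent_comp_embeddingL hf h hz hμ hR hr⟩⟩, rfl⟩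

/-- This operator maps W^kκ to W^jκ and kills W^lκ for l ≠ k, so it coincides with the operator that
corresponds to the matrix unit. -/
lemma W_pow_mul_sub_mul_mem (hf : ‖f‖ = 1) (hft : f ∈ testVectors s) (j k : ℕ) :
    W f ^ j * (1 - W f * star (W f)) * star (W f) ^ k ∈ resolventAlgebra s := by
  obtain ⟨A, hA⟩ := exists_intertwined_rankOne hf hft j k
  convert hA.1 using 1
  refine ext_on_vacuum hf fun κ h l => ?_
  have h1 := DFunLike.congr_fun (hA.2 κ h).1 (modeBasis l)
  change A (embeddingL hf h (modeBasis l)) = embeddingL hf h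
    (InnerProductSpace.rankOne ℂ (modeBasis j) (modeBasis k) (modeBasis l)) at h1
  rw [embeddingL_modeBasis, InnerProductSpace.rankOne_apply, inner_modeBasis_left, map_smul,
    embeddingL_modeBasis, modeBasis_apply] at h1
  change _ = A _
  rw [h1, mul_apply_eq_comp, mul_apply_eq_comp, star_W_pow_W_pow hf h.star_W, sub_apply,
    one_apply_eq_self, mul_apply_eq_comp]
  split_ifs with hkl hl hl
  · subst hl
    rw [Nat.sub_self, pow_zero, one_apply_eq_self, h.star_W, map_zero, sub_zero, one_smul]
  · obtain ⟨m, hm⟩ : ∃ m, l - k = m + 1 := ⟨l - k - 1, by omega⟩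
    rw [hm, pow_succ' (W f) m, mul_apply_eq_comp, star_W_W hf, sub_self, map_zero, zero_smul]
  · omega
  · simp

/-- On the states with at most `n` particles, `W_f*` agrees with a tensor of degree `-1` in the
resolvent algebra. -/
lemma exists_tensor_eq_star_W (hf : ‖f‖ = 1) (hft : f ∈ testVectors s) (n : ℕ) :
    ∃ T ∈ resolventAlgebra s, IsTensor (-1) T ∧ T * atMost s n = star (W f) * atMost s n := by
  -- This is the Wold decomposition of W*Ψ. Its remainder W^nW*^{n+1}Ψ vanishes when Ψ has at most n
  -- particles.
  refine ⟨∑ j ∈ Finset.range n, W f ^ j * (1 - W f * star (W f)) * star (W f) ^ (j + 1),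
    sum_mem fun j _ => W_pow_mul_sub_mul_mem hf hft j (j + 1), ?_, ?_⟩
  · have h1 := isTensor_W hf
    have h2 : IsTensor 0 (1 - W f * star (W f)) := isTensor_one.sub (by simpa using h1.mul h1.star)
    refine Finset.sum_induction _ (IsTensor (-1)) (fun _ _ => IsTensor.add) (IsTensor.zero _)
      fun j _ => ?_
    have := ((h1.pow j).mul h2).mul (h1.star.pow (j + 1))
    convert this using 1
    push_cast
    ring
  · ext1 Ψ
    have h0 : (star (W f) ^ (n + 1)) (atMost s n Ψ) = 0 :=
      star_W_pow_apply_eq_zero hf fun k hk => by rw [atMost_apply, if_neg (by omega)]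
    have h1 := sub_W_pow (f := f) n (star (W f) (atMost s n Ψ))
    have h2 : ∀ i, (star (W f) ^ i) (star (W f) (atMost s n Ψ))
        = (star (W f) ^ (i + 1)) (atMost s n Ψ) := fun i => by rw [pow_succ, mul_apply_eq_comp]
    simp only [h2, h0, map_zero, add_zero] at h1
    rw [mul_apply_eq_comp, mul_apply_eq_comp, h1, sum_apply]
    rfl

end Transfer

/-! ### Norm preserving extensions of restrictions -/

section Cutoff

variable {H : Type*} [NormedAddCommGroup H] [InnerProductSpace ℂ H] [CompleteSpace H]

/-- The function which is `1` up to `c²` and `c t^{-1/2}` from there on. -/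
def cutoff (c t : ℝ) : ℝ := c / max c (Real.sqrt t)

variable {c : ℝ} (hc : 0 < c)

include hc

lemma continuous_cutoff : Continuous (cutoff c) := by
  unfold cutoff
  exact continuous_const.div (by fun_prop) fun t => (lt_max_of_lt_left hc).ne'

lemma cutoff_mul_le {t : ℝ} (ht : 0 ≤ t) : ‖cutoff c t * (t * cutoff c t)‖ ≤ c ^ 2 := by
  have h0 : 0 < max c (Real.sqrt t) := lt_max_of_lt_left hc
  have h1 : Real.sqrt t ≤ max c (Real.sqrt t) := le_max_right _ _
  have h2 : Real.sqrt t / max c (Real.sqrt t) ≤ 1 := div_le_one_of_le₀ h1 h0.le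
  have e : cutoff c t * (t * cutoff c t) = c ^ 2 * (Real.sqrt t / max c (Real.sqrt t)) ^ 2 := by
    rw [cutoff, div_pow, Real.sq_sqrt ht]
    ring
  rw [e, Real.norm_of_nonneg (by positivity)]
  exact mul_le_of_le_one_right (by positivity) (pow_le_one₀ (by positivity) h2)

lemma mul_sq_one_sub_cutoff_le {t : ℝ} (ht : 0 ≤ t) :
    c ^ 2 * (1 - cutoff c t) ^ 2 ≤ t * (1 - cutoff c t) ^ 2 := by
  rcases le_total (Real.sqrt t) c with h | h
  · rw [cutoff, max_eq_left h, div_self hc.ne']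
    simp
  · refine mul_le_mul_of_nonneg_right ?_ (sq_nonneg _)
    exact (Real.le_sqrt hc.le ht).1 h

variable (x : H →L[ℂ] H)

lemma norm_mul_cutoff_le : ‖x * cfc (cutoff c) (star x * x)‖ ≤ c := by
  set y := star x * x with hy
  have hy0 : 0 ≤ y := star_mul_self_nonneg x
  have hsa : IsSelfAdjoint y := IsSelfAdjoint.of_nonneg hy0
  have hcont := (continuous_cutoff hc).continuousOn (s := spectrum ℝ y)
  have hg : star (cfc (cutoff c) y) = cfc (cutoff c) y := (cfc_predicate (cutoff c) y).star_eq
  have e : star (x * cfc (cutoff c) y) * (x * cfc (cutoff c) y)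
      = cfc (fun t => cutoff c t * (t * cutoff c t)) y := by
    rw [star_mul, hg, mul_assoc, ← mul_assoc (star x), ← hy,
      cfc_mul (cutoff c) (fun t => t * cutoff c t) y hcont (by fun_prop),
      cfc_mul (fun t => t) (cutoff c) y (by fun_prop) hcont, cfc_id' ℝ y]
  have h1 : ‖x * cfc (cutoff c) y‖ * ‖x * cfc (cutoff c) y‖ ≤ c ^ 2 := by
    rw [← CStarRing.norm_star_mul_self, e]
    exact norm_cfc_le (by positivity) fun t ht =>
      cutoff_mul_le hc (spectrum_nonneg_of_nonneg hy0 ht)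
  rw [← sq] at h1
  exact (pow_le_pow_iff_left₀ (norm_nonneg _) hc.le two_ne_zero).1 h1

/-- Let h = 1 - g(x*x) with g the cutoff; it lives where x*x ≥ c². A vector v = hPΨ is in the range
of P, since h and P commute, and c‖v‖ ≤ ‖xv‖ ≤ ‖xP‖‖v‖ with ‖xP‖ < c forces v = 0. -/
lemma cutoff_mul_eq {P : H →L[ℂ] H} (hP : P * P = P) (hcomm : Commute P (star x * x))
    (hx : ‖x * P‖ < c) : cfc (cutoff c) (star x * x) * P = P := by
  set y := star x * x with hy
  have hy0 : 0 ≤ y := star_mul_self_nonneg x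
  have hsa : IsSelfAdjoint y := IsSelfAdjoint.of_nonneg hy0
  have hcont := (continuous_cutoff hc).continuousOn (s := spectrum ℝ y)
  set h := cfc (fun t => 1 - cutoff c t) y with hh
  have hhsa : star h = h := (cfc_predicate (fun t => 1 - cutoff c t) y).star_eq
  have hgh : h = 1 - cfc (cutoff c) y := by
    rw [hh, cfc_sub (fun _ => 1) (cutoff c) y (by fun_prop) hcont, cfc_const_one ℝ y]
  have hhP : Commute h P := hcomm.symm.cfc_real _
  have hle : (c ^ 2 : ℝ) • (h * h) ≤ h * (y * h) := by
    have e1 : (c ^ 2 : ℝ) • (h * h) = cfc (fun t => c ^ 2 * (1 - cutoff c t) ^ 2) y := by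
      rw [cfc_const_mul (c ^ 2) (fun t => (1 - cutoff c t) ^ 2) y (by fun_prop),
        cfc_pow (fun t => 1 - cutoff c t) 2 y (by fun_prop), sq h]
    have e2 : h * (y * h) = cfc (fun t => t * (1 - cutoff c t) ^ 2) y := by
      rw [cfc_mul (fun t => t) (fun t => (1 - cutoff c t) ^ 2) y (by fun_prop) (by fun_prop),
        cfc_pow (fun t => 1 - cutoff c t) 2 y (by fun_prop), cfc_id' ℝ y, ← hh, sq,
        ← mul_assoc h y h, ← mul_assoc y h h,
        (Commute.cfc_real (Commute.refl y) _ : Commute h y).eq]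
    rw [e1, e2]
    exact cfc_mono (fun t ht => mul_sq_one_sub_cutoff_le hc (spectrum_nonneg_of_nonneg hy0 ht))
      (by fun_prop) (by fun_prop)
  have hzero : h * P = 0 := by
    ext1 Ψ
    set v := h (P Ψ) with hv
    have hPv : P v = v := by
      have h1 : P * (h * P) = h * P := by rw [← mul_assoc, ← hhP.eq, mul_assoc, hP]
      exact DFunLike.congr_fun h1 Ψ
    have hxv : ‖x v‖ ≤ ‖x * P‖ * ‖v‖ := by
      conv_lhs => rw [← hPv]
      exact (x * P).le_opNorm v
    have hpos := ((ContinuousLinearMap.nonneg_iff_isPositive _).1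
      (sub_nonneg.2 hle)).inner_nonneg_right (P Ψ)
    have hin : ∀ u w : H, inner ℂ u (h w) = (inner ℂ (h u) w : ℂ) := fun u w => by
      conv_rhs => rw [← hhsa, ContinuousLinearMap.star_eq_adjoint,
        ContinuousLinearMap.adjoint_inner_left]
    have e1 : inner ℂ (P Ψ) ((h * (y * h)) (P Ψ)) = (‖x v‖ ^ 2 : ℂ) := by
      change inner ℂ (P Ψ) (h (star x (x v))) = _
      rw [hin, ContinuousLinearMap.star_eq_adjoint, ContinuousLinearMap.adjoint_inner_right,
        inner_self_eq_norm_sq_to_K]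
      rfl
    have e2 : inner ℂ (P Ψ) (((c ^ 2 : ℝ) • (h * h)) (P Ψ)) = (c ^ 2 * ‖v‖ ^ 2 : ℂ) := by
      change inner ℂ (P Ψ) ((c ^ 2 : ℝ) • h v) = _
      rw [← Complex.coe_smul, inner_smul_right, hin, inner_self_eq_norm_sq_to_K]
      push_cast
      rfl
    rw [sub_apply, inner_sub_right, e1, e2] at hpos
    have h2 : c ^ 2 * ‖v‖ ^ 2 ≤ ‖x v‖ ^ 2 := by
      have := (Complex.le_def.1 hpos).1
      rw [← Complex.ofReal_pow, ← Complex.ofReal_pow, ← Complex.ofReal_pow, ← Complex.ofReal_mul,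
        ← Complex.ofReal_sub, Complex.ofReal_re, Complex.zero_re] at this
      exact sub_nonneg.1 this
    rw [← mul_pow] at h2
    have h3 : c * ‖v‖ ≤ ‖x v‖ :=
      (pow_le_pow_iff_left₀ (by positivity) (norm_nonneg _) two_ne_zero).1 h2
    have h4 : ‖v‖ = 0 := by
      have := norm_nonneg v
      by_contra hne
      have : 0 < ‖v‖ := lt_of_le_of_ne this (Ne.symm hne)
      nlinarith
    exact norm_eq_zero.1 h4
  rw [hgh, sub_mul, one_mul, sub_eq_zero] at hzero
  exact hzero.symm

lemma exists_cutoff : ∃ g : H →L[ℂ] H,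
    (∀ 𝔟 : StarSubalgebra ℂ (H →L[ℂ] H), IsClosed (𝔟 : Set (H →L[ℂ] H)) → star x * x ∈ 𝔟 → g ∈ 𝔟) ∧
    (∀ S, Commute S (star x * x) → Commute S g) ∧ ‖x * g‖ ≤ c ∧
    ∀ P, P * P = P → Commute P (star x * x) → ‖x * P‖ < c → g * P = P :=
  ⟨cfc (cutoff c) (star x * x), fun _ hcl h => cfc_mem (hs := hcl) (cutoff c) h,
    fun _ hS => (hS.symm.cfc_real _).symm, norm_mul_cutoff_le hc x,
    fun _ hP hcomm h => cutoff_mul_eq hc x hP hcomm h⟩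

end Cutoff

/-! ### Lifting restrictions of tensors with norm control. -/

section Lift

variable {s : ℕ}

/-- The tensors of degree `m` in the resolvent algebra. -/
def tensors (s : ℕ) (m : ℤ) : Submodule ℂ (Fock s →L[ℂ] Fock s) where
  carrier := {T | T ∈ resolventAlgebra s ∧ IsTensor m T}
  zero_mem' := ⟨zero_mem _, IsTensor.zero m⟩
  add_mem' h h' := ⟨add_mem h.1 h'.1, h.2.add h'.2⟩
  smul_mem' c _ h := ⟨(resolventAlgebra s).toSubalgebra.smul_mem h.1 c, h.2.smul c⟩

instance (s : ℕ) (m : ℤ) : CompleteSpace (tensors s m) := by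
  have : IsClosed (tensors s m : Set (Fock s →L[ℂ] Fock s)) :=
    (isClosed_resolventAlgebra s).inter (isClosed_isTensor m)
  exact this.completeSpace_coe

lemma tensors_le_tensorSpace {m : ℤ} {M : ℕ} (h : |m| ≤ M) : tensors s m ≤ tensorSpace s M :=
  fun _ hT => Submodule.le_topologicalClosure _ (Submodule.subset_span ⟨hT.1, m, h, hT.2⟩)

lemma atMost_mul_self (n : ℕ) : atMost s n * atMost s n = atMost s n := truncate_mul_self n

/-- The tensor x is multiplied by a cutoff function of x*x at height 2‖xP_n‖; the factor 2 provides
the strict inequality needed there. As x*x has degree 0 it commutes with P_n, and the cutoff keeps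
the degree and stays in the resolvent algebra. -/
lemma exists_tensor_norm_le {m : ℤ} {x : Fock s →L[ℂ] Fock s} (hx : x ∈ tensors s m) (n : ℕ) :
    ∃ x' ∈ tensors s m, x' * atMost s n = x * atMost s n ∧ ‖x'‖ ≤ 2 * ‖x * atMost s n‖ := by
  by_cases h0 : x * atMost s n = 0
  · exact ⟨0, zero_mem _, by rw [h0, zero_mul], by simp⟩
  have hn : 0 < ‖x * atMost s n‖ := norm_pos_iff.2 h0
  have hc : 0 < 2 * ‖x * atMost s n‖ := by positivity
  have hy : IsTensor 0 (star x * x) := by simpa using hx.2.star.mul hx.2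
  obtain ⟨g, hmem, hcomm, hnorm, hg⟩ := exists_cutoff hc x
  have hg0 : IsTensor 0 g := isTensor_of_commute_gauge fun u => hcomm _ (hy.commute_gauge u)
  refine ⟨x * g, ⟨mul_mem hx.1 (hmem _ (isClosed_resolventAlgebra s)
    (mul_mem (star_mem hx.1) hx.1)), by simpa using hx.2.mul hg0⟩, ?_, hnorm⟩
  rw [mul_assoc, hg _ (atMost_mul_self n) (hy.commute_atMost n) (by linarith)]

/-- The restrictions of the tensors of degree `m` to the states with at most `n` particles form
a closed set. -/
lemma exists_tensor_of_tendsto {m : ℤ} {n : ℕ} {u : ℕ → Fock s →L[ℂ] Fock s}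
    {A : Fock s →L[ℂ] Fock s} (hu : ∀ k, ∃ T ∈ tensors s m, T * atMost s n = u k)
    (hA : Tendsto u atTop (𝓝 A)) : ∃ T ∈ tensors s m, T * atMost s n = A := by
  let φ : NormedAddGroupHom (tensors s m) (Fock s →L[ℂ] Fock s) :=
    AddMonoidHom.mkNormedAddGroupHom
      ((AddMonoidHom.mulRight (atMost s n)).comp (tensors s m).subtype.toAddMonoidHom)
      ‖atMost s n‖ fun T => (norm_mul_le _ _).trans_eq (mul_comm _ _)
  have hφ : ∀ T, φ T = T * atMost s n := fun T => rfl
  -- Every restriction has a preimage of at most twice its norm. With completeness of the space of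
  -- tensors this lets a limit of restrictions be lifted by a convergent series.
  have hsurj : φ.SurjectiveOnWith φ.range 2 := by
    rintro _ ⟨T, rfl⟩
    obtain ⟨T', hT', h1, h2⟩ := exists_tensor_norm_le T.2 n
    exact ⟨⟨T', hT'⟩, h1, h2⟩
  have hcl : A ∈ φ.range.topologicalClosure := by
    refine mem_closure_of_tendsto hA (Eventually.of_forall fun k => ?_)
    obtain ⟨T, hT, h⟩ := hu k
    exact ⟨⟨T, hT⟩, h⟩
  obtain ⟨T, hT, -⟩ := controlled_closure_of_complete two_pos one_pos hsurj A hcl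
  exact ⟨T, T.2, hT⟩

end Lift

/-! ### Limits of the operators `W_f*` -/

section Limit

variable {s : ℕ} {f : ℕ → OneParticle s} {f_lim : OneParticle s}

lemma tendsto_star_W_mul_atMost (hf : ∀ k, ‖f k‖ = 1) (hlim : ‖f_lim‖ = 1)
    (h : Tendsto f atTop (𝓝 f_lim)) (n : ℕ) :
    Tendsto (fun k => star (W (f k)) * atMost s n) atTop (𝓝 (star (W f_lim) * atMost s n)) := by
  obtain ⟨L, -, hLip⟩ := exists_lipschitz_star_W s n
  rw [tendsto_iff_norm_sub_tendsto_zero] at h ⊢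
  have h0 := h.const_mul L
  rw [mul_zero] at h0
  refine squeeze_zero (fun _ => norm_nonneg _) (fun k => ?_) h0
  rw [← sub_mul]
  exact hLip _ _ (hf k) hlim

lemma tendsto_star_W_apply (hf : ∀ k, ‖f k‖ = 1) (hlim : ‖f_lim‖ = 1)
    (h : Tendsto f atTop (𝓝 f_lim)) (Ψ : Fock s) :
    Tendsto (fun k => star (W (f k)) Ψ) atTop (𝓝 (star (W f_lim) Ψ)) := by
  rw [Metric.tendsto_atTop]
  intro ε hε
  obtain ⟨Φ, hΦ, hΨΦ⟩ := Metric.mem_closure_iff.1 (dense_finiteVectors Ψ) (ε / 3) (by positivity)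
  obtain ⟨n, hn⟩ := hΦ
  have hP : atMost s n Φ = Φ := lp.ext (funext fun k => by
    rw [atMost_apply]
    split_ifs with hk
    · rfl
    · exact (hn k (by omega)).symm)
  have h1 : Tendsto (fun k => star (W (f k)) Φ) atTop (𝓝 (star (W f_lim) Φ)) := by
    have h2 := ((ContinuousLinearMap.apply ℂ (Fock s) Φ).continuous.tendsto _).comp
      (tendsto_star_W_mul_atMost hf hlim h n)
    have h3 : ∀ g : OneParticle s, (star (W g) * atMost s n) Φ = star (W g) Φ := fun g => by
      rw [mul_apply_eq_comp, hP]
    rw [← h3]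
    refine h2.congr fun k => ?_
    exact h3 (f k)
  obtain ⟨N, hN⟩ := Metric.tendsto_atTop.1 h1 (ε / 3) (by positivity)
  have hb : ∀ g : OneParticle s, ‖g‖ = 1 → dist (star (W g) Ψ) (star (W g) Φ) < ε / 3 :=
    fun g hg => by
      rw [dist_eq_norm] at hΨΦ ⊢
      rw [← map_sub]
      refine lt_of_le_of_lt ?_ hΨΦ
      simpa using (star (W g)).le_of_opNorm_le (norm_star_W_le hg) (Ψ - Φ)
  refine ⟨N, fun k hk => ?_⟩
  have h2 := dist_triangle4 (star (W (f k)) Ψ) (star (W (f k)) Φ) (star (W f_lim) Φ)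
    (star (W f_lim) Ψ)
  have h3 := hb f_lim hlim
  rw [dist_comm] at h3
  linarith [hb (f k) (hf k), hN k hk]

/-- No closure is needed: with M = 1, each restriction W*P_n is a limit of restrictions of degree -1
tensors, hence itself such a restriction. -/
lemma star_W_mem_fieldAlgebra (hft : ∀ k, f k ∈ testVectors s) (hf : ∀ k, ‖f k‖ = 1)
    (hlim : ‖f_lim‖ = 1) (h : Tendsto f atTop (𝓝 f_lim)) : star (W f_lim) ∈ fieldAlgebra s := by
  refine subset_closure ⟨1, fun n => ?_⟩
  obtain ⟨T, hT, hTn⟩ := exists_tensor_of_tendsto (m := -1) (fun k => by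
    obtain ⟨T, hT, hT', hTn⟩ := exists_tensor_eq_star_W (hf k) (hft k) n
    exact ⟨T, ⟨hT, hT'⟩, hTn⟩) (tendsto_star_W_mul_atMost hf hlim h n)
  exact ⟨T, tensors_le_tensorSpace (by simp) hT, hTn.symm⟩

end Limit

end BoseFock

end

open BoseFock in
theorem lemma5p1 (s : ℕ) :
    (∀ n : ℕ, ∃ c : ℝ, ∀ f₁ ∈ testVectors s, ∀ f₂ ∈ testVectors s, ‖f₁‖ = 1 → ‖f₂‖ = 1 →
      ‖(star (W f₁) - star (W f₂)) * atMost s n‖ ≤ c * ‖f₁ - f₂‖) ∧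
    (∀ (f : ℕ → OneParticle s) (f_lim : OneParticle s),
      (∀ k, f k ∈ testVectors s ∧ ‖f k‖ = 1) → Tendsto f atTop (𝓝 f_lim) →
      (∀ n : ℕ, CauchySeq fun k => star (W (f k)) * atMost s n) ∧
      (∀ Ψ : Fock s, Tendsto (fun k => star (W (f k)) Ψ) atTop (𝓝 (star (W f_lim) Ψ))) ∧
      star (W f_lim) * W f_lim = 1 ∧
      IsTensor (-1) (star (W f_lim)) ∧
      star (W f_lim) ∈ fieldAlgebra s) := by
  refine ⟨fun n => ?_, fun f f_lim hf h => ?_⟩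
  · obtain ⟨L, -, hL⟩ := exists_lipschitz_star_W s n
    exact ⟨L, fun f _ g _ hf hg => hL f g hf hg⟩
  · have hn : ∀ k, ‖f k‖ = 1 := fun k => (hf k).2
    have hlim : ‖f_lim‖ = 1 := tendsto_nhds_unique h.norm (by simp [hn])
    exact ⟨fun n => (tendsto_star_W_mul_atMost hn hlim h n).cauchySeq,
      tendsto_star_W_apply hn hlim h, star_W_mul_W hlim, (isTensor_W hlim).star,
      star_W_mem_fieldAlgebra (fun k => (hf k).1) hn hlim h⟩
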